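/- **Setting.** Let $G$ be a compact connected Lie group with Lie algebra $\mathfrak g$, let $\cdot$ be an $\mathrm{Ad}$-invariant inner product on $\mathfrak g$, let $\beta\in Z(G)$ and let $g\ge 0$ be an integer. Let $\theta,\bar\theta\in\Omega^1(G)\otimes\mathfrak g$ be the left- and right-invariant Maurer–Cartan forms, and put $$\lambda=\tfrac16\,\theta\cdot[\theta,\theta]\in\Omega^3(G),\qquad \theta_\eta=\eta\cdot(\theta+\bar\theta)\in\Omega^1(G)\ (\eta\in\mathfrak g),\qquad \Omega=\pi_1^*\theta\cdot\pi_2^*\bar\theta\in\Omega^2(G\times G),$$ with the wedge convention $(\alpha\cdot\alpha')(u,v)=\alpha(u)\cdot\alpha'(v)-\alpha(v)\cdot\alpha'(u)$, $[\theta,\theta](u,v)=2[\theta(u),\theta(v)]$, so that $\lambda(u,v,w)=\theta(u)\cdot[\theta(v),\theta(w)]$. Let $F$ be the free group on $x_1,\dots,x_{2g}$, let $R=\prod_{i=1}^g[x_{2i-1},x_{2i}]$ with $[a,b]=aba^{-1}b^{-1}$, and identify $\mathrm{Hom}(F,G)$ with $G^{2g}$. Let $\partial R/\partial x_i\in\mathbb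 Z[F]$ be the Fox derivatives, let $c=\sum_{i=1}^{2g}(\partial R/\partial x_i,x_i)$, extended $\mathbb Z$-linearly to an integral combination of elements $(a,b)\in F\times F$, $c=\sum c_{a,b}\,(a,b)$, and let $$\omega=\sum_{(a,b)}c_{a,b}\,E_{a,b}^*\Omega\in\Omega^2(G^{2g}),\qquad E_{a,b}(h)=(h(a),h(b)).$$ Let $\epsilon_R:G^{2g}\to G$, $h\mapsto h(R)$, let $e_\beta=\beta\cdot\exp:\mathfrak g\to G$, let $I$ be the homotopy operator of the Poincaré lemma on $\mathfrak g$, $(I\gamma)_v=\int_0^1F_t^*(\iota_{\bar v}\gamma)\,dt$ evaluated at $v$, where $F_t$ is multiplication by $t$ and $\bar v$ is the constant vector field with value $v$, and let $\sigma=I(\exp^*\lambda)\in\Omega^2(\mathfrak g)$. Put $$X_\beta=\{(h,\Lambda)\in G^{2g}\times\mathfrak g:\ \epsilon_R(h)=e_\beta(\Lambda)\},\qquad \tilde\omega=\mathrm{pr}_1^*\omega+\mathrm{pr}_2^*\sigma .$$ For $(h,\Lambda)\in X_\beta$ the (Zariski) tangent space $T_{(h,\Lambda)}X_\beta$ consists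 of the $(H,\zeta)\in T_hG^{2g}\times\mathfrak g$ with $(d\epsilon_R)_hH=(de_\beta)_\Lambda\zeta$; forms on $X_\beta$ are restricted to these spaces. $G$ acts on $G^{2g}\times\mathfrak g$ by conjugation on each factor $G$ and by $\mathrm{Ad}$ on $\mathfrak g$; $\tilde\eta$ denotes the vector field generated by $\eta\in\mathfrak g$, $\tilde\eta_x=\frac{d}{dt}\big|_{0}\exp(t\eta)\cdot x$. **Proposition.** The $G$-action on $X_\beta$ is Hamiltonian with respect to $\tilde\omega$, with $G$-equivariant moment map $\mu=2\,\mathrm{pr}_2:X_\beta\to\mathfrak g$, $(h,\Lambda)\mapsto 2\Lambda$ (where $\mathfrak g^*$ is identified with $\mathfrak g$ by the inner product; nondegeneracy of $\tilde\omega$ is not part of the claim). That is: 1. the action of $G$ preserves $X_\beta$ and its tangent spaces, and $\tilde\eta$ is tangent to $X_\beta$ for every $\eta\in\mathfrak g$; 2. on $X_\beta$ the form $\tilde\omega$ is closed and $G$-invariant: $d\tilde\omega$ vanishes on triples of vectors of $T_xX_\beta$, and each $a\in G$ preserves $\tilde\omega$ on $TX_\beta$; 3. $\iota_{\tilde\eta}\tilde\omega=\eta\cdot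 d\mu$ on $TX_\beta$ for every $\eta\in\mathfrak g$, that is, $\tilde\omega_{(h,\Lambda)}(\tilde\eta,(H,\zeta))=2\,\eta\cdot\zeta$ for $(h,\Lambda)\in X_\beta$ and $(H,\zeta)\in T_{(h,\Lambda)}X_\beta$; 4. $\mu(a\cdot x)=\mathrm{Ad}_a\,\mu(x)$ for $a\in G$, $x\in X_\beta$. Moreover $\iota_{\tilde\eta}\tilde\omega=\mathrm{pr}_2^*\,d(I\,e_\beta^*\theta_\eta)$ on $TX_\beta$, and $(I\,e_\beta^*\theta_\eta)(\Lambda)=\eta\cdot 2\Lambda$ for all $\eta,\Lambda\in\mathfrak g$. -/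

import Mathlib

open scoped Manifold ContDiff

noncomputable section

namespace ExtendedModuli

/-! ### Differential forms on manifolds without boundary -/

section Forms

variable {E : Type*} [NormedAddCommGroup E] [NormedSpace ℝ E]
  {H : Type*} [TopologicalSpace H]
  {F : Type*} [NormedAddCommGroup F] [NormedSpace ℝ F]
  {K : Type*} [TopologicalSpace K]

/-- Real-valued `n`-forms on a manifold `M`: an alternating `n`-linear form on each tangent
space. -/
abbrev DForm (I : ModelWithCorners ℝ E H) (M : Type*) [TopologicalSpace M] [ChartedSpace H M]
    (n : ℕ) : Type _ :=
  ∀ x : M, TangentSpace I x [⋀^Fin n]→L[ℝ] ℝ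

/-- The pullback `f^* ψ` of a form by a map. -/
def DForm.pullback (I : ModelWithCorners ℝ E H) (J : ModelWithCorners ℝ F K)
    {M : Type*} [TopologicalSpace M] [ChartedSpace H M]
    {N : Type*} [TopologicalSpace N] [ChartedSpace K N] {n : ℕ}
    (f : M → N) (ψ : DForm J N n) : DForm I M n :=
  fun x => (ψ (f x)).compContinuousLinearMap (mfderiv I J f x)

/-- The exterior derivative of a form on a manifold without boundary, computed in the preferred
chart at the point: transport the form to the model space, apply the exterior derivative there,
and transport back. -/
def DForm.d (I : ModelWithCorners ℝ E H) [I.Boundaryless]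
    {M : Type*} [TopologicalSpace M] [ChartedSpace H M] {n : ℕ}
    (ψ : DForm I M n) : DForm I M (n + 1) :=
  fun x => (extDeriv (E := E) (DForm.pullback 𝓘(ℝ, E) I (extChartAt I x).symm ψ)
    (extChartAt I x x)).compContinuousLinearMap (mfderiv I 𝓘(ℝ, E) (extChartAt I x) x)

/-- The homotopy operator of the Poincaré lemma on a vector space `V`:
`(I γ)_v = ∫_0^1 F_t^* (ι_v γ) dt`, where `F_t` is multiplication by `t`. -/
def homotopyOp {V : Type*} [NormedAddCommGroup V] [NormedSpace ℝ V] {n : ℕ}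
    (γ : V → V [⋀^Fin (n + 1)]→L[ℝ] ℝ) : V → V [⋀^Fin n]→L[ℝ] ℝ :=
  fun v => ∫ t in (0 : ℝ)..1,
    ((γ (t • v)).curryLeft v).compContinuousLinearMap (t • ContinuousLinearMap.id ℝ V)

/-- The product of two boundaryless models indexed by a finite type is boundaryless. -/
instance boundaryless_pi {ι : Type*} [Fintype ι] (I : ι → ModelWithCorners ℝ E H)
    [h : ∀ i, (I i).Boundaryless] : (ModelWithCorners.pi I).Boundaryless where
  range_eq_univ := by
    refine Set.eq_univ_of_forall fun y => ?_
    have : ∀ i, ∃ x, I i x = y i := fun i => by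
      have h2 : y i ∈ Set.range (I i) := by rw [(h i).range_eq_univ]; trivial
      exact h2
    choose x hx using this
    exact ⟨x, funext hx⟩

end Forms

/-! ### Alternating forms built from vector-valued one-forms -/

section Products

variable {V : Type*} [AddCommGroup V] [Module ℝ V] [TopologicalSpace V]
  {E : Type*} [NormedAddCommGroup E] [NormedSpace ℝ E]

/-- The wedge product of two `E`-valued covectors, contracted with a bilinear form `B`:
`(α · β)(u, v) = B (α u) (β v) - B (α v) (β u)`. -/
def dotWedge (B : E →L[ℝ] E →L[ℝ] ℝ) (α β : V →L[ℝ] E) : V [⋀^Fin 2]→L[ℝ] ℝ where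
  toFun v := B (α (v 0)) (β (v 1)) - B (α (v 1)) (β (v 0))
  map_update_add' := by
    intro inst m i x y
    rcases (by fin_cases i <;> simp : i = 0 ∨ i = 1) with rfl | rfl <;>
      simp <;> ring
  map_update_smul' := by
    intro inst m i c x
    rcases (by fin_cases i <;> simp : i = 0 ∨ i = 1) with rfl | rfl <;>
      simp <;> ring
  map_eq_zero_of_eq' := by
    intro v i j h hij
    fin_cases i <;> fin_cases j <;> simp_all
  cont := by fun_prop

theorem fin3_cases (i : Fin 3) : i = 0 ∨ i = 1 ∨ i = 2 := by fin_cases i <;> simp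
theorem fin3_ne01 : (0 : Fin 3) ≠ 1 := by decide
theorem fin3_ne02 : (0 : Fin 3) ≠ 2 := by decide
theorem fin3_ne12 : (1 : Fin 3) ≠ 2 := by decide

/-- The form `α · [α, α]` for an `E`-valued covector `α` and an antisymmetric bilinear bracket
`br`. With the wedge convention, `[α, α](v, w) = br (α v) (α w) - br (α w) (α v)`
and the result is the sum of `B (α u) ([α, α](v, w))` over the cyclic permutations of
`(u, v, w)`. -/
def dotBracket (B : E →L[ℝ] E →L[ℝ] ℝ) (br : E →L[ℝ] E →L[ℝ] E) (α : V →L[ℝ] E) :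
    V [⋀^Fin 3]→L[ℝ] ℝ where
  toFun v :=
    B (α (v 0)) (br (α (v 1)) (α (v 2)) - br (α (v 2)) (α (v 1)))
    + B (α (v 1)) (br (α (v 2)) (α (v 0)) - br (α (v 0)) (α (v 2)))
    + B (α (v 2)) (br (α (v 0)) (α (v 1)) - br (α (v 1)) (α (v 0)))
  map_update_add' := by
    intro inst m i x y
    rcases fin3_cases i with rfl | rfl | rfl <;>
      simp only [Function.update_self, Function.update_of_ne fin3_ne01,
        Function.update_of_ne fin3_ne02, Function.update_of_ne fin3_ne12,
        Function.update_of_ne fin3_ne01.symm, Function.update_of_ne fin3_ne02.symm,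
        Function.update_of_ne fin3_ne12.symm, map_sub, map_add, add_apply] <;> ring
  map_update_smul' := by
    intro inst m i c x
    rcases fin3_cases i with rfl | rfl | rfl <;>
      simp only [Function.update_self, Function.update_of_ne fin3_ne01,
        Function.update_of_ne fin3_ne02, Function.update_of_ne fin3_ne12,
        Function.update_of_ne fin3_ne01.symm, Function.update_of_ne fin3_ne02.symm,
        Function.update_of_ne fin3_ne12.symm, map_sub, map_smul, smul_eq_mul, smul_apply] <;> ring
  map_eq_zero_of_eq' := by
    intro v i j h hij
    fin_cases i <;> fin_cases j <;> simp_all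
  cont := by fun_prop

end Products

/-! ### Lie groups

`G` is a Lie group modelled on the finite-dimensional space `E`. Its Lie algebra
`GroupLieAlgebra 𝓘(ℝ, E) G`, the tangent space at `1`, is the space `E` by definition; we write
`E` for it since the norm of `E` is then available. -/

section LieGroups

variable {E : Type*} [NormedAddCommGroup E] [NormedSpace ℝ E]
  (G : Type*) [TopologicalSpace G] [ChartedSpace E G] [Group G]

/-- The Lie bracket of the Lie algebra of `G`, as a continuous bilinear map. -/
def lieBr [FiniteDimensional ℝ E] [LieGroup 𝓘(ℝ, E) ∞ G] : E →L[ℝ] E →L[ℝ] E :=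
  haveI : CompleteSpace E := FiniteDimensional.complete ℝ E
  haveI : LieGroup 𝓘(ℝ, E) (minSmoothness ℝ 3) G := by
    rw [minSmoothness_of_isRCLikeNormedField]; infer_instance
  LinearMap.toContinuousLinearMap
    ((LinearMap.toContinuousLinearMap : (E →ₗ[ℝ] E) ≃ₗ[ℝ] (E →L[ℝ] E)).toLinearMap ∘ₗ
      (LinearMap.mk₂ ℝ (fun x y : GroupLieAlgebra 𝓘(ℝ, E) G => ⁅x, y⁆)
        add_lie smul_lie lie_add (fun c x y => lie_smul c x y) :
        GroupLieAlgebra 𝓘(ℝ, E) G →ₗ[ℝ] GroupLieAlgebra 𝓘(ℝ, E) G →ₗ[ℝ]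
          GroupLieAlgebra 𝓘(ℝ, E) G))

theorem lieBr_apply [FiniteDimensional ℝ E] [LieGroup 𝓘(ℝ, E) ∞ G]
    (x y : GroupLieAlgebra 𝓘(ℝ, E) G) : lieBr (E := E) G x y = ⁅x, y⁆ := rfl

variable {G}

/-- The adjoint action of `g` on the Lie algebra: the derivative at `1` of `x ↦ g x g⁻¹`. -/
def Ad (g : G) : E →L[ℝ] E := mfderiv 𝓘(ℝ, E) 𝓘(ℝ, E) (fun x : G => g * x * g⁻¹) 1

/-- The exponential map: `lieExp G ξ = γ 1`, where `γ` is the integral curve, starting at `1`,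
of the left-invariant vector field with value `ξ` at `1`. -/
def lieExp (G : Type*) [TopologicalSpace G] [ChartedSpace E G] [Group G] (ξ : E) : G :=
  Classical.epsilon fun x : G => ∃ γ : ℝ → G, γ 0 = 1 ∧
    IsMIntegralCurve (I := 𝓘(ℝ, E)) γ
      (fun g => mulInvariantVectorField (I := 𝓘(ℝ, E)) (ξ : GroupLieAlgebra 𝓘(ℝ, E) G) g) ∧
    γ 1 = x

/-- The left-invariant Maurer-Cartan form. -/
def mcL (g : G) : TangentSpace 𝓘(ℝ, E) g →L[ℝ] E :=
  mfderiv 𝓘(ℝ, E) 𝓘(ℝ, E) (fun x : G => g⁻¹ * x) g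

/-- The right-invariant Maurer-Cartan form. -/
def mcR (g : G) : TangentSpace 𝓘(ℝ, E) g →L[ℝ] E :=
  mfderiv 𝓘(ℝ, E) 𝓘(ℝ, E) (fun x : G => x * g⁻¹) g

/-- An invariant inner product on the Lie algebra of `G`. -/
structure IsInvariantInner (G : Type*) [TopologicalSpace G] [ChartedSpace E G] [Group G]
    (B : E →L[ℝ] E →L[ℝ] ℝ) : Prop where
  symm : ∀ x y, B x y = B y x
  pos : ∀ x, x ≠ 0 → 0 < B x x
  inv : ∀ (g : G) (x y : E), B (Ad g x) (Ad g y) = B x y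

/-- The 3-form `λ = (1/6) θ · [θ, θ]` on `G`, with `θ` the left-invariant Maurer-Cartan form. -/
def lambdaForm (G : Type*) [TopologicalSpace G] [ChartedSpace E G] [Group G]
    [FiniteDimensional ℝ E] [LieGroup 𝓘(ℝ, E) ∞ G] (B : E →L[ℝ] E →L[ℝ] ℝ) :
    DForm 𝓘(ℝ, E) G 3 :=
  fun g => (1 / 6 : ℝ) • dotBracket B (lieBr G) (mcL g)

/-- The 1-form `θ_η = η · (θ + θ̄)` on `G`. -/
def thetaForm (G : Type*) [TopologicalSpace G] [ChartedSpace E G] [Group G]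
    (B : E →L[ℝ] E →L[ℝ] ℝ) (η : E) : DForm 𝓘(ℝ, E) G 1 :=
  fun g => ContinuousAlternatingMap.ofSubsingleton ℝ (TangentSpace 𝓘(ℝ, E) g) ℝ (0 : Fin 1)
    ((B η).comp (mcL g + mcR g))

/-- The 2-form `Ω = θ_1 · θ̄_2` on `G × G`, where `θ_1` and `θ̄_2` are the pullbacks of the left-
and right-invariant Maurer-Cartan forms by the first and the second projection. -/
def OmegaForm (G : Type*) [TopologicalSpace G] [ChartedSpace E G] [Group G]
    (B : E →L[ℝ] E →L[ℝ] ℝ) : DForm (𝓘(ℝ, E).prod 𝓘(ℝ, E)) (G × G) 2 :=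
  fun p => dotWedge B
    ((mcL p.1).comp (mfderiv (𝓘(ℝ, E).prod 𝓘(ℝ, E)) 𝓘(ℝ, E) (Prod.fst : G × G → G) p))
    ((mcR p.2).comp (mfderiv (𝓘(ℝ, E).prod 𝓘(ℝ, E)) 𝓘(ℝ, E) (Prod.snd : G × G → G) p))

end LieGroups

/-! ### Fox calculus and the distinguished 2-chain -/

section Fox

variable {α : Type*}

/-- The action of the free group on the additive group of its integral group ring by left
multiplication. -/
def leftMulAut : FreeGroup α →*
    MulAut (Multiplicative (MonoidAlgebra ℤ (FreeGroup α))) where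
  toFun w := AddEquiv.toMultiplicative
    { toFun := fun a => MonoidAlgebra.of ℤ (FreeGroup α) w * a
      invFun := fun a => MonoidAlgebra.of ℤ (FreeGroup α) w⁻¹ * a
      left_inv := fun a => by beta_reduce; rw [← mul_assoc, ← map_mul, inv_mul_cancel, map_one, one_mul]
      right_inv := fun a => by beta_reduce; rw [← mul_assoc, ← map_mul, mul_inv_cancel, map_one, one_mul]
      map_add' := fun a b => mul_add _ a b }
  map_one' := by
    refine MulEquiv.ext fun a => congrArg Multiplicative.ofAdd ?_
    change MonoidAlgebra.of ℤ (FreeGroup α) 1 * _ = _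
    rw [map_one, one_mul]
    rfl
  map_mul' u v := by
    refine MulEquiv.ext fun a => congrArg Multiplicative.ofAdd ?_
    change MonoidAlgebra.of ℤ (FreeGroup α) (u * v) * _ = _
    rw [map_mul, mul_assoc]
    rfl

/-- The homomorphism `w ↦ (∂w/∂x_i, w)` into `ℤ[F] ⋊ F`, determined by `x_j ↦ (δ_{ij}, x_j)`. -/
def foxHom [DecidableEq α] (i : α) : FreeGroup α →*
    Multiplicative (MonoidAlgebra ℤ (FreeGroup α)) ⋊[leftMulAut] FreeGroup α :=
  FreeGroup.lift fun j => ⟨Multiplicative.ofAdd (if i = j then 1 else 0), FreeGroup.of j⟩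

/-- The Fox derivative `∂w/∂x_i`, an element of the integral group ring of the free group. -/
def foxDeriv [DecidableEq α] (i : α) (w : FreeGroup α) : MonoidAlgebra ℤ (FreeGroup α) :=
  Multiplicative.toAdd (foxHom i w).left

theorem foxHom_right [DecidableEq α] (i : α) (w : FreeGroup α) : (foxHom i w).right = w := by
  have : (SemidirectProduct.rightHom).comp (foxHom i) = MonoidHom.id (FreeGroup α) := by
    ext j
    simp [foxHom]
  exact DFunLike.congr_fun this w

theorem foxDeriv_of [DecidableEq α] (i j : α) :
    foxDeriv i (FreeGroup.of j) = if i = j then 1 else 0 := by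
  simp [foxDeriv, foxHom]

theorem foxDeriv_mul [DecidableEq α] (i : α) (u v : FreeGroup α) :
    foxDeriv i (u * v) = foxDeriv i u + MonoidAlgebra.of ℤ (FreeGroup α) u * foxDeriv i v := by
  have h := foxHom_right i u
  unfold foxDeriv
  rw [map_mul, SemidirectProduct.mul_left, h]
  rfl

/-- The relator `R = ∏_{i=1}^g [x_{2i-1}, x_{2i}]`, with `[a, b] = a b a⁻¹ b⁻¹` (the generators
are numbered from `0` here). -/
def relator (g : ℕ) : FreeGroup (Fin (2 * g)) :=
  (List.ofFn fun i : Fin g =>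
    let a : FreeGroup (Fin (2 * g)) := FreeGroup.of ⟨2 * i, by omega⟩
    let b : FreeGroup (Fin (2 * g)) := FreeGroup.of ⟨2 * i + 1, by omega⟩
    a * b * a⁻¹ * b⁻¹).prod

/-- The group 2-chain `c = ∑_i (∂R/∂x_i, x_i)`; 2-chains are the integral linear combinations of
elements of `F × F`. -/
def fundChain (g : ℕ) : (FreeGroup (Fin (2 * g)) × FreeGroup (Fin (2 * g))) →₀ ℤ :=
  ∑ i : Fin (2 * g),
    Finsupp.mapDomain (fun w => (w, FreeGroup.of i)) (foxDeriv i (relator g)).coeff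

end Fox

/-! ### The extended moduli space and its 2-form -/

section Moduli

/-- Evaluation on a word `w`: the map `Hom(F, G) = G^{2g} → G`, `h ↦ h(w)`. -/
def evalWord {G : Type*} [Group G] {g : ℕ} (w : FreeGroup (Fin (2 * g)))
    (h : Fin (2 * g) → G) : G :=
  FreeGroup.lift h w

/-- The map `ε_R : G^{2g} → G`. -/
def epsR {G : Type*} [Group G] {g : ℕ} (h : Fin (2 * g) → G) : G := evalWord (relator g) h

theorem epsR_eq {G : Type*} [Group G] {g : ℕ} (h : Fin (2 * g) → G) :
    epsR h = (List.ofFn fun i : Fin g =>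
      h ⟨2 * i, by omega⟩ * h ⟨2 * i + 1, by omega⟩ * (h ⟨2 * i, by omega⟩)⁻¹ *
        (h ⟨2 * i + 1, by omega⟩)⁻¹).prod := by
  simp [epsR, evalWord, relator, map_list_prod, List.map_ofFn, Function.comp_def]

variable {E : Type*} [NormedAddCommGroup E] [NormedSpace ℝ E]
  {G : Type*} [TopologicalSpace G] [ChartedSpace E G] [Group G]

/-- The manifold model of `G^{2g}`. -/
abbrev modelY (E : Type*) [NormedAddCommGroup E] [NormedSpace ℝ E] (g : ℕ) :
    ModelWithCorners ℝ (Fin (2 * g) → E) (ModelPi fun _ : Fin (2 * g) => E) :=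
  ModelWithCorners.pi fun _ : Fin (2 * g) => 𝓘(ℝ, E)

/-- The manifold model of `G^{2g} × 𝔤`. -/
abbrev modelYg (E : Type*) [NormedAddCommGroup E] [NormedSpace ℝ E] (g : ℕ) :
    ModelWithCorners ℝ ((Fin (2 * g) → E) × E)
      (ModelProd (ModelPi fun _ : Fin (2 * g) => E) E) :=
  (modelY E g).prod 𝓘(ℝ, E)

/-- The map `e_β = β · exp : 𝔤 → G`. -/
def expBeta (β : G) (Λ : E) : G := β * lieExp G Λ

/-- The 2-form `ω = ⟨c, E^* Ω⟩` on `G^{2g}`: the component of `E^* Ω` at `(a, b) ∈ F × F` is the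
pullback of `Ω` by `h ↦ (h(a), h(b))`. -/
def omegaForm (G : Type*) [TopologicalSpace G] [ChartedSpace E G] [Group G]
    (B : E →L[ℝ] E →L[ℝ] ℝ) (g : ℕ) : DForm (modelY E g) (Fin (2 * g) → G) 2 :=
  (fundChain g).sum fun ab n =>
    n • DForm.pullback (modelY E g) (𝓘(ℝ, E).prod 𝓘(ℝ, E))
      (fun h => (evalWord ab.1 h, evalWord ab.2 h)) (OmegaForm G B)

/-- The 2-form `σ = I (exp^* λ)` on the Lie algebra. -/
def sigmaForm (G : Type*) [TopologicalSpace G] [ChartedSpace E G] [Group G]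
    [FiniteDimensional ℝ E] [LieGroup 𝓘(ℝ, E) ∞ G] (B : E →L[ℝ] E →L[ℝ] ℝ) :
    DForm 𝓘(ℝ, E) E 2 :=
  homotopyOp (V := E) (DForm.pullback 𝓘(ℝ, E) 𝓘(ℝ, E) (lieExp G : E → G) (lambdaForm G B))

/-- The 2-form `ω̃ = pr_1^* ω + pr_2^* σ` on `G^{2g} × 𝔤`. -/
def omegaTilde (G : Type*) [TopologicalSpace G] [ChartedSpace E G] [Group G]
    [FiniteDimensional ℝ E] [LieGroup 𝓘(ℝ, E) ∞ G] (B : E →L[ℝ] E →L[ℝ] ℝ) (g : ℕ) :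
    DForm (modelYg E g) ((Fin (2 * g) → G) × E) 2 :=
  DForm.pullback (modelYg E g) (modelY E g) Prod.fst (omegaForm G B g)
    + DForm.pullback (modelYg E g) 𝓘(ℝ, E) Prod.snd (sigmaForm G B)

/-- The extended moduli space `X_β = {(h, Λ) | ε_R(h) = e_β(Λ)}`. -/
def extModuli (E : Type*) [NormedAddCommGroup E] [NormedSpace ℝ E]
    {G : Type*} [TopologicalSpace G] [ChartedSpace E G] [Group G] (g : ℕ) (β : G) :
    Set ((Fin (2 * g) → G) × E) :=
  {p | epsR p.1 = expBeta β p.2}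

/-- The (Zariski) tangent space of `X_β` at a point `p = (h, Λ)` of it: the vectors `(H, ζ)` with
`(dε_R)_h H = (d e_β)_Λ ζ`. Both sides lie in the tangent space of `G` at the point
`ε_R(h) = e_β(Λ)`, whose underlying vector space is `E`. -/
def extModuliTangent {g : ℕ} (β : G) (p : (Fin (2 * g) → G) × E) :
    Submodule ℝ (TangentSpace (modelYg E g) p) :=
  let A : TangentSpace (modelYg E g) p →L[ℝ] E :=
    mfderiv (modelYg E g) 𝓘(ℝ, E) (fun q : (Fin (2 * g) → G) × E => epsR q.1) p
  let A' : TangentSpace (modelYg E g) p →L[ℝ] E :=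
    mfderiv (modelYg E g) 𝓘(ℝ, E) (fun q : (Fin (2 * g) → G) × E => expBeta β q.2) p
  LinearMap.eqLocus (A : TangentSpace (modelYg E g) p →ₗ[ℝ] E) A'

/-- The action of `G` on `G^{2g} × 𝔤`: conjugation on each factor `G`, the adjoint action on
`𝔤`. -/
def conjAct {g : ℕ} (a : G) (p : (Fin (2 * g) → G) × E) : (Fin (2 * g) → G) × E :=
  (fun i => a * p.1 i * a⁻¹, Ad a p.2)

end Moduli

/-! ### Hamiltonian actions and moment maps -/

section Hamiltonian

variable {E : Type*} [NormedAddCommGroup E] [NormedSpace ℝ E]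
  {G : Type*} [TopologicalSpace G] [ChartedSpace E G] [Group G]
  {F : Type*} [NormedAddCommGroup F] [NormedSpace ℝ F] {K : Type*} [TopologicalSpace K]

/-- The vector field on `M` generated by `η ∈ 𝔤`: its value at `x` is the derivative at `1`, in the
direction `η`, of the orbit map `a ↦ a · x`, that is, `d/dt exp(t η) · x` at `t = 0`. -/
def fundField (J : ModelWithCorners ℝ F K) {M : Type*} [TopologicalSpace M] [ChartedSpace K M]
    (act : G → M → M) (η : E) (x : M) : TangentSpace J x :=
  (mfderiv 𝓘(ℝ, E) J (fun a : G => act a x) 1 : E →L[ℝ] F) η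

/-- Let `X` be a subset of a manifold `M`, with tangent spaces `TX x ⊆ T_x M` at the points of `X`,
and let `G` act on `M` by `act`. Then `act` restricts to a Hamiltonian action on `X`
with respect to the restriction to `X` of the 2-form `ψ`, and `μ` restricts to an equivariant
moment map `X → 𝔤`, the dual of `𝔤` being identified with `𝔤` by the inner product `B`. No
nondegeneracy of `ψ` is asked for. -/
structure IsHamiltonianOn (J : ModelWithCorners ℝ F K) [J.Boundaryless]
    {M : Type*} [TopologicalSpace M] [ChartedSpace K M]
    (B : E →L[ℝ] E →L[ℝ] ℝ) (act : G → M → M)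
    (X : Set M) (TX : ∀ x : M, Submodule ℝ (TangentSpace J x))
    (ψ : DForm J M 2) (μ : M → E) : Prop where
  /-- `G` acts on `X`. -/
  one_act : ∀ x ∈ X, act 1 x = x
  mul_act : ∀ a b : G, ∀ x ∈ X, act (a * b) x = act a (act b x)
  mapsTo : ∀ a : G, ∀ x ∈ X, act a x ∈ X
  /-- The action and the vector fields that generate it are tangent to `X`. -/
  map_tangent : ∀ a : G, ∀ x ∈ X, ∀ v ∈ TX x, mfderiv J J (act a) x v ∈ TX (act a x)
  field_tangent : ∀ η : E, ∀ x ∈ X, fundField J act η x ∈ TX x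
  /-- The restriction of `ψ` to `X` is closed and invariant. -/
  closed : ∀ x ∈ X, ∀ u ∈ TX x, ∀ v ∈ TX x, ∀ w ∈ TX x, DForm.d J ψ x ![u, v, w] = 0
  invariant : ∀ a : G, ∀ x ∈ X, ∀ u ∈ TX x, ∀ v ∈ TX x,
    DForm.pullback J J (act a) ψ x ![u, v] = ψ x ![u, v]
  /-- The moment map equation: the contraction of `ψ` with the field generated by `η` is
  `η · dμ` on `X`. -/
  moment : ∀ η : E, ∀ x ∈ X, ∀ v ∈ TX x,
    ψ x ![fundField J act η x, v] = B η (mfderiv J 𝓘(ℝ, E) μ x v)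
  /-- The moment map is equivariant. -/
  equivariant : ∀ a : G, ∀ x ∈ X, μ (act a x) = Ad a (μ x)

end Hamiltonian

end ExtendedModuli

end

set_option linter.unusedSectionVars false
set_option linter.style.haveILetI false
open Filter Topology Set

noncomputable section

/-! Everything is trivialised on the left. A map f into G is represented by its logarithmic
derivative `logD` f, which is f^*θ as an ordinary family of linear maps into E. The forms θ, θ̄, λ
and Ω then become expressions in `logD`, `Ad`, `lieBr` and B. The engine is the Maurer–Cartan
equation `fderiv_logD_sub`. It yields the derivative of `Ad` and the invariance of the bracket under
`Ad`; differentiating invariance then gives the Jacobi identity and the skewness of ad with respect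
to B.

On G^{2g}, write F(w) for the pullback of λ, or of θ_η, by evaluation on the word w. By the
Polyakov–Wiegmann identity `extDeriv_pairForm`, the differential of E_{a,b}^*Ω is F(a) + F(b) -
F(ab) for λ. Its contraction with the field of η is -(F(a) + F(b) - F(ab)) for θ_η. For any real
function F on the free group, `sum_fundChain` sums F(a) + F(b) - F(ab) over the chain c to F(1) -
F(R): this is the fundamental formula of the Fox calculus, together with the vanishing of the
exponent sums of R. Hence dω = -ε_R^*λ, and the contraction of ω is ε_R^*θ_η.

On the Lie algebra, exp^*λ is closed, so dσ = exp^*λ by the Poincaré lemma (`extDeriv_homotopyOp`).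
The contraction of σ with the field of η is 2 η·dΛ - e_β^*θ_η (`sigmaE_moment`). On the tangent
spaces of X_β the maps ε_R and e_β have the same value and the same derivative, and β is central, so
the λ terms cancel and the θ_η terms cancel. What is left is closedness and the moment map equation.
Invariance comes from the equivariance of each ingredient.

The exponential map is given only through integral curves, and only its first derivative is
computed: `logD` of exp at ξ is J_1, where J' = 1 - (ad ξ) J and J_0 = 0
(`mdifferentiableAt_lieExp`). J depends smoothly on ξ, so the pulled back forms are smooth, and the
Maurer–Cartan equation for J_t is itself proved by an ODE argument (`fderiv_jacobiOp_sub`). -/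

namespace ExtendedModuli

/-! ### Calculus of the left logarithmic derivative. -/

section LogD

variable {E : Type*} [NormedAddCommGroup E] [NormedSpace ℝ E]
  {G : Type*} [TopologicalSpace G] [ChartedSpace E G] [Group G]
  {F : Type*} [NormedAddCommGroup F] [NormedSpace ℝ F] {K : Type*} [TopologicalSpace K]
  {F' : Type*} [NormedAddCommGroup F'] [NormedSpace ℝ F'] {K' : Type*} [TopologicalSpace K']
  (J : ModelWithCorners ℝ F K) {M : Type*} [TopologicalSpace M] [ChartedSpace K M]
  (J' : ModelWithCorners ℝ F' K') {N : Type*} [TopologicalSpace N] [ChartedSpace K' N]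

/-- The manifold derivative, as a map between the model spaces. -/
def mD (f : M → N) (x : M) : F →L[ℝ] F' := mfderiv J J' f x

variable (E) in
/-- The left logarithmic derivative of a map into a Lie group. -/
def logD (f : M → G) (x : M) : F →L[ℝ] E :=
  mD J 𝓘(ℝ, E) (fun y => (f x)⁻¹ * f y) x

variable {J J'}

theorem mD_comp {F'' : Type*} [NormedAddCommGroup F''] [NormedSpace ℝ F''] {K'' : Type*}
    [TopologicalSpace K''] {J'' : ModelWithCorners ℝ F'' K''} {P : Type*} [TopologicalSpace P]
    [ChartedSpace K'' P] {f : N → P} {k : M → N} {x : M}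
    (hf : MDifferentiableAt J' J'' f (k x)) (hk : MDifferentiableAt J J' k x) (v : F) :
    mD J J'' (fun y => f (k y)) x v = mD J' J'' f (k x) (mD J J' k x v) :=
  mfderiv_comp_apply x hf hk v

theorem mD_id (x : M) (v : F) : mD J J (fun y : M => y) x v = v := by
  have : mfderiv J J (fun y : M => y) x = ContinuousLinearMap.id ℝ (TangentSpace J x) := mfderiv_id
  unfold mD
  rw [this]; rfl

theorem mD_const (c : N) (x : M) (v : F) : mD J J' (fun _ : M => c) x v = 0 := by
  have : mfderiv J J' (fun _ : M => c) x = 0 := mfderiv_const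
  unfold mD
  rw [this]; rfl

theorem mD_prodMk {F'' : Type*} [NormedAddCommGroup F''] [NormedSpace ℝ F''] {K'' : Type*}
    [TopologicalSpace K''] {J'' : ModelWithCorners ℝ F'' K''} {P : Type*} [TopologicalSpace P]
    [ChartedSpace K'' P] {f : M → N} {k : M → P} {x : M}
    (hf : MDifferentiableAt J J' f x) (hk : MDifferentiableAt J J'' k x) (v : F) :
    mD J (J'.prod J'') (fun y => (f y, k y)) x v = (mD J J' f x v, mD J J'' k x v) := by
  unfold mD
  rw [mfderiv_prodMk hf hk]; rfl

theorem mD_congr {f k : M → N} {x : M} (h : f =ᶠ[𝓝 x] k) : mD J J' f x = mD J J' k x := by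
  unfold mD
  rw [h.mfderiv_eq]

theorem mD_eq_fderiv (f : F → F') (x : F) : mD 𝓘(ℝ, F) 𝓘(ℝ, F') f x = fderiv ℝ f x :=
  mfderiv_eq_fderiv

variable [LieGroup 𝓘(ℝ, E) ∞ G]

theorem mdifferentiableAt_mul_left (a x : G) :
    MDifferentiableAt 𝓘(ℝ, E) 𝓘(ℝ, E) (fun y : G => a * y) x :=
  (contMDiff_mul_left (I := 𝓘(ℝ, E)) (n := ∞) (a := a)).mdifferentiableAt (by simp)

theorem mdifferentiableAt_mul_right (a x : G) :
    MDifferentiableAt 𝓘(ℝ, E) 𝓘(ℝ, E) (fun y : G => y * a) x :=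
  (contMDiff_mul_right (I := 𝓘(ℝ, E)) (n := ∞) (a := a)).mdifferentiableAt (by simp)

theorem mdifferentiable_mul :
    MDifferentiable (𝓘(ℝ, E).prod 𝓘(ℝ, E)) 𝓘(ℝ, E) (fun p : G × G => p.1 * p.2) :=
  (contMDiff_mul 𝓘(ℝ, E) ∞).mdifferentiable (by simp)

theorem mdifferentiable_inv : MDifferentiable 𝓘(ℝ, E) 𝓘(ℝ, E) (fun p : G => p⁻¹) :=
  (contMDiff_inv 𝓘(ℝ, E) ∞).mdifferentiable (by simp)

theorem MDiffAt.gmul {f k : M → G} {x : M} (hf : MDifferentiableAt J 𝓘(ℝ, E) f x)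
    (hk : MDifferentiableAt J 𝓘(ℝ, E) k x) :
    MDifferentiableAt J 𝓘(ℝ, E) (fun y => f y * k y) x :=
  (mdifferentiable_mul (f x, k x)).comp x (hf.prodMk hk)

theorem MDiffAt.ginv {f : M → G} {x : M} (hf : MDifferentiableAt J 𝓘(ℝ, E) f x) :
    MDifferentiableAt J 𝓘(ℝ, E) (fun y => (f y)⁻¹) x :=
  (mdifferentiable_inv (f x)).comp x hf

theorem MDiffAt.const_gmul {f : M → G} {x : M} (a : G) (hf : MDifferentiableAt J 𝓘(ℝ, E) f x) :
    MDifferentiableAt J 𝓘(ℝ, E) (fun y => a * f y) x :=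
  (mdifferentiableAt_mul_left a (f x)).comp x hf

theorem MDiffAt.gmul_const {f : M → G} {x : M} (a : G) (hf : MDifferentiableAt J 𝓘(ℝ, E) f x) :
    MDifferentiableAt J 𝓘(ℝ, E) (fun y => f y * a) x :=
  (mdifferentiableAt_mul_right a (f x)).comp x hf

/-- At the point (1, 1) the two partial derivatives of multiplication are derivatives of
translations by 1, hence identities. -/
theorem mD_gmul_of_eq_one {f k : M → G} {x : M} (hf : MDifferentiableAt J 𝓘(ℝ, E) f x)
    (hk : MDifferentiableAt J 𝓘(ℝ, E) k x) (hf1 : f x = 1) (hk1 : k x = 1) (v : F) :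
    mD J 𝓘(ℝ, E) (fun y => f y * k y) x v =
      mD J 𝓘(ℝ, E) f x v + mD J 𝓘(ℝ, E) k x v := by
  have h2 (p : G × G) (w : E × E) : mD (𝓘(ℝ, E).prod 𝓘(ℝ, E)) 𝓘(ℝ, E)
      (fun p : G × G => p.1 * p.2) p w =
      mD 𝓘(ℝ, E) 𝓘(ℝ, E) (fun z => z * p.2) p.1 w.1 +
        mD 𝓘(ℝ, E) 𝓘(ℝ, E) (fun z => p.1 * z) p.2 w.2 :=
    mfderiv_prod_eq_add_apply (mdifferentiable_mul p)
  have h1 := mD_comp (k := fun y => (f y, k y)) (mdifferentiable_mul (G := G) (E := E) (f x, k x))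
    (hf.prodMk hk) v
  rw [h2, mD_prodMk hf hk] at h1
  simp only [hf1, hk1, mul_one, one_mul, mD_id] at h1
  exact h1

theorem logD_apply_eq {f : M → G} {x : M} (hf : MDifferentiableAt J 𝓘(ℝ, E) f x) (v : F) :
    logD E J f x v = mcL (f x) (mD J 𝓘(ℝ, E) f x v) :=
  mfderiv_comp_apply x (mdifferentiableAt_mul_left (f x)⁻¹ (f x)) hf v

theorem logD_comp {f : M → G} {k : N → M} {x : N} (hf : MDifferentiableAt J 𝓘(ℝ, E) f (k x))
    (hk : MDifferentiableAt J' J k x) (v : F') :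
    logD E J' (fun y => f (k y)) x v = logD E J f (k x) (mD J' J k x v) :=
  mfderiv_comp_apply x (MDiffAt.const_gmul (f (k x))⁻¹ hf) hk v

theorem logD_const_mul (a : G) (f : M → G) (x : M) :
    logD E J (fun y => a * f y) x = logD E J f x := by
  unfold logD
  congr 1
  ext y; group

theorem mD_conj {f : M → G} {x : M} (hf : MDifferentiableAt J 𝓘(ℝ, E) f x) (hf1 : f x = 1)
    (a : G) (v : F) :
    mD J 𝓘(ℝ, E) (fun y => a * f y * a⁻¹) x v =
      Ad a (mD J 𝓘(ℝ, E) f x v) := by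
  have h := mfderiv_comp_apply (I := J) (I' := 𝓘(ℝ, E)) (I'' := 𝓘(ℝ, E)) x
    (g := fun z : G => a * z * a⁻¹) 
    (MDiffAt.gmul_const a⁻¹ (mdifferentiableAt_mul_left (E := E) a (f x))) hf v
  refine h.trans ?_
  rw [hf1]
  rfl

/-- The translate of f k back to 1 factors as a conjugate by k(x)⁻¹ of the translate of f, times the
translate of k. Both factors pass through 1, so their derivatives add. -/
theorem logD_mul {f k : M → G} {x : M} (hf : MDifferentiableAt J 𝓘(ℝ, E) f x)
    (hk : MDifferentiableAt J 𝓘(ℝ, E) k x) (v : F) :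
    logD E J (fun y => f y * k y) x v = Ad (k x)⁻¹ (logD E J f x v) + logD E J k x v := by
  have e : (fun y => (f x * k x)⁻¹ * (f y * k y)) =
      fun y => ((k x)⁻¹ * ((f x)⁻¹ * f y) * ((k x)⁻¹)⁻¹) * ((k x)⁻¹ * k y) := by
    ext y; group
  have hf' := MDiffAt.const_gmul (f x)⁻¹ hf
  have hk' := MDiffAt.const_gmul (k x)⁻¹ hk
  have hc := MDiffAt.gmul_const ((k x)⁻¹)⁻¹ (MDiffAt.const_gmul (k x)⁻¹ hf')
  unfold logD
  rw [e, mD_gmul_of_eq_one hc hk' (by group) (by group), mD_conj hf' (by group)]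

theorem logD_const (c : G) (x : M) (v : F) : logD E J (fun _ => c) x v = 0 :=
  mD_const (J := J) (J' := 𝓘(ℝ, E)) _ x v

theorem logD_mul_const {f : M → G} {x : M} (hf : MDifferentiableAt J 𝓘(ℝ, E) f x) (a : G)
    (v : F) : logD E J (fun y => f y * a) x v = Ad a⁻¹ (logD E J f x v) := by
  rw [logD_mul hf mdifferentiableAt_const, logD_const, add_zero]

theorem logD_conj {f : M → G} {x : M} (hf : MDifferentiableAt J 𝓘(ℝ, E) f x) (a : G)
    (v : F) : logD E J (fun y => a * f y * a⁻¹) x v = Ad a (logD E J f x v) := by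
  rw [logD_mul_const (MDiffAt.const_gmul a hf), logD_const_mul, inv_inv]

theorem Ad_one (v : E) : Ad (1 : G) v = v := by
  have : (fun x : G => 1 * x * 1⁻¹) = fun x => x := by ext; simp
  unfold Ad
  rw [this]; exact mD_id (J := 𝓘(ℝ, E)) (1 : G) v

theorem Ad_mul (a b : G) (v : E) : Ad (a * b) v = Ad a (Ad b v) := by
  have h := mD_conj (J := 𝓘(ℝ, E)) (f := fun x : G => b * x * b⁻¹) (x := 1) (E := E)
    (MDiffAt.gmul_const b⁻¹ (mdifferentiableAt_mul_left (E := E) b 1)) (by group) a v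
  refine Eq.trans ?_ h
  have e : (fun x : G => a * (b * x * b⁻¹) * a⁻¹) = fun x => a * b * x * (a * b)⁻¹ := by
    ext x; group
  rw [e]; rfl

theorem Ad_inv_Ad (a : G) (v : E) : Ad a⁻¹ (Ad a v) = v := by
  rw [← Ad_mul, inv_mul_cancel, Ad_one]

theorem Ad_Ad_inv (a : G) (v : E) : Ad a (Ad a⁻¹ v) = v := by
  rw [← Ad_mul, mul_inv_cancel, Ad_one]

theorem Ad_of_mem_center {β : G} (hβ : β ∈ Subgroup.center G) (v : E) : Ad β v = v := by
  have : (fun x : G => β * x * β⁻¹) = fun x => x := by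
    ext x
    rw [← (Subgroup.mem_center_iff.1 hβ x)]; simp
  unfold Ad
  rw [this]; exact mD_id (J := 𝓘(ℝ, E)) (1 : G) v

theorem logD_inv {f : M → G} {x : M} (hf : MDifferentiableAt J 𝓘(ℝ, E) f x) (v : F) :
    logD E J (fun y => (f y)⁻¹) x v = - Ad (f x) (logD E J f x v) := by
  have h := logD_mul hf (MDiffAt.ginv hf) v
  simp only [mul_inv_cancel, inv_inv] at h
  rw [logD_const] at h
  rw [eq_neg_iff_add_eq_zero, add_comm]; exact h.symm

/-- The right translate f(y) f(x)⁻¹ is the conjugate by f(x) of the left translate f(x)⁻¹ f(y). -/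
theorem mcR_mfderiv {f : M → G} {x : M} (hf : MDifferentiableAt J 𝓘(ℝ, E) f x) (v : F) :
    mcR (f x) (mD J 𝓘(ℝ, E) f x v) = Ad (f x) (logD E J f x v) := by
  have h : mD J 𝓘(ℝ, E) (fun y => f y * (f x)⁻¹) x v =
      mcR (f x) (mD J 𝓘(ℝ, E) f x v) :=
    mfderiv_comp_apply x (mdifferentiableAt_mul_right (f x)⁻¹ (f x)) hf v
  rw [← h]
  unfold logD
  rw [← mD_conj (MDiffAt.const_gmul _ hf) (by group)]
  congr 2
  ext y; group

theorem logD_congr {f k : M → G} {x : M} (h : f =ᶠ[𝓝 x] k) : logD E J f x = logD E J k x := by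
  have : (fun y => (f x)⁻¹ * f y) =ᶠ[𝓝 x] (fun y => (k x)⁻¹ * k y) := by
    filter_upwards [h] with y hy
    rw [hy, h.self_of_nhds]
  exact mD_congr this

end LogD

/-! ### The Maurer–Cartan equation. -/

section MaurerCartan

variable {E : Type*} [NormedAddCommGroup E] [NormedSpace ℝ E]
  {G : Type*} [TopologicalSpace G] [ChartedSpace E G] [Group G]
variable (E G) in
/-- The inverse of the preferred chart at the identity. -/
def chartInv : E → G := (extChartAt 𝓘(ℝ, E) (1 : G)).symm

variable (E G) in
/-- The identity in the preferred chart. -/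
def chartOne : E := extChartAt 𝓘(ℝ, E) (1 : G) 1

variable (G) in
/-- The left-invariant vector field with value `u` at the identity, in the preferred chart. -/
def invField (u : E) (e : E) : E :=
  (mD 𝓘(ℝ, E) 𝓘(ℝ, E) (chartInv E G) e).inverse
    (mD 𝓘(ℝ, E) 𝓘(ℝ, E) (fun y : G => chartInv E G e * y) 1 u)

variable [LieGroup 𝓘(ℝ, E) ∞ G] [FiniteDimensional ℝ E]

theorem mD_chart (v : E) : mD 𝓘(ℝ, E) 𝓘(ℝ, E) (extChartAt 𝓘(ℝ, E) (1 : G)) 1 v = v := by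
  haveI : IsManifold 𝓘(ℝ, E) 1 G := IsManifold.of_le (n := ∞) (by simp)
  have := mfderiv_extChartAt_self (I := 𝓘(ℝ, E)) (x := (1 : G))
  unfold mD
  rw [this]; rfl

/-- The bracket of left-invariant fields is computed in the preferred chart at 1. There the chart
has derivative the identity, and the absence of boundary turns derivatives within sets into plain
ones. -/
theorem lieBr_eq (u v : E) : lieBr G u v =
    fderiv ℝ (invField G v) (chartOne E G) (invField G u (chartOne E G)) -
    fderiv ℝ (invField G u) (chartOne E G) (invField G v (chartOne E G)) := by
  have h : lieBr G u v = VectorField.mlieBracketWithin 𝓘(ℝ, E)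
    (mulInvariantVectorField (I := 𝓘(ℝ, E)) (u : GroupLieAlgebra 𝓘(ℝ, E) G))
    (mulInvariantVectorField (I := 𝓘(ℝ, E)) (v : GroupLieAlgebra 𝓘(ℝ, E) G)) univ (1 : G) := rfl
  rw [h]
  have h2 : mD 𝓘(ℝ, E) 𝓘(ℝ, E) (extChartAt 𝓘(ℝ, E) (1 : G)) 1 = ContinuousLinearMap.id ℝ E := by
    ext v; exact mD_chart v
  have h3 : ∀ w : E, (mD 𝓘(ℝ, E) 𝓘(ℝ, E) (extChartAt 𝓘(ℝ, E) (1 : G)) 1).inverse w = w := by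
    intro w; rw [h2, ContinuousLinearMap.inverse_id]; rfl
  refine (h3 _).trans ?_
  have h4 (w : E) : (VectorField.mpullbackWithin 𝓘(ℝ, E) 𝓘(ℝ, E) (extChartAt 𝓘(ℝ, E) (1:G)).symm
    (mulInvariantVectorField (I := 𝓘(ℝ, E)) (w : GroupLieAlgebra 𝓘(ℝ, E) G)) (range 𝓘(ℝ, E))) = invField G w := by
    funext e
    have : range (𝓘(ℝ, E)) = univ := ModelWithCorners.range_eq_univ _
    rw [this]
    have h := VectorField.mpullbackWithin_univ (I := 𝓘(ℝ, E)) (I' := 𝓘(ℝ, E)) (f := (extChartAt 𝓘(ℝ, E) (1:G)).symm)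
      (V := (mulInvariantVectorField (I := 𝓘(ℝ, E)) (w : GroupLieAlgebra 𝓘(ℝ, E) G)))
    exact congrFun h e
  rw [h4 u, h4 v]
  have h5 : ((extChartAt 𝓘(ℝ, E) (1:G)).symm ⁻¹' univ ∩ range 𝓘(ℝ, E)) = univ := by
    simp 
  have h6 : ∀ w : E, fderivWithin ℝ (invField G w) ((extChartAt 𝓘(ℝ, E) (1:G)).symm ⁻¹' univ ∩ range 𝓘(ℝ, E)) (chartOne E G) = fderiv ℝ (invField G w) (chartOne E G) := by
    intro w; rw [h5, fderivWithin_univ]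
  rw [← h6, ← h6]
  rfl

variable {V : Type*} [NormedAddCommGroup V] [NormedSpace ℝ V]

theorem chartInv_chartOne : chartInv E G (chartOne E G) = 1 :=
  extChartAt_to_inv (I := 𝓘(ℝ, E)) (1 : G)

theorem target_mem_nhds : (extChartAt 𝓘(ℝ, E) (1 : G)).target ∈ 𝓝 (chartOne E G) :=
  extChartAt_target_mem_nhds (I := 𝓘(ℝ, E)) (1 : G)

theorem eventually_contMDiffAt_chartInv :
    ∀ᶠ e in 𝓝 (chartOne E G), ContMDiffAt 𝓘(ℝ, E) 𝓘(ℝ, E) ∞ (chartInv E G) e := by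
  filter_upwards [eventually_mem_nhds_iff.2 (target_mem_nhds (E := E) (G := G))] with e he
  exact (contMDiffOn_extChartAt_symm (1 : G)).contMDiffAt he

theorem contMDiffAt_chartInv :
    ContMDiffAt 𝓘(ℝ, E) 𝓘(ℝ, E) ∞ (chartInv E G) (chartOne E G) :=
  eventually_contMDiffAt_chartInv.self_of_nhds

theorem contMDiffAt_chart :
    ContMDiffAt 𝓘(ℝ, E) 𝓘(ℝ, E) ∞ (extChartAt 𝓘(ℝ, E) (1 : G)) 1 :=
  contMDiffAt_extChartAt

theorem logD_eq_fderiv {f : V → G} {x : V} (hf : MDifferentiableAt 𝓘(ℝ, V) 𝓘(ℝ, E) f x) :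
    logD E 𝓘(ℝ, V) f x =
      fderiv ℝ (fun y => extChartAt 𝓘(ℝ, E) (1 : G) ((f x)⁻¹ * f y)) x := by
  ext v
  have h1 : (f x)⁻¹ * f x = 1 := by group
  have h := mD_comp (k := fun y => (f x)⁻¹ * f y) (x := x) (J := 𝓘(ℝ, V)) (J' := 𝓘(ℝ, E))
    (J'' := 𝓘(ℝ, E)) (f := extChartAt 𝓘(ℝ, E) (1 : G))
    (by rw [h1]; exact contMDiffAt_chart.mdifferentiableAt (by simp))
    (MDiffAt.const_gmul (f x)⁻¹ hf) v
  rw [mD_eq_fderiv, h1, mD_chart] at h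
  exact h.symm

theorem logD_id_one (v : E) : logD E 𝓘(ℝ, E) (fun y : G => y) 1 v = v := by
  unfold logD
  simp only [inv_one, one_mul]
  exact mD_id _ v

theorem mcL_mD_mul_left (g : G) (u : E) :
    mcL g (mD 𝓘(ℝ, E) 𝓘(ℝ, E) (fun y : G => g * y) 1 u) = u := by
  have h : mD 𝓘(ℝ, E) 𝓘(ℝ, E) (fun y : G => g⁻¹ * (g * y)) 1 u =
      mcL g (mD 𝓘(ℝ, E) 𝓘(ℝ, E) (fun y : G => g * y) 1 u) :=
    mfderiv_comp_apply_of_eq (1 : G) (mdifferentiableAt_mul_left g⁻¹ g) (mdifferentiableAt_mul_left g 1)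
      (mul_one g) u
  simp only [inv_mul_cancel_left, mD_id] at h
  exact h.symm

/-- In the chart φ at 1, `logD` f is the derivative in z, taken at z = y, of the smooth two-variable
map φ(f(y)⁻¹ f(z)). A partial derivative of a smooth map is smooth in the parameter. -/
theorem contDiffAt_logD {f : V → G} {x : V} (hf : ContMDiffAt 𝓘(ℝ, V) 𝓘(ℝ, E) ∞ f x) :
    ContDiffAt ℝ ∞ (logD E 𝓘(ℝ, V) f) x := by
  have hev : ∀ᶠ y in 𝓝 x, MDifferentiableAt 𝓘(ℝ, V) 𝓘(ℝ, E) f y := by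
    have h1 : ContMDiffAt 𝓘(ℝ, V) 𝓘(ℝ, E) 1 f x := hf.of_le (by simp)
    haveI : IsManifold 𝓘(ℝ, E) 1 G := IsManifold.of_le (n := ∞) (by simp)
    filter_upwards [(contMDiffAt_iff_contMDiffAt_nhds (by simp)).1 h1] with y hy
    exact hy.mdifferentiableAt (by simp)
  have hQ : ContDiffAt ℝ ∞ (Function.uncurry fun y z : V =>
      extChartAt 𝓘(ℝ, E) (1 : G) ((f y)⁻¹ * f z)) (x, x) := by
    rw [← contMDiffAt_iff_contDiffAt]
    have a1 : ContMDiffAt 𝓘(ℝ, V × V) 𝓘(ℝ, E) ∞ (fun p : V × V => f p.1) (x, x) :=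
      ContMDiffAt.comp (x, x) (f := Prod.fst) hf contDiff_fst.contMDiff.contMDiffAt
    have a2 : ContMDiffAt 𝓘(ℝ, V × V) 𝓘(ℝ, E) ∞ (fun p : V × V => f p.2) (x, x) :=
      ContMDiffAt.comp (x, x) (f := Prod.snd) hf contDiff_snd.contMDiff.contMDiffAt
    refine ContMDiffAt.comp (x, x) (g := extChartAt 𝓘(ℝ, E) (1 : G)) ?_ (a1.inv.mul a2)
    simp only [inv_mul_cancel]
    exact contMDiffAt_chart
  have h := ContDiffAt.fderiv (m := ∞) (g := fun y : V => y) hQ contDiffAt_id (by simp)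
  refine h.congr_of_eventuallyEq ?_
  filter_upwards [hev] with y hy
  exact logD_eq_fderiv hy

theorem logD_chartInv_one : logD E 𝓘(ℝ, E) (chartInv E G) (chartOne E G) =
    ContinuousLinearMap.id ℝ E := by
  rw [logD_eq_fderiv (contMDiffAt_chartInv.mdifferentiableAt (by simp))]
  rw [← fderiv_id (𝕜 := ℝ) (x := chartOne E G)]
  refine Filter.EventuallyEq.fderiv_eq ?_
  filter_upwards [target_mem_nhds (E := E) (G := G)] with e he
  rw [chartInv_chartOne, inv_one, one_mul]
  exact (extChartAt 𝓘(ℝ, E) (1 : G)).right_inv he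

theorem logD_chartInv_invField (u : E) : ∀ᶠ e in 𝓝 (chartOne E G),
    logD E 𝓘(ℝ, E) (chartInv E G) e (invField G u e) = u := by
  haveI : IsManifold 𝓘(ℝ, E) 1 G := IsManifold.of_le (n := ∞) (by simp)
  filter_upwards [target_mem_nhds (E := E) (G := G), eventually_contMDiffAt_chartInv] with e he hc
  rw [logD_apply_eq (hc.mdifferentiableAt (by simp))]
  have hinv : (mD 𝓘(ℝ, E) 𝓘(ℝ, E) (chartInv E G) e).IsInvertible := by
    have h := isInvertible_mfderivWithin_extChartAt_symm (I := 𝓘(ℝ, E)) he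
    have h2 : range (𝓘(ℝ, E)) = univ := ModelWithCorners.range_eq_univ _
    rw [h2, mfderivWithin_univ] at h
    exact h
  have h1 : ∀ w : E, mD 𝓘(ℝ, E) 𝓘(ℝ, E) (chartInv E G) e
      ((mD 𝓘(ℝ, E) 𝓘(ℝ, E) (chartInv E G) e).inverse w) = w := by
    obtain ⟨M, hM⟩ := hinv
    intro w
    rw [← hM, ContinuousLinearMap.inverse_equiv]
    exact M.apply_symm_apply w
  unfold invField
  rw [h1]
  exact mcL_mD_mul_left _ u

/-- Near the base point the field is the inverse of `logD` of the chart inverse, applied to u. That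
operator is the identity at the base point, and inversion is smooth there. -/
theorem hasFDerivAt_invField (u : E) :
    DifferentiableAt ℝ (invField G u) (chartOne E G) := by
  have hA := (contDiffAt_logD (contMDiffAt_chartInv (E := E) (G := G)))
  have hA0 := logD_chartInv_one (E := E) (G := G)
  haveI : CompleteSpace E := FiniteDimensional.complete ℝ E
  have hI : ContDiffAt ℝ ∞ (fun e => (logD E 𝓘(ℝ, E) (chartInv E G) e).inverse u)
      (chartOne E G) := by
    refine ContDiffAt.clm_apply ?_ contDiffAt_const
    refine ContDiffAt.comp (chartOne E G) (g := ContinuousLinearMap.inverse) ?_ hA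
    rw [hA0]
    exact contDiffAt_map_inverse (ContinuousLinearEquiv.refl ℝ E)
  refine (hI.differentiableAt (by simp)).congr_of_eventuallyEq ?_
  have hopen : ∀ᶠ e in 𝓝 (chartOne E G), (logD E 𝓘(ℝ, E) (chartInv E G) e).IsInvertible := by
    have := hA.continuousAt.tendsto
    rw [hA0] at this
    exact this (ContinuousLinearEquiv.nhds (ContinuousLinearEquiv.refl ℝ E))
  filter_upwards [hopen, logD_chartInv_invField (G := G) u] with e he hu
  obtain ⟨M, hM⟩ := he
  rw [← hM] at hu ⊢
  rw [ContinuousLinearMap.inverse_equiv]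
  exact (M.symm_apply_eq.2 hu.symm).symm

theorem invField_one (u : E) : invField G u (chartOne E G) = u := by
  have h := (logD_chartInv_invField (G := G) u).self_of_nhds
  rwa [logD_chartInv_one] at h

/-- Differentiate the identity θ(left-invariant field of u) = u, which holds on a whole
neighbourhood. This converts the bracket of fields into the exterior derivative of θ. -/
theorem fderiv_invField (u v : E) :
    fderiv ℝ (invField G u) (chartOne E G) v =
      - fderiv ℝ (logD E 𝓘(ℝ, E) (chartInv E G)) (chartOne E G) v u := by
  have hA := ((contDiffAt_logD (contMDiffAt_chartInv (E := E) (G := G))).differentiableAt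
    (by simp)).hasFDerivAt
  have h := hA.clm_apply (hasFDerivAt_invField (G := G) u).hasFDerivAt
  have h0 : HasFDerivAt (fun e => logD E 𝓘(ℝ, E) (chartInv E G) e (invField G u e))
      (0 : E →L[ℝ] E) (chartOne E G) :=
    (hasFDerivAt_const u _).congr_of_eventuallyEq (logD_chartInv_invField (G := G) u)
  have := DFunLike.congr_fun (h.unique h0) v
  simp [logD_chartInv_one, invField_one] at this
  exact eq_neg_of_add_eq_zero_left this

/-- The Maurer-Cartan equation for the inverse of the preferred chart, at the identity. -/
theorem lieBr_eq_fderiv_logD_chartInv (u v : E) : lieBr G u v =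
    fderiv ℝ (logD E 𝓘(ℝ, E) (chartInv E G)) (chartOne E G) v u -
    fderiv ℝ (logD E 𝓘(ℝ, E) (chartInv E G)) (chartOne E G) u v := by
  rw [lieBr_eq, invField_one, invField_one, fderiv_invField, fderiv_invField]
  abel

/-- The Maurer-Cartan equation. -/
theorem fderiv_logD_sub {f : V → G} {x : V} (hf : ContMDiffAt 𝓘(ℝ, V) 𝓘(ℝ, E) ∞ f x) (u v : V) :
    fderiv ℝ (logD E 𝓘(ℝ, V) f) x u v - fderiv ℝ (logD E 𝓘(ℝ, V) f) x v u =
      - lieBr G (logD E 𝓘(ℝ, V) f x u) (logD E 𝓘(ℝ, V) f x v) := by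
  set k : V → E := fun y => extChartAt 𝓘(ℝ, E) (1 : G) ((f x)⁻¹ * f y) with hk
  have hkx : k x = chartOne E G := by simp [hk, chartOne]
  have hks : ContDiffAt ℝ ∞ k x := by
    rw [← contMDiffAt_iff_contDiffAt]
    refine ContMDiffAt.comp x (g := extChartAt 𝓘(ℝ, E) (1 : G)) ?_ (contMDiffAt_const.mul hf)
    simp only [inv_mul_cancel]
    exact contMDiffAt_chart
  have hA := contDiffAt_logD (contMDiffAt_chartInv (E := E) (G := G))
  rw [← hkx] at hA
  -- Left translation does not change `logD`, so f is replaced by the chart inverse composed with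
  -- the E-valued map k.
  have hfk : ∀ᶠ y in 𝓝 x, f y = f x * chartInv E G (k y) := by
    have hsrc : ∀ᶠ y in 𝓝 x, (f x)⁻¹ * f y ∈ (extChartAt 𝓘(ℝ, E) (1 : G)).source := by
      have hc : ContinuousAt (fun y => (f x)⁻¹ * f y) x :=
        (contMDiffAt_const.mul hf).continuousAt
      refine hc (extChartAt_source_mem_nhds' ?_)
      simp
    filter_upwards [hsrc] with y hy
    have := (extChartAt 𝓘(ℝ, E) (1 : G)).left_inv hy
    rw [hk]
    unfold chartInv
    rw [this]; group
  have hev : logD E 𝓘(ℝ, V) f =ᶠ[𝓝 x]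
      fun y => (logD E 𝓘(ℝ, E) (chartInv E G) (k y)).comp (fderiv ℝ k y) := by
    have h1 : ∀ᶠ y in 𝓝 x, DifferentiableAt ℝ k y := by
      have h1 : ContDiffAt ℝ 1 k x := hks.of_le (by simp)
      filter_upwards [h1.eventually (by simp)] with y hy
      exact hy.differentiableAt (by simp)
    have h2 : ∀ᶠ y in 𝓝 x, ContMDiffAt 𝓘(ℝ, E) 𝓘(ℝ, E) ∞ (chartInv E G) (k y) := by
      have := eventually_contMDiffAt_chartInv (E := E) (G := G)
      rw [← hkx] at this
      exact hks.continuousAt.eventually this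
    filter_upwards [hfk.eventually_nhds, h1, h2] with y hy h1 h2
    ext v
    rw [logD_congr hy, logD_const_mul, logD_comp (h2.mdifferentiableAt (by simp))
      h1.mdifferentiableAt, mD_eq_fderiv]
    rfl
  have hd := ((hA.comp x hks).differentiableAt (by simp)).hasFDerivAt
  have hd2 : HasFDerivAt (fderiv ℝ k) _ x :=
    ((hks.fderiv_right (m := ∞) (by simp)).differentiableAt (by simp)).hasFDerivAt
  have hD := hd.clm_comp hd2
  have hchain : fderiv ℝ (logD E 𝓘(ℝ, E) (chartInv E G) ∘ k) x =
      (fderiv ℝ (logD E 𝓘(ℝ, E) (chartInv E G)) (k x)).comp (fderiv ℝ k x) :=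
    fderiv_comp x (hA.differentiableAt (by simp)) (hks.differentiableAt (by simp))
  have hval (a b : V) : fderiv ℝ (logD E 𝓘(ℝ, V) f) x a b =
      fderiv ℝ (fderiv ℝ k) x a b +
      fderiv ℝ (logD E 𝓘(ℝ, E) (chartInv E G)) (chartOne E G) (fderiv ℝ k x a)
        (fderiv ℝ k x b) := by
    rw [hev.fderiv_eq]
    have := hD.fderiv
    refine (DFunLike.congr_fun (DFunLike.congr_fun this a) b).trans ?_
    simp [hchain, hkx, logD_chartInv_one]
  have hx (a : V) : logD E 𝓘(ℝ, V) f x a = fderiv ℝ k x a := by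
    rw [hev.self_of_nhds]
    beta_reduce
    rw [hkx, logD_chartInv_one]; rfl
  -- The antisymmetrised second derivative of k vanishes. What remains is the equation for the chart
  -- inverse at the identity.
  have hs := (hks.isSymmSndFDerivAt (by
    rw [minSmoothness_of_isRCLikeNormedField]; exact WithTop.coe_le_coe.2 (le_top : (2 : ℕ∞) ≤ ⊤))).eq u v
  rw [hval, hval, hx, hx, hs, lieBr_eq_fderiv_logD_chartInv]
  abel

end MaurerCartan

/-! ### The adjoint representation and its derivative. -/

section Adjoint

variable {E : Type*} [NormedAddCommGroup E] [NormedSpace ℝ E]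
  {G : Type*} [TopologicalSpace G] [ChartedSpace E G] [Group G]
  [LieGroup 𝓘(ℝ, E) ∞ G] [FiniteDimensional ℝ E]
  {V : Type*} [NormedAddCommGroup V] [NormedSpace ℝ V]

theorem exists_chart_lift {f : V → G} {x : V} (hf : MDifferentiableAt 𝓘(ℝ, V) 𝓘(ℝ, E) f x) :
    ∃ k : V → E, HasFDerivAt k (logD E 𝓘(ℝ, V) f x) x ∧ k x = chartOne E G ∧
      ∀ᶠ y in 𝓝 x, f y = f x * chartInv E G (k y) := by
  refine ⟨fun y => extChartAt 𝓘(ℝ, E) (1 : G) ((f x)⁻¹ * f y), ?_, by simp [chartOne], ?_⟩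
  · rw [logD_eq_fderiv hf]
    refine DifferentiableAt.hasFDerivAt ?_
    rw [← mdifferentiableAt_iff_differentiableAt]
    refine MDifferentiableAt.comp x (g := extChartAt 𝓘(ℝ, E) (1 : G)) ?_
      (MDiffAt.const_gmul (f x)⁻¹ hf)
    simp only [inv_mul_cancel]
    exact contMDiffAt_chart.mdifferentiableAt (by simp)
  · have hsrc : ∀ᶠ y in 𝓝 x, (f x)⁻¹ * f y ∈ (extChartAt 𝓘(ℝ, E) (1 : G)).source := by
      have hc : ContinuousAt (fun y => (f x)⁻¹ * f y) x :=
        (MDiffAt.const_gmul (f x)⁻¹ hf).continuousAt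
      refine hc (extChartAt_source_mem_nhds' ?_)
      simp
    filter_upwards [hsrc] with y hy
    have := (extChartAt 𝓘(ℝ, E) (1 : G)).left_inv hy
    unfold chartInv
    rw [this]; group

theorem fderiv_clm_apply_const {W : Type*} [NormedAddCommGroup W] [NormedSpace ℝ W]
    {X : Type*} [NormedAddCommGroup X] [NormedSpace ℝ X]
    {F : V → W →L[ℝ] X} {x : V} (hF : DifferentiableAt ℝ F x) (a : V) (b : W) :
    fderiv ℝ F x a b = fderiv ℝ (fun y => F y b) x a := by
  rw [(hF.hasFDerivAt.clm_apply (hasFDerivAt_const b x)).fderiv]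
  simp

theorem mD_chartInv (v : E) :
    mD 𝓘(ℝ, E) 𝓘(ℝ, E) (chartInv E G) (chartOne E G) v = v := by
  have h := DFunLike.congr_fun (logD_chartInv_one (E := E) (G := G)) v
  unfold logD at h
  rw [chartInv_chartOne] at h
  simpa using h

theorem Ad_eq_fderiv (g : G) : Ad g = fderiv ℝ (fun e : E =>
    extChartAt 𝓘(ℝ, E) (1 : G) (g * chartInv E G e * g⁻¹)) (chartOne E G) := by
  have hc := contMDiffAt_chartInv (E := E) (G := G)
  have hcd := hc.mdifferentiableAt (by simp)
  ext v
  have h1 : g * chartInv E G (chartOne E G) * g⁻¹ = 1 := by rw [chartInv_chartOne]; group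
  have h := mD_comp (k := fun e => g * chartInv E G e * g⁻¹) (x := chartOne E G)
    (J := 𝓘(ℝ, E)) (J' := 𝓘(ℝ, E))
    (J'' := 𝓘(ℝ, E)) (f := extChartAt 𝓘(ℝ, E) (1 : G))
    (by rw [h1]; exact contMDiffAt_chart.mdifferentiableAt (by simp))
    (MDiffAt.gmul_const g⁻¹ (MDiffAt.const_gmul g hcd)) v
  rw [mD_eq_fderiv, h1, mD_chart, mD_conj hcd chartInv_chartOne, mD_chartInv] at h
  exact h.symm

/-- As for `logD`: `Ad` (f y) is a partial derivative of a smooth map of two variables, conjugation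
by f y read in the chart. -/
theorem contDiffAt_Ad {f : V → G} {x : V} (hf : ContMDiffAt 𝓘(ℝ, V) 𝓘(ℝ, E) ∞ f x) :
    ContDiffAt ℝ ∞ (fun y => (Ad (f y) : E →L[ℝ] E)) x := by
  have hQ : ContDiffAt ℝ ∞ (Function.uncurry fun (y : V) (e : E) =>
      extChartAt 𝓘(ℝ, E) (1 : G) (f y * chartInv E G e * (f y)⁻¹)) (x, chartOne E G) := by
    rw [← contMDiffAt_iff_contDiffAt]
    have a1 : ContMDiffAt 𝓘(ℝ, V × E) 𝓘(ℝ, E) ∞ (fun p : V × E => f p.1) (x, chartOne E G) :=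
      ContMDiffAt.comp (x, chartOne E G) (f := Prod.fst) hf contDiff_fst.contMDiff.contMDiffAt
    have a2 : ContMDiffAt 𝓘(ℝ, V × E) 𝓘(ℝ, E) ∞ (fun p : V × E => chartInv E G p.2)
        (x, chartOne E G) :=
      ContMDiffAt.comp (x, chartOne E G) (f := Prod.snd) contMDiffAt_chartInv
        contDiff_snd.contMDiff.contMDiffAt
    refine ContMDiffAt.comp (x, chartOne E G) (g := extChartAt 𝓘(ℝ, E) (1 : G)) ?_
      ((a1.mul a2).mul a1.inv)
    simp only [chartInv_chartOne, mul_one, mul_inv_cancel]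
    exact contMDiffAt_chart
  have h := ContDiffAt.fderiv (m := ∞) (g := fun _ : V => chartOne E G) hQ contDiffAt_const
    (by simp)
  exact h.congr_of_eventuallyEq (Eventually.of_forall fun y => Ad_eq_fderiv (f y))

theorem lieBr_swap (u v : E) : lieBr G u v = - lieBr G v u := by
  rw [lieBr_eq_fderiv_logD_chartInv, lieBr_eq_fderiv_logD_chartInv]; abel

theorem lieBr_self (u : E) : lieBr G u u = 0 := by
  rw [lieBr_eq_fderiv_logD_chartInv]; abel

/-- Apply the Maurer–Cartan equation to the product map (p₁, p₂) ↦ p₁ p₂ in the chart, on the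
vectors (u, 0) and (0, v). In `logD_mul` the value on (0, v) does not depend on p₁. So the only
surviving derivative is that of `Ad` of the inverse of the second factor. -/
theorem fderiv_Ad_inv_chartInv (u v : E) :
    fderiv ℝ (fun e => (Ad (chartInv E G e)⁻¹ : E →L[ℝ] E)) (chartOne E G) v u =
      lieBr G u v := by
  set o := chartOne E G with ho
  have hc := contMDiffAt_chartInv (E := E) (G := G)
  set f : E × E → G := fun p => chartInv E G p.1 * chartInv E G p.2 with hfdef
  have a1 : ContMDiffAt 𝓘(ℝ, E × E) 𝓘(ℝ, E) ∞ (fun p : E × E => chartInv E G p.1) (o, o) :=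
    ContMDiffAt.comp (o, o) (f := Prod.fst) hc contDiff_fst.contMDiff.contMDiffAt
  have a2 : ContMDiffAt 𝓘(ℝ, E × E) 𝓘(ℝ, E) ∞ (fun p : E × E => chartInv E G p.2) (o, o) :=
    ContMDiffAt.comp (o, o) (f := Prod.snd) hc contDiff_snd.contMDiff.contMDiffAt
  have hf : ContMDiffAt 𝓘(ℝ, E × E) 𝓘(ℝ, E) ∞ f (o, o) := a1.mul a2
  have hA := contDiffAt_logD hc
  have hAd := contDiffAt_Ad hc.inv
  have hlog : ∀ᶠ p : E × E in 𝓝 (o, o), ∀ w : E × E, logD E 𝓘(ℝ, E × E) f p w =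
      Ad (chartInv E G p.2)⁻¹ (logD E 𝓘(ℝ, E) (chartInv E G) p.1 w.1) +
        logD E 𝓘(ℝ, E) (chartInv E G) p.2 w.2 := by
    have e1 : ∀ᶠ p : E × E in 𝓝 (o, o), ContMDiffAt 𝓘(ℝ, E) 𝓘(ℝ, E) ∞ (chartInv E G) p.1 :=
      continuousAt_fst.eventually (eventually_contMDiffAt_chartInv (E := E) (G := G))
    have e2 : ∀ᶠ p : E × E in 𝓝 (o, o), ContMDiffAt 𝓘(ℝ, E) 𝓘(ℝ, E) ∞ (chartInv E G) p.2 :=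
      continuousAt_snd.eventually (eventually_contMDiffAt_chartInv (E := E) (G := G))
    filter_upwards [e1, e2] with p h1 h2 w
    have d1 := h1.mdifferentiableAt (by simp)
    have d2 := h2.mdifferentiableAt (by simp)
    have f1 : MDifferentiableAt 𝓘(ℝ, E × E) 𝓘(ℝ, E) (Prod.fst : E × E → E) p :=
      differentiableAt_fst.mdifferentiableAt
    have f2 : MDifferentiableAt 𝓘(ℝ, E × E) 𝓘(ℝ, E) (Prod.snd : E × E → E) p :=
      differentiableAt_snd.mdifferentiableAt
    have g1 : MDifferentiableAt 𝓘(ℝ, E × E) 𝓘(ℝ, E) (fun q : E × E => chartInv E G q.1) p :=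
      d1.comp p f1
    have g2 : MDifferentiableAt 𝓘(ℝ, E × E) 𝓘(ℝ, E) (fun q : E × E => chartInv E G q.2) p :=
      d2.comp p f2
    rw [logD_mul g1 g2, logD_comp d1 f1, logD_comp d2 f2, mD_eq_fderiv,
      mD_eq_fderiv, fderiv_fst, fderiv_snd]
    rfl
  have hlogd := (contDiffAt_logD hf).differentiableAt (by simp)
  have hMC := fderiv_logD_sub hf (u, 0) (0, v)
  rw [fderiv_clm_apply_const hlogd, fderiv_clm_apply_const hlogd, hlog.self_of_nhds,
    hlog.self_of_nhds] at hMC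
  have hd1 : fderiv ℝ (fun p => logD E 𝓘(ℝ, E × E) f p (0, v)) (o, o) (u, 0) = 0 := by
    have he : (fun p => logD E 𝓘(ℝ, E × E) f p (0, v)) =ᶠ[𝓝 (o, o)]
        fun p => logD E 𝓘(ℝ, E) (chartInv E G) p.2 v := by
      filter_upwards [hlog] with p hp
      rw [hp]; simp
    rw [he.fderiv_eq]
    have hA' : HasFDerivAt (fun e => logD E 𝓘(ℝ, E) (chartInv E G) e v) _ (o, o).2 :=
      ((hA.clm_apply contDiffAt_const).differentiableAt (by simp)).hasFDerivAt
    have := (hA'.comp (o, o) hasFDerivAt_snd).fderiv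
    refine (DFunLike.congr_fun this (u, 0)).trans ?_
    simp
  have hd2 : fderiv ℝ (fun p => logD E 𝓘(ℝ, E × E) f p (u, 0)) (o, o) (0, v) =
      fderiv ℝ (fun e => (Ad (chartInv E G e)⁻¹ : E →L[ℝ] E)) o v u := by
    have he : (fun p => logD E 𝓘(ℝ, E × E) f p (u, 0)) =ᶠ[𝓝 (o, o)]
        fun p => Ad (chartInv E G p.2)⁻¹ (logD E 𝓘(ℝ, E) (chartInv E G) p.1 u) := by
      filter_upwards [hlog] with p hp
      rw [hp]; simp
    rw [he.fderiv_eq]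
    have hA' : HasFDerivAt (fun e => logD E 𝓘(ℝ, E) (chartInv E G) e u) _ (o, o).1 :=
      ((hA.clm_apply contDiffAt_const).differentiableAt (by simp)).hasFDerivAt
    have hAd' : HasFDerivAt (fun e => (Ad (chartInv E G e)⁻¹ : E →L[ℝ] E)) _ (o, o).2 :=
      (hAd.differentiableAt (by simp)).hasFDerivAt
    have := ((hAd'.comp (o, o) hasFDerivAt_snd).clm_apply
      (hA'.comp (o, o) hasFDerivAt_fst)).fderiv
    refine (DFunLike.congr_fun this (0, v)).trans ?_
    simp [ho, logD_chartInv_one]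
  rw [hd1, hd2] at hMC
  simpa [ho, logD_chartInv_one, chartInv_chartOne, Ad_one] using hMC

/-- Differentiate `Ad` g (`Ad` g⁻¹ u) = u at the identity. -/
theorem fderiv_Ad_chartInv (u v : E) :
    fderiv ℝ (fun e => (Ad (chartInv E G e) : E →L[ℝ] E)) (chartOne E G) v u =
      lieBr G v u := by
  have hc := contMDiffAt_chartInv (E := E) (G := G)
  have h1 := ((contDiffAt_Ad hc).differentiableAt (by simp)).hasFDerivAt
  have h2 := ((contDiffAt_Ad hc.inv).differentiableAt (by simp)).hasFDerivAt
  have h3 := h1.clm_apply (h2.clm_apply (hasFDerivAt_const u _))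
  have h4 : (fun e => Ad (chartInv E G e) (Ad (chartInv E G e)⁻¹ u)) = fun _ => u := by
    funext e; rw [Ad_Ad_inv]
  rw [h4] at h3
  have h5 := DFunLike.congr_fun (h3.unique (hasFDerivAt_const u _)) v
  have h6 := fderiv_Ad_inv_chartInv (G := G) u v
  simp [chartInv_chartOne, Ad_one] at h5
  rw [h6] at h5
  rw [lieBr_swap, ← eq_neg_of_add_eq_zero_right h5]

/-- `Ad` is multiplicative and f is f(x) times a map through 1, so the derivative at the identity
suffices. Only differentiability of f is required, which makes the lemma applicable to integral
curves. -/
theorem hasFDerivAt_Ad {f : V → G} {x : V} (hf : MDifferentiableAt 𝓘(ℝ, V) 𝓘(ℝ, E) f x) :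
    HasFDerivAt (fun y => (Ad (f y) : E →L[ℝ] E))
      ((ContinuousLinearMap.compL ℝ E E E (Ad (f x))).comp
        ((lieBr G).comp (logD E 𝓘(ℝ, V) f x))) x := by
  obtain ⟨k, hk, hkx, hfk⟩ := exists_chart_lift hf
  have h1 := ((contDiffAt_Ad (contMDiffAt_chartInv (E := E) (G := G))).differentiableAt
    (by simp)).hasFDerivAt
  have h2 : fderiv ℝ (fun e => (Ad (chartInv E G e) : E →L[ℝ] E)) (chartOne E G) = lieBr G := by
    ext v u
    exact fderiv_Ad_chartInv u v
  rw [h2, ← hkx] at h1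
  have h3 := ((ContinuousLinearMap.compL ℝ E E E (Ad (f x))).hasFDerivAt.comp x (h1.comp x hk))
  refine h3.congr_of_eventuallyEq ?_
  filter_upwards [hfk] with y hy
  rw [hy]
  ext v
  simp [Ad_mul]

/-- Conjugation by g turns `logD` into `Ad` g of it. Compare the Maurer–Cartan equations before and
after. -/
theorem Ad_lieBr (g : G) (u v : E) : Ad g (lieBr G u v) = lieBr G (Ad g u) (Ad g v) := by
  have hc := contMDiffAt_chartInv (E := E) (G := G)
  have hf : ContMDiffAt 𝓘(ℝ, E) 𝓘(ℝ, E) ∞ (fun e => g * chartInv E G e * g⁻¹) (chartOne E G) :=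
    (contMDiffAt_const.mul hc).mul contMDiffAt_const
  have hA := ((contDiffAt_logD hc).differentiableAt (by simp))
  have he : logD E 𝓘(ℝ, E) (fun e => g * chartInv E G e * g⁻¹) =ᶠ[𝓝 (chartOne E G)]
      fun e => ContinuousLinearMap.compL ℝ E E E (Ad g) (logD E 𝓘(ℝ, E) (chartInv E G) e) := by
    filter_upwards [eventually_contMDiffAt_chartInv (E := E) (G := G)] with e he
    ext v
    rw [logD_conj (he.mdifferentiableAt (by simp))]; rfl
  have hMC := fderiv_logD_sub hf u v
  have hd := ((ContinuousLinearMap.compL ℝ E E E (Ad g)).hasFDerivAt.comp _ hA.hasFDerivAt).fderiv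
  rw [he.fderiv_eq, he.self_of_nhds] at hMC
  have hd' (a b : E) : fderiv ℝ (fun e => ContinuousLinearMap.compL ℝ E E E (Ad g)
      (logD E 𝓘(ℝ, E) (chartInv E G) e)) (chartOne E G) a b =
      Ad g (fderiv ℝ (logD E 𝓘(ℝ, E) (chartInv E G)) (chartOne E G) a b) :=
    DFunLike.congr_fun (DFunLike.congr_fun hd a) b
  rw [hd', hd', ← map_sub] at hMC
  simp only [logD_chartInv_one, ContinuousLinearMap.compL_apply, ContinuousLinearMap.comp_id]
    at hMC
  rw [lieBr_eq_fderiv_logD_chartInv u v, ← neg_sub, map_neg, hMC, neg_neg]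

/-- The derivative of `Ad_lieBr` at the identity, in the direction w. -/
theorem lieBr_leibniz (w u v : E) :
    lieBr G w (lieBr G u v) = lieBr G (lieBr G w u) v + lieBr G u (lieBr G w v) := by
  have hc := contMDiffAt_chartInv (E := E) (G := G)
  have h1 := hasFDerivAt_Ad (hc.mdifferentiableAt (by simp))
  have hl (x : E) := h1.clm_apply (hasFDerivAt_const x _)
  have h3 := (((lieBr G).hasFDerivAt.comp _ (hl u)).clm_apply (hl v))
  have h4 : (fun e => lieBr G (Ad (chartInv E G e) u) (Ad (chartInv E G e) v)) =
      fun e => Ad (chartInv E G e) (lieBr G u v) := by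
    funext e; rw [Ad_lieBr]
  have h5 := DFunLike.congr_fun ((hl (lieBr G u v)).unique (h4 ▸ h3)) w
  simpa [chartInv_chartOne, Ad_one, logD_chartInv_one, add_comm] using h5

/-- The derivative at the identity of the invariance of B under `Ad`. -/
theorem IsInvariantInner.lieBr_left {B : E →L[ℝ] E →L[ℝ] ℝ} (hB : IsInvariantInner G B)
    (w x y : E) : B (lieBr G w x) y = - B x (lieBr G w y) := by
  have hc := contMDiffAt_chartInv (E := E) (G := G)
  have h1 := hasFDerivAt_Ad (hc.mdifferentiableAt (by simp))
  have hl (x : E) := h1.clm_apply (hasFDerivAt_const x _)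
  have h3 := (B.hasFDerivAt.comp _ (hl x)).clm_apply (hl y)
  have h4 : (fun e => B (Ad (chartInv E G e) x) (Ad (chartInv E G e) y)) =
      fun _ => B x y := by
    funext e; rw [hB.inv]
  have h5 := DFunLike.congr_fun ((h4 ▸ h3 : HasFDerivAt (fun _ : E => B x y) _ _).unique
    (hasFDerivAt_const _ _)) w
  simp [chartInv_chartOne, Ad_one, logD_chartInv_one] at h5
  linarith

end Adjoint

/-! ### Paths with prescribed logarithmic derivative, and one-parameter subgroups. -/

section OneParameter

variable {E : Type*} [NormedAddCommGroup E] [NormedSpace ℝ E]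
  {G : Type*} [TopologicalSpace G] [ChartedSpace E G] [Group G]

variable (G) in
/-- `γ` is a differentiable path in `G` with left logarithmic derivative `a`. -/
def IsLogPath (γ : ℝ → G) (a : ℝ → E) : Prop :=
  ∀ t, MDifferentiableAt 𝓘(ℝ, ℝ) 𝓘(ℝ, E) γ t ∧ logD E 𝓘(ℝ, ℝ) γ t 1 = a t

variable [LieGroup 𝓘(ℝ, E) ∞ G]

theorem IsLogPath.continuous {γ : ℝ → G} {a : ℝ → E} (h : IsLogPath G γ a) : Continuous γ :=
  continuous_iff_continuousAt.2 fun t => (h t).1.continuousAt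

theorem IsLogPath.mul {γ δ : ℝ → G} {a b : ℝ → E} (h : IsLogPath G γ a) (k : IsLogPath G δ b) :
    IsLogPath G (fun t => γ t * δ t) (fun t => Ad (δ t)⁻¹ (a t) + b t) := fun t =>
  ⟨MDiffAt.gmul (h t).1 (k t).1, by rw [logD_mul (h t).1 (k t).1, (h t).2, (k t).2]⟩

theorem IsLogPath.inv {γ : ℝ → G} {a : ℝ → E} (h : IsLogPath G γ a) :
    IsLogPath G (fun t => (γ t)⁻¹) (fun t => - Ad (γ t) (a t)) := fun t =>
  ⟨MDiffAt.ginv (h t).1, by rw [logD_inv (h t).1, (h t).2]⟩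

theorem IsLogPath.const_mul {γ : ℝ → G} {a : ℝ → E} (h : IsLogPath G γ a) (c : G) :
    IsLogPath G (fun t => c * γ t) a := fun t =>
  ⟨MDiffAt.const_gmul c (h t).1, by rw [logD_const_mul, (h t).2]⟩

theorem IsLogPath.conj {γ : ℝ → G} {a : ℝ → E} (h : IsLogPath G γ a) (c : G) :
    IsLogPath G (fun t => c * γ t * c⁻¹) (fun t => Ad c (a t)) := fun t =>
  ⟨MDiffAt.gmul_const c⁻¹ (MDiffAt.const_gmul c (h t).1), by rw [logD_conj (h t).1, (h t).2]⟩

theorem IsLogPath.comp_mul {γ : ℝ → G} {a : ℝ → E} (h : IsLogPath G γ a) (s : ℝ) :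
    IsLogPath G (fun t => γ (t * s)) (fun t => s • a (t * s)) := fun t => by
  have h1 : MDifferentiableAt 𝓘(ℝ, ℝ) 𝓘(ℝ, ℝ) (fun t : ℝ => t * s) t :=
    (differentiableAt_id.mul_const s).mdifferentiableAt
  refine ⟨(h (t * s)).1.comp t h1, ?_⟩
  rw [logD_comp (k := fun t => t * s) (h (t * s)).1 h1, mD_eq_fderiv]
  have h2 : fderiv ℝ (fun t : ℝ => t * s) t 1 = s • (1 : ℝ) := by
    rw [fderiv_apply_one_eq_deriv, (hasDerivAt_mul_const s).deriv]; simp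
  rw [h2, map_smul, (h (t * s)).2]

theorem mD_mul_left_mcL (g : G) (w : E) :
    mD 𝓘(ℝ, E) 𝓘(ℝ, E) (fun y : G => g * y) 1 (mcL g w) = w := by
  have h1 : MDifferentiableAt 𝓘(ℝ, E) 𝓘(ℝ, E) (fun y : G => g * y) (g⁻¹ * g) :=
    mdifferentiableAt_mul_left g _
  have h : mD 𝓘(ℝ, E) 𝓘(ℝ, E) (fun y : G => g * (g⁻¹ * y)) g w =
      mD 𝓘(ℝ, E) 𝓘(ℝ, E) (fun y : G => g * y) 1 (mcL g w) :=
    mfderiv_comp_apply_of_eq g (mdifferentiableAt_mul_left g 1) (mdifferentiableAt_mul_left g⁻¹ g)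
      (inv_mul_cancel g) w
  simp only [mul_inv_cancel_left, mD_id] at h
  exact h.symm

theorem isMIntegralCurve_iff_isLogPath {γ : ℝ → G} {ξ : E} [FiniteDimensional ℝ E] :
    IsMIntegralCurve (I := 𝓘(ℝ, E)) γ (fun g => mulInvariantVectorField (I := 𝓘(ℝ, E))
      (ξ : GroupLieAlgebra 𝓘(ℝ, E) G) g) ↔ IsLogPath G γ fun _ => ξ := by
  refine forall_congr' fun t => ⟨fun h => ?_, fun h => ?_⟩
  · refine ⟨h.mdifferentiableAt, ?_⟩
    have h2 : mD 𝓘(ℝ, ℝ) 𝓘(ℝ, E) γ t (1 : ℝ) =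
        mD 𝓘(ℝ, E) 𝓘(ℝ, E) (fun y : G => γ t * y) 1 ξ := by
      unfold mD
      rw [h.mfderiv]
      exact one_smul ℝ _
    rw [logD_apply_eq h.mdifferentiableAt, h2, mcL_mD_mul_left]
  · have h1 := h.1.hasMFDerivAt
    have h2 := h.2
    rw [logD_apply_eq h.1] at h2
    beta_reduce at h2
    have h3 : mD 𝓘(ℝ, ℝ) 𝓘(ℝ, E) γ t =
        (1 : ℝ →L[ℝ] ℝ).smulRight (mD 𝓘(ℝ, E) 𝓘(ℝ, E) (fun y : G => γ t * y) 1 ξ) := by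
      ext
      rw [← h2, mD_mul_left_mcL]
      simp
    exact h3 ▸ h1

variable [FiniteDimensional ℝ E]

theorem lieGroup_three : LieGroup 𝓘(ℝ, E) (minSmoothness ℝ 3) G := by
  rw [minSmoothness_of_isRCLikeNormedField]; infer_instance

theorem contMDiff_invariantField (ξ : E) :
    ContMDiff 𝓘(ℝ, E) 𝓘(ℝ, E).tangent 1 (fun g : G =>
      (mulInvariantVectorField (I := 𝓘(ℝ, E)) (ξ : GroupLieAlgebra 𝓘(ℝ, E) G) g :
        TangentBundle 𝓘(ℝ, E) G)) := by
  haveI := lieGroup_three (E := E) (G := G)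
  refine (contMDiff_mulInvariantVectorField (I := 𝓘(ℝ, E)) (G := G) ξ).of_le ?_
  rw [minSmoothness_of_isRCLikeNormedField]
  exact one_le_two

variable [T2Space G]

/-- A local integral curve through 1 exists on some interval of radius ε. Its left translates are
integral curves through every point on that same interval. A uniform existence time makes the field
complete. -/
theorem exists_isLogPath_const (ξ : E) :
    ∃ γ : ℝ → G, γ 0 = 1 ∧ IsLogPath G γ fun _ => ξ := by
  haveI : CompleteSpace E := FiniteDimensional.complete ℝ E
  haveI : IsManifold 𝓘(ℝ, E) 1 G := IsManifold.of_le (n := ∞) (by simp)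
  have hv := contMDiff_invariantField (G := G) ξ
  obtain ⟨γ, h0, hγ⟩ := exists_isMIntegralCurveAt_of_contMDiffAt_boundaryless (t₀ := 0)
    (hv.contMDiffAt (x := 1))
  obtain ⟨ε, hε, hγ⟩ := isMIntegralCurveAt_iff'.1 hγ
  obtain ⟨δ, hδ, hδ'⟩ := exists_isMIntegralCurve_of_isMIntegralCurveOn hv hε (fun x => by
    refine ⟨fun t => x * γ t, by beta_reduce; rw [h0, mul_one], fun t ht => ?_⟩
    have h1 : t ∈ Metric.ball (0 : ℝ) ε := by rwa [Real.ball_eq_Ioo, zero_sub, zero_add]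
    have hd := ((hγ t h1).hasMFDerivAt (Metric.isOpen_ball.mem_nhds h1))
    refine HasMFDerivAt.hasMFDerivWithinAt ?_
    have hx := (MDiffAt.const_gmul x hd.mdifferentiableAt).hasMFDerivAt
    have h3 : mD 𝓘(ℝ, ℝ) 𝓘(ℝ, E) (fun t => x * γ t) t = (1 : ℝ →L[ℝ] ℝ).smulRight
        (mD 𝓘(ℝ, E) 𝓘(ℝ, E) (fun y : G => x * γ t * y) 1 ξ) := by
      ext
      have h2 : mD 𝓘(ℝ, ℝ) 𝓘(ℝ, E) γ t (1 : ℝ) =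
          mD 𝓘(ℝ, E) 𝓘(ℝ, E) (fun y : G => γ t * y) 1 ξ := by
        unfold mD
        rw [hd.mfderiv]
        exact one_smul ℝ _
      have h4 : mD 𝓘(ℝ, E) 𝓘(ℝ, E) (fun y : G => x * (γ t * y)) 1 ξ =
          mD 𝓘(ℝ, E) 𝓘(ℝ, E) (fun y : G => x * y) (γ t)
            (mD 𝓘(ℝ, E) 𝓘(ℝ, E) (fun y : G => γ t * y) 1 ξ) :=
        mfderiv_comp_apply_of_eq (1 : G) (mdifferentiableAt_mul_left x (γ t))
          (mdifferentiableAt_mul_left (γ t) 1) (mul_one _) ξ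
      have h5 := mD_comp (mdifferentiableAt_mul_left (E := E) x (γ t)) hd.mdifferentiableAt (1 : ℝ)
      simp only [ContinuousLinearMap.smulRight_apply, one_apply_eq_self, one_smul,
        mul_assoc]
      rw [h5, h4, h2]
    exact h3 ▸ hx) 1
  exact ⟨δ, hδ, isMIntegralCurve_iff_isLogPath.1 hδ'⟩

theorem isLogPath_const_unique {γ δ : ℝ → G} {ξ : E} (hγ : IsLogPath G γ fun _ => ξ)
    (hδ : IsLogPath G δ fun _ => ξ) (h : γ 0 = δ 0) : γ = δ := by
  haveI : CompleteSpace E := FiniteDimensional.complete ℝ E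
  haveI : IsManifold 𝓘(ℝ, E) 1 G := IsManifold.of_le (n := ∞) (by simp)
  exact isMIntegralCurve_Ioo_eq_of_contMDiff_boundaryless (contMDiff_invariantField ξ)
    (isMIntegralCurve_iff_isLogPath.2 hγ) (isMIntegralCurve_iff_isLogPath.2 hδ) h

/-- The choice in the definition of `lieExp` is harmless, because integral curves from 1 are unique.
-/
theorem lieExp_eq_of_isLogPath {γ : ℝ → G} {ξ : E} (hγ : IsLogPath G γ fun _ => ξ)
    (h0 : γ 0 = 1) : lieExp G ξ = γ 1 := by
  have h := Classical.epsilon_spec (p := fun x : G => ∃ γ : ℝ → G, γ 0 = 1 ∧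
    IsMIntegralCurve (I := 𝓘(ℝ, E)) γ
      (fun g => mulInvariantVectorField (I := 𝓘(ℝ, E)) (ξ : GroupLieAlgebra 𝓘(ℝ, E) G) g) ∧
    γ 1 = x) ⟨γ 1, γ, h0, isMIntegralCurve_iff_isLogPath.2 hγ, rfl⟩
  obtain ⟨δ, hδ0, hδ, hδ1⟩ := h
  have := isLogPath_const_unique (isMIntegralCurve_iff_isLogPath.1 hδ) hγ (hδ0.trans h0.symm)
  rw [this] at hδ1
  exact hδ1.symm

theorem lieExp_smul_eq_of_isLogPath {γ : ℝ → G} {ξ : E} (hγ : IsLogPath G γ fun _ => ξ)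
    (h0 : γ 0 = 1) (t : ℝ) : lieExp G (t • ξ) = γ t := by
  rw [lieExp_eq_of_isLogPath (hγ.comp_mul t) (by simpa using h0), one_mul]

theorem isLogPath_lieExp (ξ : E) : IsLogPath G (fun t : ℝ => lieExp G (t • ξ)) fun _ => ξ := by
  obtain ⟨γ, h0, hγ⟩ := exists_isLogPath_const (G := G) ξ
  have : (fun t : ℝ => lieExp G (t • ξ)) = γ := by
    funext t; exact lieExp_smul_eq_of_isLogPath hγ h0 t
  rwa [this]

theorem lieExp_zero : lieExp G (0 : E) = 1 := by
  obtain ⟨γ, h0, hγ⟩ := exists_isLogPath_const (G := G) (0 : E)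
  have := lieExp_smul_eq_of_isLogPath hγ h0 0
  rwa [zero_smul, h0] at this

theorem hasDerivAt_Ad_of_isLogPath {γ : ℝ → G} {a : ℝ → E} (h : IsLogPath G γ a) (t : ℝ) :
    HasDerivAt (fun t => (Ad (γ t) : E →L[ℝ] E)) ((Ad (γ t)).comp (lieBr G (a t))) t := by
  have := (hasFDerivAt_Ad (h t).1).hasDerivAt
  simpa [(h t).2] using this

/-- The derivative in t is `Ad` applied to [ξ, ξ] = 0. -/
theorem Ad_lieExp_smul_self (ξ : E) (t : ℝ) : Ad (lieExp G (t • ξ)) ξ = ξ := by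
  have h := fun t => (hasDerivAt_Ad_of_isLogPath (isLogPath_lieExp (G := G) ξ) t).clm_apply
    (hasDerivAt_const t ξ)
  have h2 := is_const_of_deriv_eq_zero (fun t => (h t).differentiableAt)
    (fun t => by rw [(h t).deriv]; simp [lieBr_self]) t 0
  simpa [lieExp_zero, Ad_one] using h2

theorem hasDerivAt_Ad_lieExp (ξ : E) (t : ℝ) :
    HasDerivAt (fun t : ℝ => (Ad (lieExp G (t • ξ)) : E →L[ℝ] E))
      ((lieBr G ξ).comp (Ad (lieExp G (t • ξ)))) t := by
  have h := hasDerivAt_Ad_of_isLogPath (isLogPath_lieExp (G := G) ξ) t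
  convert! h using 1
  ext v
  simp [Ad_lieBr, Ad_lieExp_smul_self]

theorem lieExp_neg_smul (ξ : E) (t : ℝ) : lieExp G (t • (-ξ)) = (lieExp G (t • ξ))⁻¹ := by
  have h := (isLogPath_lieExp (G := G) ξ).inv
  simp only [Ad_lieExp_smul_self] at h
  exact lieExp_smul_eq_of_isLogPath h (by simp [lieExp_zero]) t

/-- The conjugated one-parameter subgroup has constant logarithmic derivative `Ad` a ξ. -/
theorem lieExp_Ad (a : G) (ξ : E) : lieExp G (Ad a ξ) = a * lieExp G ξ * a⁻¹ := by
  have h := (isLogPath_lieExp (G := G) ξ).conj a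
  have := lieExp_eq_of_isLogPath h (by simp [lieExp_zero])
  simpa using this

end OneParameter

/-! ### Uniqueness for linear ordinary differential equations. -/

section LinearODE

variable {W : Type*} [NormedAddCommGroup W] [NormedSpace ℝ W]

theorem linear_ode_unique (M : W →L[ℝ] W) {f h : ℝ → W}
    (hf : ∀ t, HasDerivAt f (M (f t)) t) (hh : ∀ t, HasDerivAt h (M (h t)) t)
    (h0 : f 0 = h 0) : f = h :=
  ODE_solution_unique_univ (v := fun _ => M) (s := fun _ => univ)
    (fun _ => M.lipschitz.lipschitzOnWith) (fun t => ⟨hf t, trivial⟩) (fun t => ⟨hh t, trivial⟩) h0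

theorem affine_ode_unique (M : W →L[ℝ] W) {f h : ℝ → W} (b : ℝ → W)
    (hf : ∀ t, HasDerivAt f (b t + M (f t)) t) (hh : ∀ t, HasDerivAt h (b t + M (h t)) t)
    (h0 : f 0 = h 0) : f = h := by
  have h1 := linear_ode_unique M (f := fun t => f t - h t) (h := fun _ => 0)
    (fun t => by simpa using (hf t).fun_sub (hh t)) (fun t => by simpa using hasDerivAt_const t (0 : W))
    (by simp [h0])
  funext t
  exact sub_eq_zero.1 (congrFun h1 t)

end LinearODE

/-! ### The operator J_t solving J' = 1 - L J. -/

section Jop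

variable {E : Type*} [NormedAddCommGroup E] [NormedSpace ℝ E]

/-- The block operator `(x, ζ) ↦ (ζ - L x, 0)`. -/
def jacobiBlock (L : E →L[ℝ] E) : (E × E) →L[ℝ] (E × E) :=
  (ContinuousLinearMap.inl ℝ E E).comp
    (ContinuousLinearMap.snd ℝ E E - L.comp (ContinuousLinearMap.fst ℝ E E))

theorem jacobiBlock_apply (L : E →L[ℝ] E) (p : E × E) : jacobiBlock L p = (p.2 - L p.1, 0) := by
  simp [jacobiBlock]

/-- The solution `J` of `J' = 1 - L J`, `J 0 = 0`, that is, `J t = ∫_0^t e^{-s L} ds`. -/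
def jacobiOp (t : ℝ) (L : E →L[ℝ] E) : E →L[ℝ] E :=
  (ContinuousLinearMap.fst ℝ E E).comp
    ((NormedSpace.exp (t • jacobiBlock L)).comp (ContinuousLinearMap.inr ℝ E E))

variable [CompleteSpace E]

theorem contDiff_exp_clm {W : Type*} [NormedAddCommGroup W] [NormedSpace ℝ W] [CompleteSpace W] :
    ContDiff ℝ ∞ (NormedSpace.exp : (W →L[ℝ] W) → (W →L[ℝ] W)) :=
  contDiff_iff_contDiffAt.2 fun x => (NormedSpace.exp_analytic (𝕂 := ℝ) x).contDiffAt

/-- This is what the block exponential is for: joint smoothness in t and L is inherited from the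
exponential, and no invertibility of L is needed. -/
theorem contDiff_jacobiOp : ContDiff ℝ ∞ (fun p : ℝ × (E →L[ℝ] E) => jacobiOp p.1 p.2) := by
  unfold jacobiOp
  have h1 : ContDiff ℝ ∞ (fun p : ℝ × (E →L[ℝ] E) => p.1 • jacobiBlock p.2) := by
    unfold jacobiBlock
    fun_prop
  have h2 := contDiff_exp_clm.comp h1
  exact contDiff_const.clm_comp (h2.clm_comp contDiff_const)

theorem jacobiOp_zero (L : E →L[ℝ] E) : jacobiOp 0 L = 0 := by
  ext v
  simp [jacobiOp]

theorem hasDerivAt_jacobiOp (L : E →L[ℝ] E) (t : ℝ) :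
    HasDerivAt (fun t => jacobiOp t L) (ContinuousLinearMap.id ℝ E - L.comp (jacobiOp t L)) t := by
  have h (t : ℝ) := hasDerivAt_exp_smul_const' (jacobiBlock L) t
  -- The block operator has zero second component, so the second component of its flow is constant.
  have hs : ∀ t : ℝ, (ContinuousLinearMap.snd ℝ E E).comp
    ((NormedSpace.exp (t • jacobiBlock L)).comp (ContinuousLinearMap.inr ℝ E E)) =
      ContinuousLinearMap.id ℝ E := by
    have hd (t : ℝ) := (hasDerivAt_const t (ContinuousLinearMap.snd ℝ E E)).clm_comp
      ((h t).clm_comp (hasDerivAt_const t (ContinuousLinearMap.inr ℝ E E)))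
    intro t
    rw [is_const_of_deriv_eq_zero (fun t => (hd t).differentiableAt)
      (fun t => by rw [(hd t).deriv]; ext; simp [jacobiBlock_apply]) t 0]
    ext; simp
  have hd := (hasDerivAt_const t (ContinuousLinearMap.fst ℝ E E)).clm_comp
      ((h t).clm_comp (hasDerivAt_const t (ContinuousLinearMap.inr ℝ E E)))
  have hs' (v : E) : (NormedSpace.exp (t • jacobiBlock L) (0, v)).2 = v :=
    DFunLike.congr_fun (hs t) v
  convert! hd using 1
  ext v
  simp [jacobiBlock_apply, jacobiOp, hs']

theorem jacobiOp_unique (L : E →L[ℝ] E) {J : ℝ → E →L[ℝ] E}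
    (hJ : ∀ t, HasDerivAt J (ContinuousLinearMap.id ℝ E - L.comp (J t)) t) (h0 : J 0 = 0) (t : ℝ) :
    J t = jacobiOp t L := by
  have := affine_ode_unique (-(ContinuousLinearMap.compL ℝ E E E L)) (f := J)
    (h := fun t => jacobiOp t L) (fun _ => ContinuousLinearMap.id ℝ E)
    (fun t => by simpa [sub_eq_add_neg] using hJ t)
    (fun t => by simpa [sub_eq_add_neg] using hasDerivAt_jacobiOp L t)
    (by simp [h0, jacobiOp_zero])
  exact congrFun this t

/-- Both sides solve Y' = s - s L Y with Y(0) = 0. -/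
theorem jacobiOp_smul (L : E →L[ℝ] E) (s t : ℝ) :
    jacobiOp (t * s) L = s • jacobiOp t (s • L) := by
  have h := affine_ode_unique (-(ContinuousLinearMap.compL ℝ E E E (s • L)))
    (f := fun t => jacobiOp (t * s) L)
    (h := fun t => s • jacobiOp t (s • L)) (fun _ => s • ContinuousLinearMap.id ℝ E)
    (fun t => ?_) (fun t => ?_) (by simp [jacobiOp_zero])
  · exact congrFun h t
  · have := (hasDerivAt_jacobiOp L (t * s)).scomp t (hasDerivAt_mul_const s)
    convert! this using 1
    ext v; simp [sub_eq_add_neg]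
  · convert! (hasDerivAt_jacobiOp (s • L) t).const_smul s using 1
    ext v; simp [sub_eq_add_neg]

end Jop

/-! ### Paths with small logarithmic derivative. -/

section SmallPaths

variable {E : Type*} [NormedAddCommGroup E] [NormedSpace ℝ E]
  {G : Type*} [TopologicalSpace G] [ChartedSpace E G] [Group G]
  [LieGroup 𝓘(ℝ, E) ∞ G] [FiniteDimensional ℝ E] [T2Space G]

/-- A path with small logarithmic derivative, written in the preferred chart at the identity,
is approximated by the integral of its logarithmic derivative. -/
theorem exists_chart_approx {η : ℝ} (hη : 0 < η) : ∃ δ > 0, ∀ (h : ℝ → G) (a K : ℝ → E) (m : ℝ),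
    h 0 = 1 → IsLogPath G h a → (∀ t, HasDerivAt K (a t) t) → K 0 = 0 → m ≤ δ →
    (∀ t ∈ Icc (0 : ℝ) 1, ‖a t‖ ≤ m) →
    h 1 ∈ (extChartAt 𝓘(ℝ, E) (1 : G)).source ∧
      ‖extChartAt 𝓘(ℝ, E) (1 : G) (h 1) - chartOne E G - K 1‖ ≤ η * m := by
  set φ := extChartAt 𝓘(ℝ, E) (1 : G) with hφ
  set o := chartOne E G with ho
  set A := logD E 𝓘(ℝ, E) (chartInv E G) with hA
  haveI : IsManifold 𝓘(ℝ, E) 1 G := IsManifold.of_le (n := ∞) (by simp)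
  -- Capping at 1 serves the a priori bound: if the operator A differs from the identity by less
  -- than η'/2 ≤ 1/2, the chart velocity is at most twice the logarithmic derivative.
  set η' := min η 1 with hη'
  have hη'0 : 0 < η' := lt_min hη one_pos
  have hAc : ∀ᶠ e in 𝓝 o, ‖A e - ContinuousLinearMap.id ℝ E‖ < η' / 2 := by
    have hc := (contDiffAt_logD (contMDiffAt_chartInv (E := E) (G := G))).continuousAt
    have := Metric.continuousAt_iff'.1 hc (η' / 2) (by positivity)
    rw [logD_chartInv_one] at this
    simpa [dist_eq_norm] using this
  obtain ⟨r, hr, hball⟩ := Metric.nhds_basis_closedBall.eventually_iff.1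
    ((hAc.and (eventually_contMDiffAt_chartInv (E := E) (G := G))).and
      (target_mem_nhds (E := E) (G := G)))
  -- Speed at most 2m ≤ r/2 over unit time keeps the path within r/2 of the base point, strictly
  -- inside the ball of radius r.
  refine ⟨r / 4, by positivity, ?_⟩
  intro h a K m h0 hh hK hK0 hm ha
  have hm0 : 0 ≤ m := (norm_nonneg _).trans (ha 0 (by simp))
  set S : Set G := chartInv E G '' Metric.closedBall o r with hS
  have hScl : IsClosed S := by
    refine ((isCompact_closedBall o r).image_of_continuousOn ?_).isClosed
    exact fun e he => (hball he).1.2.continuousAt.continuousWithinAt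
  have hSsrc : ∀ g ∈ S, g ∈ φ.source ∧ φ g ∈ Metric.closedBall o r := by
    rintro _ ⟨e, he, rfl⟩
    refine ⟨φ.map_target (hball he).2, ?_⟩
    have : φ (chartInv E G e) = e := φ.right_inv (hball he).2
    rwa [this]
  have hder : ∀ t ∈ Icc (0 : ℝ) 1, h t ∈ S → ∃ y' : E, HasDerivAt (fun s => φ (h s)) y' t ∧
      ‖y'‖ ≤ 2 * m ∧ ‖y' - a t‖ ≤ η * m := by
    intro t ht hhS
    obtain ⟨hsrc, hb⟩ := hSsrc _ hhS
    have hφd : MDifferentiableAt 𝓘(ℝ, E) 𝓘(ℝ, E) φ (h t) :=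
      mdifferentiableAt_extChartAt (by simpa [hφ] using hsrc)
    have hyd : MDifferentiableAt 𝓘(ℝ, ℝ) 𝓘(ℝ, E) (fun s => φ (h s)) t := hφd.comp t (hh t).1
    have hyd' := hyd.differentiableAt
    refine ⟨deriv (fun s => φ (h s)) t, hyd'.hasDerivAt, ?_⟩
    have hev : h =ᶠ[𝓝 t] fun s => chartInv E G (φ (h s)) := by
      have : ∀ᶠ s in 𝓝 t, h s ∈ φ.source :=
        (hh t).1.continuousAt.eventually ((isOpen_extChartAt_source (I := 𝓘(ℝ, E)) (1 : G)).mem_nhds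
          hsrc)
      filter_upwards [this] with s hs
      exact (φ.left_inv hs).symm
    have h1 := (hh t).2
    rw [logD_congr hev, logD_comp (f := chartInv E G) (k := fun s => φ (h s)) ((hball hb).1.2.mdifferentiableAt (by simp)) hyd, mD_eq_fderiv,
      fderiv_apply_one_eq_deriv] at h1
    set y' := deriv (fun s => φ (h s)) t with hy'
    have h2 : y' - a t = - (A (φ (h t)) - ContinuousLinearMap.id ℝ E) y' := by
      rw [← h1]; simp [hA]
    have h3 : ‖y' - a t‖ ≤ η' / 2 * ‖y'‖ := by
      rw [h2, norm_neg]
      exact (ContinuousLinearMap.le_opNorm _ _).trans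
        (mul_le_mul_of_nonneg_right (hball hb).1.1.le (norm_nonneg _))
    have h4 : ‖y'‖ ≤ ‖y' - a t‖ + ‖a t‖ := by
      simpa using norm_add_le (y' - a t) (a t)
    have h5 : η' ≤ 1 := min_le_right _ _
    have h6 : ‖y'‖ ≤ 2 * m := by
      nlinarith [ha t ht, norm_nonneg y']
    refine ⟨h6, h3.trans ?_⟩
    have h7 : η' ≤ η := min_le_left _ _
    nlinarith [norm_nonneg y']
  have hbound : ∀ t ∈ Icc (0 : ℝ) 1, (∀ s ∈ Icc (0 : ℝ) t, h s ∈ S) →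
      ‖φ (h t) - o‖ ≤ r / 2 := by
    intro t ht hs
    have hsub : ∀ s ∈ Icc (0 : ℝ) t, s ∈ Icc (0 : ℝ) 1 := fun s h => ⟨h.1, h.2.trans ht.2⟩
    choose! y' hy' using hder
    have := norm_image_sub_le_of_norm_deriv_le_segment' (f := fun s => φ (h s)) (f' := y')
      (a := 0) (b := t) (C := 2 * m)
      (fun s hst => (hy' s (hsub s hst) (hs s hst)).1.hasDerivWithinAt)
      (fun s hst => (hy' s (hsub s ⟨hst.1, hst.2.le⟩) (hs s ⟨hst.1, hst.2.le⟩)).2.1) t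
      ⟨ht.1, le_rfl⟩
    beta_reduce at this
    rw [h0] at this
    refine this.trans ?_
    nlinarith [ht.1, ht.2]
  -- Continuity argument on [0, 1]. The condition that the path lies in S up to time t is written
  -- with min u t, so that it is visibly closed in t. It is open to the right because the bound r/2
  -- is strict.
  have hall : Icc (0 : ℝ) 1 ⊆ {t | ∀ u ∈ Icc (0 : ℝ) 1, h (min u t) ∈ S} := by
    have h0S : h 0 ∈ S := ⟨o, Metric.mem_closedBall_self hr.le, by rw [ho, chartInv_chartOne, h0]⟩
    refine IsClosed.Icc_subset_of_forall_mem_nhdsWithin ?_ ?_ ?_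
    · refine IsClosed.inter ?_ isClosed_Icc
      simp only [ofPred_forall]
      refine isClosed_biInter fun u _ => ?_
      exact hScl.preimage (hh.continuous.comp (continuous_const.min continuous_id))
    · intro u hu
      rwa [min_eq_right hu.1]
    · rintro t ⟨ht, ht0, ht1⟩
      have hprev : ∀ s ∈ Icc (0 : ℝ) t, h s ∈ S := fun s hs => by
        have := ht s ⟨hs.1, hs.2.trans ht1.le⟩
        rwa [min_eq_left hs.2] at this
      have hbt := hbound t ⟨ht0, ht1.le⟩ hprev
      have htS := hSsrc _ (hprev t ⟨ht0, le_rfl⟩)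
      have hc : ContinuousAt (fun s => φ (h s)) t :=
        (continuousAt_extChartAt' htS.1).comp (hh t).1.continuousAt
      have hnear : ∀ᶠ s in 𝓝 t, h s ∈ S := by
        have e1 : ∀ᶠ s in 𝓝 t, h s ∈ φ.source := (hh t).1.continuousAt.eventually
          ((isOpen_extChartAt_source (I := 𝓘(ℝ, E)) (1 : G)).mem_nhds htS.1)
        have e2 : ∀ᶠ s in 𝓝 t, φ (h s) ∈ Metric.ball o r :=
          hc.eventually (Metric.isOpen_ball.mem_nhds (by
            rw [Metric.mem_ball, dist_eq_norm]; linarith))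
        filter_upwards [e1, e2] with s h1 h2
        exact ⟨φ (h s), Metric.ball_subset_closedBall h2, φ.left_inv h1⟩
      obtain ⟨ε, hε, hnear⟩ := Metric.eventually_nhds_iff_ball.1 hnear
      have : Ioo t (t + ε) ∈ 𝓝[>] t := Ioo_mem_nhdsGT (by linarith)
      filter_upwards [this] with s hs u hu
      rcases le_total (min u s) t with hle | hle
      · exact hprev _ ⟨le_min hu.1 (ht0.trans hs.1.le), hle⟩
      · refine hnear _ ?_
        rw [Real.ball_eq_Ioo]
        exact ⟨by linarith, (min_le_right _ _).trans_lt hs.2⟩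
  have hallS : ∀ t ∈ Icc (0 : ℝ) 1, h t ∈ S := fun t ht => by
    have := hall ht t ht
    rwa [min_self] at this
  refine ⟨(hSsrc _ (hallS 1 (by simp))).1, ?_⟩
  choose! y' hy' using hder
  have := norm_image_sub_le_of_norm_deriv_le_segment' (f := fun s => φ (h s) - K s)
    (f' := fun s => y' s - a s)
    (a := 0) (b := 1) (C := η * m)
    (fun s hs => ((hy' s hs (hallS s hs)).1.sub (hK s)).hasDerivWithinAt)
    (fun s hs => (hy' s ⟨hs.1, hs.2.le⟩ (hallS s ⟨hs.1, hs.2.le⟩)).2.2) 1 (by simp)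
  beta_reduce at this
  rw [h0, hK0, sub_zero, sub_zero, mul_one] at this
  rwa [sub_right_comm]

end SmallPaths

/-! ### The derivative of the exponential map. -/

section ExpDerivative

variable {E : Type*} [NormedAddCommGroup E] [NormedSpace ℝ E]
  {G : Type*} [TopologicalSpace G] [ChartedSpace E G] [Group G]
  [LieGroup 𝓘(ℝ, E) ∞ G] [FiniteDimensional ℝ E] [T2Space G]

/-- Both sides solve Y' = (ad ξ) Y with Y(0) = 1. -/
theorem Ad_lieExp_eq (ξ : E) (t : ℝ) : (Ad (lieExp G (t • ξ)) : E →L[ℝ] E) =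
    ContinuousLinearMap.id ℝ E + (lieBr G ξ).comp (jacobiOp t (-lieBr G ξ)) := by
  haveI : CompleteSpace E := FiniteDimensional.complete ℝ E
  refine congrFun (linear_ode_unique (ContinuousLinearMap.compL ℝ E E E (lieBr G ξ))
    (f := fun t : ℝ => (Ad (lieExp G (t • ξ)) : E →L[ℝ] E))
    (h := fun t => ContinuousLinearMap.id ℝ E + (lieBr G ξ).comp (jacobiOp t (-lieBr G ξ)))
    (fun t => hasDerivAt_Ad_lieExp ξ t) (fun t => ?_) ?_) t
  · have := ((hasDerivAt_const t (lieBr G ξ)).clm_comp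
      (hasDerivAt_jacobiOp (-lieBr G ξ) t)).const_add (ContinuousLinearMap.id ℝ E)
    convert! this using 1
    ext v; simp
  · ext v; simp [lieExp_zero, Ad_one, jacobiOp_zero]

theorem hasDerivAt_jacobiOp_neg (ξ : E) (t : ℝ) :
    HasDerivAt (fun t => jacobiOp t (-lieBr G ξ)) (Ad (lieExp G (t • ξ))) t := by
  haveI : CompleteSpace E := FiniteDimensional.complete ℝ E
  convert! hasDerivAt_jacobiOp (-lieBr G ξ) t using 1
  rw [Ad_lieExp_eq]
  ext v; simp

theorem Ad_lieExp_neg_eq (ξ : E) (t : ℝ) : (Ad (lieExp G (t • ξ))⁻¹ : E →L[ℝ] E) =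
    ContinuousLinearMap.id ℝ E - (lieBr G ξ).comp (jacobiOp t (lieBr G ξ)) := by
  rw [← lieExp_neg_smul, Ad_lieExp_eq]
  ext v; simp [sub_eq_add_neg]

theorem hasDerivAt_jacobiOp_Ad (ξ : E) (t : ℝ) :
    HasDerivAt (fun t => jacobiOp t (lieBr G ξ)) (Ad (lieExp G (t • ξ))⁻¹) t := by
  haveI : CompleteSpace E := FiniteDimensional.complete ℝ E
  rw [Ad_lieExp_neg_eq]
  exact hasDerivAt_jacobiOp _ t

theorem Ad_lieExp_lieBr_self (ξ : E) (t : ℝ) (v : E) :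
    Ad (lieExp G (t • ξ)) (lieBr G ξ v) = lieBr G ξ (Ad (lieExp G (t • ξ)) v) := by
  rw [Ad_lieBr, Ad_lieExp_smul_self]

/-- Both sides vanish at 0 and have derivative `Ad` (exp tξ). The identity passes between the left
and right trivialisations of d exp. -/
theorem Ad_lieExp_comp_jacobiOp (ξ : E) (t : ℝ) :
    (Ad (lieExp G (t • ξ)) : E →L[ℝ] E).comp (jacobiOp t (lieBr G ξ)) =
      jacobiOp t (-lieBr G ξ) := by
  haveI : CompleteSpace E := FiniteDimensional.complete ℝ E
  refine congrFun (affine_ode_unique 0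
    (f := fun t : ℝ => (Ad (lieExp G (t • ξ)) : E →L[ℝ] E).comp (jacobiOp t (lieBr G ξ)))
    (h := fun t => jacobiOp t (-lieBr G ξ)) (fun t => (Ad (lieExp G (t • ξ)) : E →L[ℝ] E))
    (fun t => ?_) (fun t => ?_) ?_) t
  · convert! (hasDerivAt_Ad_lieExp (G := G) ξ t).clm_comp (hasDerivAt_jacobiOp (lieBr G ξ) t)
      using 1
    ext v
    simp [Ad_lieExp_lieBr_self]
  · simpa using hasDerivAt_jacobiOp_neg (G := G) ξ t
  · simp [jacobiOp_zero]

theorem jacobiOp_lieBr_self (ξ : E) (t : ℝ) : jacobiOp t (lieBr G ξ) ξ = t • ξ := by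
  haveI : CompleteSpace E := FiniteDimensional.complete ℝ E
  refine congrFun (affine_ode_unique (-lieBr G ξ) (f := fun t => jacobiOp t (lieBr G ξ) ξ)
    (h := fun t => t • ξ) (fun _ => ξ) (fun t => ?_) (fun t => ?_) ?_) t
  · convert! (hasDerivAt_jacobiOp (lieBr G ξ) t).clm_apply (hasDerivAt_const t ξ) using 1
    simp [sub_eq_add_neg]
  · simpa [lieBr_self] using (hasDerivAt_id t).smul_const ξ
  · simp [jacobiOp_zero]

/-- Conjugating J by `Ad` a solves the equation that defines J for ad of `Ad` a ξ, because `Ad` a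
preserves brackets. -/
theorem jacobiOp_Ad (a : G) (ξ v : E) (t : ℝ) :
    jacobiOp t (lieBr G (Ad a ξ)) (Ad a v) = Ad a (jacobiOp t (lieBr G ξ) v) := by
  haveI : CompleteSpace E := FiniteDimensional.complete ℝ E
  have := jacobiOp_unique (lieBr G (Ad a ξ))
    (J := fun t => (Ad a : E →L[ℝ] E).comp ((jacobiOp t (lieBr G ξ)).comp (Ad a⁻¹ : E →L[ℝ] E)))
    (fun t => ?_) (by simp [jacobiOp_zero]) t
  · rw [← this]; simp [Ad_inv_Ad]
  · convert! (hasDerivAt_const t (Ad a : E →L[ℝ] E)).clm_comp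
      ((hasDerivAt_jacobiOp (lieBr G ξ) t).clm_comp (hasDerivAt_const t (Ad a⁻¹ : E →L[ℝ] E)))
      using 1
    ext v
    simp [Ad_lieBr, Ad_Ad_inv]

/-- The ξ contributions of the two factors cancel, since `Ad` (exp tξ) fixes ξ. The remaining
logarithmic derivative is linear in ζ, hence small with ζ. -/
theorem isLogPath_lieExp_mul_inv (ξ ζ : E) :
    IsLogPath G (fun t : ℝ => lieExp G (t • (ξ + ζ)) * (lieExp G (t • ξ))⁻¹)
      (fun t => Ad (lieExp G (t • ξ)) ζ) := by
  have := (isLogPath_lieExp (G := G) (ξ + ζ)).mul (isLogPath_lieExp ξ).inv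
  convert! this using 2 with t
  simp

/-- The path exp(t(ξ+ζ)) exp(tξ)⁻¹ runs from 1 to the point in question with logarithmic derivative
`Ad` (exp tξ) ζ. By `exists_chart_approx` its endpoint is, up to o(ζ), the integral of that
derivative, namely J_1(-ad ξ) ζ. -/
theorem hasFDerivAt_chart_lieExp (ξ : E) :
    HasFDerivAt (fun ξ' => extChartAt 𝓘(ℝ, E) (1 : G) (lieExp G ξ' * (lieExp G ξ)⁻¹))
      (jacobiOp 1 (-lieBr G ξ)) ξ ∧
    ∀ᶠ ξ' in 𝓝 ξ, lieExp G ξ' * (lieExp G ξ)⁻¹ ∈ (extChartAt 𝓘(ℝ, E) (1 : G)).source := by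
  haveI : CompleteSpace E := FiniteDimensional.complete ℝ E
  obtain ⟨C, hC⟩ : ∃ C : ℝ, ∀ t ∈ Icc (0 : ℝ) 1, ‖(Ad (lieExp G (t • ξ)) : E →L[ℝ] E)‖ ≤ C := by
    refine isCompact_Icc.exists_bound_of_continuousOn ?_
    exact continuousOn_of_forall_continuousAt fun t _ =>
      (hasDerivAt_Ad_lieExp (G := G) ξ t).continuousAt
  set C' := max C 1
  have hC' : 0 < C' := lt_of_lt_of_le one_pos (le_max_right _ _)
  have key : ∀ c : ℝ, 0 < c → ∀ᶠ ζ in 𝓝 (0 : E),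
      lieExp G (ξ + ζ) * (lieExp G ξ)⁻¹ ∈ (extChartAt 𝓘(ℝ, E) (1 : G)).source ∧
      ‖extChartAt 𝓘(ℝ, E) (1 : G) (lieExp G (ξ + ζ) * (lieExp G ξ)⁻¹) - chartOne E G -
        jacobiOp 1 (-lieBr G ξ) ζ‖ ≤ c * ‖ζ‖ := by
    intro c hc
    -- The logarithmic derivative has norm at most C' ‖ζ‖, so the tolerance c / C' yields an error
    -- of at most c ‖ζ‖.
    obtain ⟨δ, hδ, H⟩ := exists_chart_approx (E := E) (G := G) (η := c / C') (by positivity)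
    filter_upwards [Metric.ball_mem_nhds (0 : E) (ε := δ / C') (by positivity)] with ζ hζ
    rw [mem_ball_zero_iff] at hζ
    have := H _ _ (fun t => jacobiOp t (-lieBr G ξ) ζ) (C' * ‖ζ‖) (by simp [lieExp_zero])
      (isLogPath_lieExp_mul_inv (G := G) ξ ζ)
      (fun t => by
        simpa using (hasDerivAt_jacobiOp_neg (G := G) ξ t).clm_apply (hasDerivAt_const t ζ))
      (by simp [jacobiOp_zero])
      (by rw [mul_comm]; exact ((lt_div_iff₀ hC').1 hζ).le)
      (fun t ht => (ContinuousLinearMap.le_opNorm _ _).trans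
        (mul_le_mul_of_nonneg_right ((hC t ht).trans (le_max_left _ _)) (norm_nonneg _)))
    simp only [one_smul] at this
    refine ⟨this.1, this.2.trans (le_of_eq ?_)⟩
    field_simp
  constructor
  · rw [hasFDerivAt_iff_isLittleO_nhds_zero, Asymptotics.isLittleO_iff]
    intro c hc
    filter_upwards [key c hc] with ζ hζ
    rw [mul_inv_cancel]
    exact hζ.2
  · have h := (key 1 one_pos).mono fun _ h => h.1
    have ht : Tendsto (fun ξ' => ξ' - ξ) (𝓝 ξ) (𝓝 0) := by
      have : Continuous fun ξ' : E => ξ' - ξ := by fun_prop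
      simpa using this.tendsto ξ
    simpa using ht.eventually h

/-- Undo the right translation by exp ξ. This turns J_1(-ad ξ) into its image under `Ad` (exp ξ)⁻¹,
which is J_1(ad ξ). -/
theorem mdifferentiableAt_lieExp (ξ : E) :
    MDifferentiableAt 𝓘(ℝ, E) 𝓘(ℝ, E) (lieExp G : E → G) ξ ∧
      logD E 𝓘(ℝ, E) (lieExp G : E → G) ξ = jacobiOp 1 (lieBr G ξ) := by
  haveI : CompleteSpace E := FiniteDimensional.complete ℝ E
  obtain ⟨h1, h2⟩ := hasFDerivAt_chart_lieExp (G := G) ξ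
  set k : E → E := fun ξ' => extChartAt 𝓘(ℝ, E) (1 : G) (lieExp G ξ' * (lieExp G ξ)⁻¹) with hk
  have hkξ : k ξ = chartOne E G := by simp [hk, chartOne]
  have hc := (contMDiffAt_chartInv (E := E) (G := G)).mdifferentiableAt (by simp)
  have hev : (lieExp G : E → G) =ᶠ[𝓝 ξ] fun ξ' => chartInv E G (k ξ') * lieExp G ξ := by
    filter_upwards [h2] with ξ' h
    have : chartInv E G (k ξ') = lieExp G ξ' * (lieExp G ξ)⁻¹ :=
      (extChartAt 𝓘(ℝ, E) (1 : G)).left_inv h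
    rw [this]; group
  have hkd : MDifferentiableAt 𝓘(ℝ, E) 𝓘(ℝ, E) k ξ := h1.differentiableAt.mdifferentiableAt
  have hcd : MDifferentiableAt 𝓘(ℝ, E) 𝓘(ℝ, E) (chartInv E G) (k ξ) := by rwa [hkξ]
  have hd : MDifferentiableAt 𝓘(ℝ, E) 𝓘(ℝ, E) (fun ξ' => chartInv E G (k ξ')) ξ := hcd.comp ξ hkd
  refine ⟨(MDiffAt.gmul_const _ hd).congr_of_eventuallyEq hev, ?_⟩
  ext v
  rw [logD_congr hev, logD_mul_const hd, logD_comp (f := chartInv E G) (k := k) hcd hkd, hkξ,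
    logD_chartInv_one, mD_eq_fderiv, h1.fderiv]
  have := Ad_lieExp_comp_jacobiOp (G := G) ξ 1
  rw [one_smul] at this
  rw [← this]
  simp [Ad_inv_Ad]

theorem logD_lieExp (ξ : E) :
    logD E 𝓘(ℝ, E) (lieExp G : E → G) ξ = jacobiOp 1 (lieBr G ξ) :=
  (mdifferentiableAt_lieExp ξ).2

end ExpDerivative

/-! ### The homotopy operator and the Poincaré lemma. -/

section Poincare

variable {V : Type*} [NormedAddCommGroup V] [NormedSpace ℝ V] [FiniteDimensional ℝ V]
  {W : Type*} [NormedAddCommGroup W] [NormedSpace ℝ W]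

theorem hasFDerivAt_slice {K : ℝ × V → W} (hK : ContDiff ℝ ∞ K) (t : ℝ) (y : V) :
    HasFDerivAt (fun y => K (t, y)) ((fderiv ℝ K (t, y)).comp (ContinuousLinearMap.inr ℝ ℝ V)) y :=
  (hK.differentiable (by simp) (t, y)).hasFDerivAt.comp y (hasFDerivAt_prodMk_right t y)

theorem continuous_fderiv_slice {K : ℝ × V → W} (hK : ContDiff ℝ ∞ K) :
    Continuous fun p : ℝ × V => fderiv ℝ (fun y => K (p.1, y)) p.2 := by
  simp only [fun p : ℝ × V => (hasFDerivAt_slice hK p.1 p.2).fderiv]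
  exact (hK.continuous_fderiv (by simp)).clm_comp continuous_const

/-- Differentiation under the integral sign. The dominating constant is the maximum of the
derivative on the compact product of [0, 1] with a closed ball. -/
theorem hasFDerivAt_integral_of_contDiff {K : ℝ × V → W} (hK : ContDiff ℝ ∞ K) (x : V) :
    HasFDerivAt (fun y => ∫ t in (0 : ℝ)..1, K (t, y))
      (∫ t in (0 : ℝ)..1, fderiv ℝ (fun y => K (t, y)) x) x := by
  haveI : ProperSpace V := FiniteDimensional.proper ℝ V
  have hc := continuous_fderiv_slice hK
  obtain ⟨C, hC⟩ := (isCompact_Icc.prod (isCompact_closedBall x 1)).exists_bound_of_continuousOn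
    (s := Icc (0 : ℝ) 1 ×ˢ Metric.closedBall x 1) hc.continuousOn
  have hK' := hK.continuous
  refine intervalIntegral.hasFDerivAt_integral_of_dominated_of_fderiv_le
    (F' := fun y t => fderiv ℝ (fun y => K (t, y)) y) (bound := fun _ => C)
    (Metric.ball_mem_nhds x one_pos) ?_ ?_ ?_ ?_ ?_ ?_
  · exact Eventually.of_forall fun y =>
      (hK'.comp (Continuous.prodMk_left y)).aestronglyMeasurable
  · exact (hK'.comp (Continuous.prodMk_left x)).intervalIntegrable _ _
  · exact (hc.comp (Continuous.prodMk_left x)).aestronglyMeasurable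
  · refine Eventually.of_forall fun t ht y hy => ?_
    rw [uIoc_of_le zero_le_one] at ht
    exact hC (t, y) ⟨⟨ht.1.le, ht.2⟩, Metric.ball_subset_closedBall hy⟩
  · exact intervalIntegrable_const
  · exact Eventually.of_forall fun t _ y _ => (hasFDerivAt_slice hK t y).differentiableAt.hasFDerivAt

variable (V) in
/-- `curryLeft` as a continuous linear map. -/
def curryLeftCLM (n : ℕ) :=
  (ContinuousAlternatingMap.curryLeftLI :
    (V [⋀^Fin (n + 1)]→L[ℝ] ℝ) →ₗᵢ[ℝ] (V →L[ℝ] V [⋀^Fin n]→L[ℝ] ℝ)).toContinuousLinearMap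

theorem ContDiff.curryLeft {X : Type*} [NormedAddCommGroup X] [NormedSpace ℝ X] {n : ℕ}
    {g : X → V [⋀^Fin (n + 1)]→L[ℝ] ℝ} (hg : ContDiff ℝ ∞ g) :
    ContDiff ℝ ∞ fun y => (g y).curryLeft := by
  have h := ContinuousLinearMap.contDiff (𝕜 := ℝ) (n := ∞)
      (E := V [⋀^Fin (n + 1)]→L[ℝ] ℝ) (F := V →L[ℝ] V [⋀^Fin n]→L[ℝ] ℝ) (curryLeftCLM V n)
  exact h.comp hg

theorem HasFDerivAt.curryLeft {X : Type*} [NormedAddCommGroup X] [NormedSpace ℝ X] {n : ℕ}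
    {g : X → V [⋀^Fin (n + 1)]→L[ℝ] ℝ} {g' : X →L[ℝ] V [⋀^Fin (n + 1)]→L[ℝ] ℝ} {x : X}
    (hg : HasFDerivAt g g' x) :
    HasFDerivAt (fun y => (g y).curryLeft) ((curryLeftCLM V n).comp g') x := by
  have h := ContinuousLinearMap.hasFDerivAt (𝕜 := ℝ) (x := g x)
      (E := V [⋀^Fin (n + 1)]→L[ℝ] ℝ) (F := V →L[ℝ] V [⋀^Fin n]→L[ℝ] ℝ) (curryLeftCLM V n)
  exact HasFDerivAt.comp (𝕜 := ℝ) (F := V [⋀^Fin (n + 1)]→L[ℝ] ℝ)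
    (G := V →L[ℝ] V [⋀^Fin n]→L[ℝ] ℝ) x h hg

theorem homotopyOp_eq {n : ℕ} (γ : V → V [⋀^Fin (n + 1)]→L[ℝ] ℝ) (x : V) :
    homotopyOp γ x = ∫ t in (0 : ℝ)..1, t ^ n • (γ (t • x)).curryLeft x := by
  unfold homotopyOp
  congr 1
  ext t w
  have : (⇑(t • ContinuousLinearMap.id ℝ V) ∘ w) = fun i => t • w i := rfl
  simp only [ContinuousAlternatingMap.compContinuousLinearMap_apply, this,
    ContinuousAlternatingMap.map_smul_univ]
  simp

theorem contDiff_homotopyOp_integrand {n : ℕ} {γ : V → V [⋀^Fin (n + 1)]→L[ℝ] ℝ}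
    (hγ : ContDiff ℝ ∞ γ) :
    ContDiff ℝ ∞ (fun p : ℝ × V => p.1 ^ n • (γ (p.1 • p.2)).curryLeft p.2) := by
  have h1 : ContDiff ℝ ∞ (fun p : ℝ × V => γ (p.1 • p.2)) :=
    hγ.comp (contDiff_fst.smul contDiff_snd)
  exact (contDiff_fst.pow n).smul ((ContDiff.curryLeft h1).clm_apply contDiff_snd)

theorem homotopyOp_apply {n : ℕ} {γ : V → V [⋀^Fin (n + 1)]→L[ℝ] ℝ} (hγ : ContDiff ℝ ∞ γ) (x : V)
    (w : Fin n → V) :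
    homotopyOp γ x w = ∫ t in (0 : ℝ)..1, t ^ n * γ (t • x) (Matrix.vecCons x w) := by
  rw [homotopyOp_eq]
  have := ContinuousLinearMap.intervalIntegral_comp_comm (𝕜 := ℝ) (μ := MeasureTheory.volume)
    (a := 0) (b := 1) (ContinuousAlternatingMap.apply ℝ V ℝ w)
    (((contDiff_homotopyOp_integrand hγ).continuous.comp
      (Continuous.prodMk_left x)).intervalIntegrable 0 1)
  exact this.symm

theorem differentiable_homotopyOp {n : ℕ} {γ : V → V [⋀^Fin (n + 1)]→L[ℝ] ℝ}
    (hγ : ContDiff ℝ ∞ γ) : Differentiable ℝ (homotopyOp γ) := fun x => by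
  have := hasFDerivAt_integral_of_contDiff (contDiff_homotopyOp_integrand hγ) x
  rw [show homotopyOp γ = _ from funext (homotopyOp_eq γ)]
  exact this.differentiableAt

/-- For closed γ, alternating the derivative of t^n ι_x γ(tx) gives exactly d/dt of t^{n+1} γ(tx).
Integration over [0, 1] leaves γ(x). -/
theorem extDeriv_homotopyOp {n : ℕ} {γ : V → V [⋀^Fin (n + 1)]→L[ℝ] ℝ} (hγ : ContDiff ℝ ∞ γ)
    (hd : extDeriv γ = 0) : extDeriv (homotopyOp γ) = γ := by
  funext x
  have h1 := hasFDerivAt_integral_of_contDiff (contDiff_homotopyOp_integrand hγ) x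
  have hγd (y : V) := (hγ.differentiable (by simp) y).hasFDerivAt
  have h2 (t : ℝ) : ContinuousAlternatingMap.alternatizeUncurryFinCLM ℝ V ℝ
      (fderiv ℝ (fun y => t ^ n • (γ (t • y)).curryLeft y) x) =
      ((n + 1) * t ^ n) • γ (t • x) + t ^ (n + 1) • fderiv ℝ γ (t • x) x := by
    have a1 : HasFDerivAt (fun y => γ (t • y)) (t • fderiv ℝ γ (t • x)) x := by
      convert! (hγd (t • x)).comp x ((hasFDerivAt_id x).const_smul t) using 1
      ext v; simp
    have a2 := ((HasFDerivAt.curryLeft a1).clm_apply (hasFDerivAt_id x))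
    have a3 := (a2.const_smul (t ^ n)).fderiv
    refine (congrArg _ a3).trans ?_
    ext w
    have hc := congrArg (fun f => f (Matrix.vecCons x w)) (congrFun hd (t • x))
    simp only [extDeriv, ContinuousAlternatingMap.alternatizeUncurryFin_apply,
      Fin.sum_univ_succ (n := n + 1)] at hc
    have hr (i : Fin (n + 1)) : i.succ.removeNth (Matrix.vecCons x w) =
        Matrix.vecCons x (i.removeNth w) := by
      funext j
      refine Fin.cases ?_ (fun k => ?_) j <;> simp [Fin.removeNth]
    -- Closedness at tx, evaluated on (x, w), trades the alternating sum for the radial derivative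
    -- of γ.
    have hs : ∑ i : Fin (n + 1), (-1) ^ (i : ℕ) *
        curryLeftCLM V n (fderiv ℝ γ (t • x) (w i)) x (i.removeNth w) =
        fderiv ℝ γ (t • x) x w := by
      have h0 : Fin.removeNth 0 (Matrix.vecCons x w) = w := rfl
      simp only [h0, hr, Fin.val_succ, pow_succ, Fin.val_zero, pow_zero, one_smul, mul_neg_one,
        neg_smul, Finset.sum_neg_distrib, Matrix.cons_val_zero, Matrix.cons_val_succ] at hc
      refine Eq.trans (Finset.sum_congr rfl fun i _ => ?_)
        (sub_eq_zero.1 ((sub_eq_add_neg _ _).trans hc)).symm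
      simp [curryLeftCLM]
    simp [ContinuousAlternatingMap.alternatizeUncurryFin_apply]
    rw [hs]
    ring
  have h3 (t : ℝ) : HasDerivAt (fun t : ℝ => t ^ (n + 1) • γ (t • x))
      (((n + 1) * t ^ n) • γ (t • x) + t ^ (n + 1) • fderiv ℝ γ (t • x) x) t := by
    have b1 : HasDerivAt (fun t : ℝ => γ (t • x)) (fderiv ℝ γ (t • x) x) t := by
      have := (hγd (t • x)).comp_hasDerivAt t ((hasDerivAt_id t).smul_const x)
      rw [one_smul] at this
      exact this
    convert! (hasDerivAt_pow (n + 1) t).smul b1 using 1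
    simp [add_comm]
  rw [show homotopyOp γ = _ from funext (homotopyOp_eq γ)]
  have hcont : Continuous fun t : ℝ => fderiv ℝ (fun y => t ^ n • (γ (t • y)).curryLeft y) x :=
    (continuous_fderiv_slice (contDiff_homotopyOp_integrand hγ)).comp (Continuous.prodMk_left x)
  refine (congrArg (ContinuousAlternatingMap.alternatizeUncurryFinCLM ℝ V ℝ) h1.fderiv).trans ?_
  refine (ContinuousLinearMap.intervalIntegral_comp_comm (𝕜 := ℝ) _
    (E := V →L[ℝ] V [⋀^Fin n]→L[ℝ] ℝ) (F := V [⋀^Fin (n + 1)]→L[ℝ] ℝ)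
    (hcont.intervalIntegrable (μ := MeasureTheory.volume) 0 1)).symm.trans ?_
  simp only [h2]
  rw [intervalIntegral.integral_eq_sub_of_hasDerivAt (fun t _ => h3 t)]
  · simp
  · simp only [← h2]
    exact ((ContinuousLinearMap.continuous _).comp hcont).intervalIntegrable _ _

end Poincare

/-! ### Interchange of the time derivative and the space derivative. -/

section MixedPartials

variable {V : Type*} [NormedAddCommGroup V] [NormedSpace ℝ V] [FiniteDimensional ℝ V]
  {W : Type*} [NormedAddCommGroup W] [NormedSpace ℝ W]

theorem hasDerivAt_fderiv_slice {K : ℝ × V → W} (hK : ContDiff ℝ ∞ K) {K' : ℝ → V → W}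
    (hK' : ∀ t y, HasDerivAt (fun t => K (t, y)) (K' t y) t) (t : ℝ) (x u : V) :
    HasDerivAt (fun t => fderiv ℝ (fun y => K (t, y)) x u) (fderiv ℝ (K' t) x u) t := by
  have hs (t : ℝ) (y : V) := (hasFDerivAt_slice hK t y).fderiv
  have hd (p : ℝ × V) := ((hK.fderiv_right (m := ∞) (by simp)).differentiable
    (by simp) p).hasFDerivAt
  have h1 (t : ℝ) (y : V) : K' t y = fderiv ℝ K (t, y) (1, 0) :=
    (hK' t y).unique (((hK.differentiable (by simp) (t, y)).hasFDerivAt).comp_hasDerivAt t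
      ((hasDerivAt_id t).prodMk (hasDerivAt_const t y)))
  have h2 : K' t = fun y => fderiv ℝ K (t, y) (1, 0) := funext (h1 t)
  have h3 (p : ℝ × V) (w : ℝ × V) : HasFDerivAt (fun q => fderiv ℝ K q w)
      ((fderiv ℝ (fderiv ℝ K) p).flip w) p := by
    have := (hd p).clm_apply (hasFDerivAt_const w p)
    rwa [ContinuousLinearMap.comp_zero, zero_add] at this
  have h4 : HasDerivAt (fun t => fderiv ℝ K (t, x) (0, u))
      (fderiv ℝ (fderiv ℝ K) (t, x) (1, 0) (0, u)) t := by
    have hc : HasDerivAt (fun t : ℝ => (t, x)) (1, 0) t :=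
      (hasDerivAt_id t).prodMk (hasDerivAt_const t x)
    exact HasFDerivAt.comp_hasDerivAt (f := fun t : ℝ => (t, x)) t (h3 (t, x) (0, u)) hc
  have hsymm := (hK.contDiffAt (x := (t, x))).isSymmSndFDerivAt (by simp; exact WithTop.coe_le_coe.2 le_top)
  have h3' : fderiv ℝ (K' t) x u = fderiv ℝ (fderiv ℝ K) (t, x) (0, u) (1, 0) := by
    rw [h2]
    exact DFunLike.congr_fun ((h3 (t, x) (1, 0)).comp x (hasFDerivAt_prodMk_right t x)).fderiv u
  have h5 : (fun t => fderiv ℝ (fun y => K (t, y)) x u) = fun t => fderiv ℝ K (t, x) (0, u) := by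
    funext t; rw [hs]; simp
  rw [h3', hsymm.eq, h5]
  exact h4

end MixedPartials

/-! ### The Maurer–Cartan equation for the derivative of exp. -/

section MaurerCartanExp

variable {E : Type*} [NormedAddCommGroup E] [NormedSpace ℝ E]
  {G : Type*} [TopologicalSpace G] [ChartedSpace E G] [Group G]
  [LieGroup 𝓘(ℝ, E) ∞ G] [FiniteDimensional ℝ E]

theorem contDiff_jacobiOp_clm [CompleteSpace E] (L : E →L[ℝ] E →L[ℝ] E) :
    ContDiff ℝ ∞ (fun p : ℝ × E => jacobiOp p.1 (L p.2)) := by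
  have h : ContDiff ℝ ∞ (fun p : ℝ × E => (p.1, L p.2)) := by fun_prop
  exact contDiff_jacobiOp.comp h

/-- Let W_t be the left side plus [J_t u, J_t v]. By the equation for J and the Jacobi identity, W'
= -[x, W] with W_0 = 0, so W vanishes. `fderiv_logD_sub` does not apply directly, since exp is known
here only to be differentiable. -/
theorem fderiv_jacobiOp_sub (t : ℝ) (x u v : E) :
    fderiv ℝ (fun y => jacobiOp t (lieBr G y)) x u v -
      fderiv ℝ (fun y => jacobiOp t (lieBr G y)) x v u =
    -lieBr G (jacobiOp t (lieBr G x) u) (jacobiOp t (lieBr G x) v) := by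
  haveI : CompleteSpace E := FiniteDimensional.complete ℝ E
  have hK := contDiff_jacobiOp_clm (lieBr (E := E) G)
  have hA (u : E) (t : ℝ) : HasDerivAt (fun t => fderiv ℝ (fun y => jacobiOp t (lieBr G y)) x u)
      (-(lieBr G u).comp (jacobiOp t (lieBr G x)) -
        (lieBr G x).comp (fderiv ℝ (fun y => jacobiOp t (lieBr G y)) x u)) t := by
    have h := hasDerivAt_fderiv_slice hK (fun t y => hasDerivAt_jacobiOp (lieBr G y) t) t x u
    refine h.congr_deriv ?_
    have hd : HasFDerivAt (fun y => jacobiOp t (lieBr G y)) _ x :=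
      (hasFDerivAt_slice hK t x).differentiableAt.hasFDerivAt
    have hd' := (((lieBr G).hasFDerivAt (x := x)).clm_comp hd).const_sub (ContinuousLinearMap.id ℝ E)
    refine (DFunLike.congr_fun hd'.fderiv u).trans ?_
    ext w
    simp
    abel
  have hJ (u : E) (t : ℝ) : HasDerivAt (fun t => jacobiOp t (lieBr G x) u)
      (u - lieBr G x (jacobiOp t (lieBr G x) u)) t := by
    simpa using (hasDerivAt_jacobiOp (lieBr G x) t).clm_apply (hasDerivAt_const t u)
  have hA' (u v : E) (t : ℝ) : HasDerivAt
      (fun t => fderiv ℝ (fun y => jacobiOp t (lieBr G y)) x u v)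
      (-(lieBr G u (jacobiOp t (lieBr G x) v)) -
        lieBr G x (fderiv ℝ (fun y => jacobiOp t (lieBr G y)) x u v)) t := by
    simpa using (hA u t).clm_apply (hasDerivAt_const t v)
  have hB (t : ℝ) := (lieBr G).hasDerivAt_of_bilinear (fun _ => hJ u t) (fun _ => hJ v t)
  have hW (t : ℝ) := ((hA' u v t).fun_sub (hA' v u t)).fun_add (hB t)
  have h := congrFun (linear_ode_unique (-lieBr G x) (h := fun _ => 0) (fun t => by
    refine (hW t).congr_deriv ?_
    have e1 := lieBr_leibniz (G := G) x (jacobiOp t (lieBr G x) u) (jacobiOp t (lieBr G x) v)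
    have e2 := lieBr_swap (G := G) v (jacobiOp t (lieBr G x) u)
    simp only [map_sub, map_add, neg_apply, sub_apply, e1, e2]
    abel) (fun t => by simpa using hasDerivAt_const t (0 : E)) (by simp [jacobiOp_zero])) t
  exact eq_neg_of_add_eq_zero_left h

end MaurerCartanExp

/-! ### Closedness of the form B(α, [α, α]). -/

section ClosedThreeForm

variable {E : Type*} [NormedAddCommGroup E] [NormedSpace ℝ E]
  {G : Type*} [TopologicalSpace G] [ChartedSpace E G] [Group G]
  [LieGroup 𝓘(ℝ, E) ∞ G] [FiniteDimensional ℝ E]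
  {V : Type*} [NormedAddCommGroup V] [NormedSpace ℝ V]
  {B : E →L[ℝ] E →L[ℝ] ℝ}

theorem IsInvariantInner.cyclic (hB : IsInvariantInner G B) (x y z : E) :
    B x (lieBr G y z) = B z (lieBr G x y) := by
  rw [hB.symm x, hB.lieBr_left, lieBr_swap y x]; simp

theorem IsInvariantInner.swap_left (hB : IsInvariantInner G B) (x y z : E) :
    B x (lieBr G y z) = - B y (lieBr G x z) := by
  rw [hB.cyclic, hB.cyclic, lieBr_swap z x]; simp

/-- By cyclicity and antisymmetry all six terms of α · [α, α] agree, which absorbs the factor 1/6.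
-/
theorem dotBracket_apply (hB : IsInvariantInner G B) (α : V →L[ℝ] E) (v : Fin 3 → V) :
    ((1 / 6 : ℝ) • dotBracket B (lieBr G) α) v =
      B (α (v 0)) (lieBr G (α (v 1)) (α (v 2))) := by
  change (1 / 6 : ℝ) * (_ + _ + _) = _
  rw [lieBr_swap (α (v 2)) (α (v 1)), lieBr_swap (α (v 0)) (α (v 2)),
    lieBr_swap (α (v 1)) (α (v 0))]
  simp only [map_sub, map_neg]
  rw [hB.cyclic (α (v 2)), hB.cyclic (α (v 1))]
  ring

theorem hasFDerivAt_triple (L : E →L[ℝ] E →L[ℝ] E) {α : V → V →L[ℝ] E} {x : V}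
    (hα : DifferentiableAt ℝ α x) (u v w z : V) :
    fderiv ℝ (fun y => B (α y u) (L (α y v) (α y w))) x z =
      B (fderiv ℝ α x z u) (L (α x v) (α x w)) + B (α x u) (L (fderiv ℝ α x z v) (α x w)) +
        B (α x u) (L (α x v) (fderiv ℝ α x z w)) := by
  have h (u : V) := hα.hasFDerivAt.clm_apply (hasFDerivAt_const u x)
  have h1 := (L.hasFDerivAt.comp x (h v)).clm_apply (h w)
  have h2 := (B.hasFDerivAt.comp x (h u)).clm_apply h1
  refine (DFunLike.congr_fun h2.fderiv z).trans ?_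
  simp
  ring

/-- The algebra behind closedness. Here ab stands for the derivative of α(v₁) in the direction v₀,
and so on; the opposite order differs by a bracket, by Maurer–Cartan. The derivative terms cancel by
invariance and the quartic bracket terms by Jacobi. -/
theorem IsInvariantInner.closed_identity (hB : IsInvariantInner G B) (a b c d : E)
    (ab ac ad bc bd cd : E) :
    (B ab (lieBr G c d) + B b (lieBr G ac d) + B b (lieBr G c ad)) -
    (B (ab + lieBr G a b) (lieBr G c d) + B a (lieBr G bc d) + B a (lieBr G c bd)) +
    (B (ac + lieBr G a c) (lieBr G b d) + B a (lieBr G (bc + lieBr G b c) d) +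
      B a (lieBr G b cd)) -
    (B (ad + lieBr G a d) (lieBr G b c) + B a (lieBr G (bd + lieBr G b d) c) +
      B a (lieBr G b (cd + lieBr G c d))) = 0 := by
  simp only [map_add, add_apply]
  rw [hB.swap_left b ac, hB.cyclic b c ad, hB.swap_left a bc, hB.cyclic a c bd,
    hB.swap_left a bd, hB.cyclic a b cd, lieBr_swap a b, lieBr_swap a c, lieBr_swap a d]
  have h1 := congrArg (B a) (lieBr_leibniz (G := G) b c d)
  simp only [map_add, map_neg, neg_apply, hB.lieBr_left _ a] at h1 ⊢
  rw [lieBr_swap d (lieBr G b c), lieBr_swap (lieBr G b d) c]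
  simp only [map_neg]
  linarith

theorem extDeriv_dotBracket (hB : IsInvariantInner G B) {α : V → V →L[ℝ] E} {x : V}
    (hα : DifferentiableAt ℝ α x)
    (hMC : ∀ u v, fderiv ℝ α x u v - fderiv ℝ α x v u = -lieBr G (α x u) (α x v))
    {γ : V → V [⋀^Fin 3]→L[ℝ] ℝ} (hγ : DifferentiableAt ℝ γ x)
    (hγα : ∀ y v, γ y v = B (α y (v 0)) (lieBr G (α y (v 1)) (α y (v 2)))) :
    extDeriv γ x = 0 := by
  ext v
  rw [extDeriv_apply hγ]
  simp only [hγα, hasFDerivAt_triple _ hα]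
  have e (u w : V) : fderiv ℝ α x u w =
      fderiv ℝ α x w u + lieBr G (α x w) (α x u) := by
    rw [← sub_eq_iff_eq_add', hMC, lieBr_swap]; simp
  rw [Fin.sum_univ_four]
  simp [Fin.removeNth, Fin.succAbove]
  rw [e (v 1) (v 0), e (v 2) (v 0), e (v 3) (v 0), e (v 2) (v 1), e (v 3) (v 1), e (v 3) (v 2)]
  have := hB.closed_identity (α x (v 0)) (α x (v 1)) (α x (v 2)) (α x (v 3))
    (fderiv ℝ α x (v 0) (v 1)) (fderiv ℝ α x (v 0) (v 2)) (fderiv ℝ α x (v 0) (v 3))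
    (fderiv ℝ α x (v 1) (v 2)) (fderiv ℝ α x (v 1) (v 3)) (fderiv ℝ α x (v 2) (v 3))
  linarith

end ClosedThreeForm

/-! ### Regularity of form-valued maps, tested on fixed vectors. -/

section AlternatingEval

variable {V : Type*} [NormedAddCommGroup V] [NormedSpace ℝ V] [FiniteDimensional ℝ V]
  {X : Type*} [NormedAddCommGroup X] [NormedSpace ℝ X]

variable (V) in
-- An alternating form is determined by its values on tuples of basis vectors. The evaluation map is
-- therefore injective and linear, and has a linear left inverse, continuous by finite dimension.
theorem exists_alternating_reconstruction (n : ℕ) :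
    ∃ (d : ℕ) (b : Fin d → V) (g : ((Fin n → Fin d) → ℝ) →L[ℝ] V [⋀^Fin n]→L[ℝ] ℝ),
      ∀ f : V [⋀^Fin n]→L[ℝ] ℝ, g (fun s => f (b ∘ s)) = f := by
  let b := Module.finBasis ℝ V
  let Ψ : (V [⋀^Fin n]→L[ℝ] ℝ) →ₗ[ℝ] ((Fin n → Fin (Module.finrank ℝ V)) → ℝ) :=
    { toFun := fun f s => f (b ∘ s)
      map_add' := fun _ _ => rfl
      map_smul' := fun _ _ => rfl }
  have hΨ : LinearMap.ker Ψ = ⊥ := by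
    rw [LinearMap.ker_eq_bot]
    intro f f' h
    refine ContinuousAlternatingMap.toAlternatingMap_injective
      (AlternatingMap.coe_multilinearMap_injective (Module.Basis.ext_multilinear (fun _ => b)
        fun s => congrFun h s))
  obtain ⟨g, hg⟩ := Ψ.exists_leftInverse_of_injective hΨ
  exact ⟨_, b, LinearMap.toContinuousLinearMap g, fun f => DFunLike.congr_fun hg f⟩

theorem contDiff_alternating {n : ℕ} {f : X → V [⋀^Fin n]→L[ℝ] ℝ}
    (h : ∀ v, ContDiff ℝ ∞ fun x => f x v) : ContDiff ℝ ∞ f := by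
  obtain ⟨d, b, g, hg⟩ := exists_alternating_reconstruction V n
  have h1 : ContDiff ℝ ∞ fun x => (fun s : Fin n → Fin d => f x (b ∘ s)) :=
    contDiff_pi.2 fun s => h _
  have h2 := ContinuousLinearMap.contDiff (𝕜 := ℝ) (n := ∞) (E := (Fin n → Fin d) → ℝ)
    (F := V [⋀^Fin n]→L[ℝ] ℝ) g
  have h3 := h2.comp h1
  convert! h3 using 1
  funext x
  exact (hg (f x)).symm

theorem differentiableAt_alternating {n : ℕ} {f : X → V [⋀^Fin n]→L[ℝ] ℝ} {x : X}
    (h : ∀ v, DifferentiableAt ℝ (fun x => f x v) x) : DifferentiableAt ℝ f x := by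
  obtain ⟨d, b, g, hg⟩ := exists_alternating_reconstruction V n
  have h1 : DifferentiableAt ℝ (fun x => (fun s : Fin n → Fin d => f x (b ∘ s))) x :=
    differentiableAt_pi.2 fun s => h _
  have h2 := ContinuousLinearMap.differentiable (𝕜 := ℝ) (E := (Fin n → Fin d) → ℝ)
    (F := V [⋀^Fin n]→L[ℝ] ℝ) g
  have h3 := (h2 _).comp x h1
  convert! h3 using 1
  funext x
  exact (hg (f x)).symm

end AlternatingEval

/-! ### The 2-form σ: differential, invariance and contraction. -/

section Sigma

variable {E : Type*} [NormedAddCommGroup E] [NormedSpace ℝ E]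
  {G : Type*} [TopologicalSpace G] [ChartedSpace E G] [Group G]
  [LieGroup 𝓘(ℝ, E) ∞ G] [FiniteDimensional ℝ E] [T2Space G]
  {B : E →L[ℝ] E →L[ℝ] ℝ}

variable (G B) in
/-- The pullback `exp^* λ`. -/
def expLambda : E → E [⋀^Fin 3]→L[ℝ] ℝ :=
  DForm.pullback 𝓘(ℝ, E) 𝓘(ℝ, E) (lieExp G : E → G) (lambdaForm G B)

variable (G B) in
/-- The form `σ`, with values in the alternating forms on `E`. -/
def sigmaE : E → E [⋀^Fin 2]→L[ℝ] ℝ := homotopyOp (expLambda G B)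

theorem expLambda_apply (hB : IsInvariantInner G B) (y : E) (v : Fin 3 → E) :
    expLambda G B y v = B (jacobiOp 1 (lieBr G y) (v 0))
      (lieBr G (jacobiOp 1 (lieBr G y) (v 1)) (jacobiOp 1 (lieBr G y) (v 2))) := by
  have h := dotBracket_apply (V := E) hB (mcL (E := E) (lieExp G y))
    (fun i => mD 𝓘(ℝ, E) 𝓘(ℝ, E) (lieExp G : E → G) y (v i))
  have h2 (u : E) : mcL (lieExp G y) (mD 𝓘(ℝ, E) 𝓘(ℝ, E) (lieExp G : E → G) y u) =
      jacobiOp 1 (lieBr G y) u := by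
    rw [← logD_lieExp, logD_apply_eq (mdifferentiableAt_lieExp y).1]
  have h3 (a a' b b' c c' : E) (ha : a = a') (hb : b = b') (hc : c = c') :
      B a (lieBr G b c) = B a' (lieBr G b' c') := by rw [ha, hb, hc]
  exact h.trans (h3 _ _ _ _ _ _ (h2 _) (h2 _) (h2 _))

theorem contDiff_jacobiOp_apply (L : E →L[ℝ] E →L[ℝ] E) (v : E) :
    ContDiff ℝ ∞ fun y => jacobiOp 1 (L y) v := by
  haveI : CompleteSpace E := FiniteDimensional.complete ℝ E
  have h : ContDiff ℝ ∞ fun y : E => ((1 : ℝ), y) := by fun_prop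
  exact ((contDiff_jacobiOp_clm L).comp h).clm_apply contDiff_const

theorem contDiff_bilin (L : E →L[ℝ] E →L[ℝ] E) {f h : E → E} (hf : ContDiff ℝ ∞ f)
    (hh : ContDiff ℝ ∞ h) : ContDiff ℝ ∞ fun y => L (f y) (h y) :=
  (L.contDiff.comp hf).clm_apply hh

theorem contDiff_expLambda (hB : IsInvariantInner G B) : ContDiff ℝ ∞ (expLambda G B) := by
  refine contDiff_alternating fun v => ?_
  simp only [expLambda_apply hB]
  have h (v : E) := contDiff_jacobiOp_apply (lieBr G) v
  exact (B.contDiff.comp (h (v 0))).clm_apply (contDiff_bilin _ (h (v 1)) (h (v 2)))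

theorem extDeriv_expLambda (hB : IsInvariantInner G B) : extDeriv (expLambda G B) = 0 := by
  funext x
  refine extDeriv_dotBracket hB (α := fun y => jacobiOp 1 (lieBr G y)) ?_
    (fderiv_jacobiOp_sub 1 x) ((contDiff_expLambda hB).differentiable (by simp) x)
    (expLambda_apply hB)
  haveI : CompleteSpace E := FiniteDimensional.complete ℝ E
  exact (hasFDerivAt_slice (contDiff_jacobiOp_clm (lieBr G)) 1 x).differentiableAt

theorem extDeriv_sigmaE (hB : IsInvariantInner G B) :
    extDeriv (sigmaE G B) = expLambda G B :=
  extDeriv_homotopyOp (contDiff_expLambda hB) (extDeriv_expLambda hB)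

theorem differentiable_sigmaE (hB : IsInvariantInner G B) :
    Differentiable ℝ (sigmaE G B) :=
  differentiable_homotopyOp (contDiff_expLambda hB)

/-- Since J_t(ad x) = t J_1(ad tx), the factor t² of the homotopy operator is absorbed into the two
arguments. The radial slot is just x, because J_1(ad tx) fixes x. -/
theorem sigmaE_apply (hB : IsInvariantInner G B) (x u v : E) :
    sigmaE G B x ![u, v] = ∫ t in (0 : ℝ)..1,
      B x (lieBr G (jacobiOp t (lieBr G x) u) (jacobiOp t (lieBr G x) v)) := by
  haveI : CompleteSpace E := FiniteDimensional.complete ℝ E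
  refine (homotopyOp_apply (contDiff_expLambda hB) x _).trans ?_
  congr 1
  funext t
  have h1 (w : E) : jacobiOp t (lieBr G x) w = t • jacobiOp 1 (lieBr G (t • x)) w := by
    have := jacobiOp_smul (lieBr G x) t 1
    rw [one_mul] at this
    rw [this]; simp
  rcases eq_or_ne t 0 with rfl | ht
  · simp [jacobiOp_zero]
  have h2 : jacobiOp 1 (lieBr G (t • x)) x = x :=
    smul_right_injective E ht ((h1 x).symm.trans (jacobiOp_lieBr_self x t))
  rw [expLambda_apply hB, h1, h1]
  change t ^ 2 * B (jacobiOp 1 (lieBr G (t • x)) x) _ = _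
  rw [h2]
  simp
  ring

theorem sigmaE_Ad (hB : IsInvariantInner G B) (a : G) (x u v : E) :
    sigmaE G B (Ad a x) ![Ad a u, Ad a v] =
      sigmaE G B x ![u, v] := by
  rw [sigmaE_apply hB, sigmaE_apply hB]
  simp only [jacobiOp_Ad, ← Ad_lieBr, hB.inv]

theorem jacobiOp_comp_lieBr (x : E) (t : ℝ) (v : E) :
    jacobiOp t (lieBr G x) (lieBr G x v) = lieBr G x (jacobiOp t (lieBr G x) v) := by
  haveI : CompleteSpace E := FiniteDimensional.complete ℝ E
  refine congrFun (affine_ode_unique (-lieBr G x)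
    (f := fun t => jacobiOp t (lieBr G x) (lieBr G x v))
    (h := fun t => lieBr G x (jacobiOp t (lieBr G x) v)) (fun _ => lieBr G x v)
    (fun t => ?_) (fun t => ?_) (by simp [jacobiOp_zero])) t
  · convert! (hasDerivAt_jacobiOp (lieBr G x) t).clm_apply (hasDerivAt_const t _) using 1
    simp [sub_eq_add_neg]
  · convert! (hasDerivAt_const t (lieBr G x)).clm_apply
      ((hasDerivAt_jacobiOp (lieBr G x) t).clm_apply (hasDerivAt_const t v)) using 1
    simp [sub_eq_add_neg]

/-- With A_t = `Ad` (exp tx)⁻¹, the difference of 2 B(η, ζ) and the integrand of σ is the total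
t-derivative of B(η, J_t ζ) + B(A_t η, J_t ζ). Its value at t = 1 is e_β^*θ_η on ζ, for β central.
-/
theorem sigmaE_moment (hB : IsInvariantInner G B) (η x ζ : E) :
    sigmaE G B x ![lieBr G η x, ζ] =
      2 * B η ζ - B η (jacobiOp 1 (lieBr G x) ζ + Ad (lieExp G x) (jacobiOp 1 (lieBr G x) ζ)) := by
  haveI : CompleteSpace E := FiniteDimensional.complete ℝ E
  rw [sigmaE_apply hB]
  set J : ℝ → E →L[ℝ] E := fun t => jacobiOp t (lieBr G x) with hJdef
  set A : ℝ → E →L[ℝ] E := fun t => Ad (lieExp G (t • x))⁻¹ with hA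
  have hJ (t : ℝ) (u : E) : HasDerivAt (fun t => J t u) (A t u) t := by
    simpa using (hasDerivAt_jacobiOp_Ad (G := G) x t).clm_apply (hasDerivAt_const t u)
  have hAJ (t : ℝ) (u : E) : A t u = u - lieBr G x (J t u) := by
    rw [hA]; beta_reduce; rw [Ad_lieExp_neg_eq]; simp [hJdef]
  have hBd (t : ℝ) : HasDerivAt (fun t => B η (J t ζ) + B (A t η) (J t ζ))
      (B η (A t ζ) + (B (A t η) (A t ζ) + B (-lieBr G x (A t η)) (J t ζ))) t := by
    have h1 : HasDerivAt (fun t => A t η) (-lieBr G x (A t η)) t := by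
      have hf : (fun t => A t η) = fun t => η - lieBr G x (J t η) := funext fun t => hAJ t η
      rw [hf]
      exact ((lieBr G x).hasFDerivAt.comp_hasDerivAt t (hJ t η)).const_sub η |>.congr_deriv (by simp [hAJ])
    exact ((B η).hasFDerivAt.comp_hasDerivAt t (hJ t ζ)).add
      (B.hasDerivAt_of_bilinear (fun _ => h1) (fun _ => hJ t ζ))
  have hint (t : ℝ) : 2 * B η ζ - B x (lieBr G (J t (lieBr G η x)) (J t ζ)) =
      B η (A t ζ) + (B (A t η) (A t ζ) + B (-lieBr G x (A t η)) (J t ζ)) := by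
    -- J_t commutes with ad x, and A_t = 1 - (ad x) J_t.
    have e1 : J t (lieBr G η x) = A t η - η := by
      rw [lieBr_swap, map_neg, hAJ, hJdef]; beta_reduce; rw [jacobiOp_comp_lieBr]; abel
    have e2 : lieBr G x (J t ζ) = ζ - A t ζ := by rw [hAJ]; abel
    have e3 : B (A t η) (A t ζ) = B η ζ := hB.inv _ _ _
    rw [e1, hB.swap_left x, e2, map_neg, neg_apply, hB.lieBr_left, e2]
    simp only [map_sub, sub_apply, e3]
    ring
  have hcont : Continuous fun t => B x (lieBr G (J t (lieBr G η x)) (J t ζ)) := by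
    have hc (u : E) : Continuous fun t => J t u :=
      continuous_iff_continuousAt.2 fun t => (hJ t u).continuousAt
    exact (B x).continuous.comp ((((lieBr G).continuous).comp (hc _)).clm_apply (hc _))
  have hF := intervalIntegral.integral_eq_sub_of_hasDerivAt (a := 0) (b := 1)
    (f := fun t => B η (J t ζ) + B (A t η) (J t ζ))
    (f' := fun t => 2 * B η ζ - B x (lieBr G (J t (lieBr G η x)) (J t ζ)))
    (fun t _ => by rw [hint]; exact hBd t)
    ((continuous_const.sub hcont).intervalIntegrable _ _)
  rw [intervalIntegral.integral_sub (continuous_const.intervalIntegrable _ _)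
    (hcont.intervalIntegrable _ _)] at hF
  have e4 : B (A 1 η) (J 1 ζ) = B η (Ad (lieExp G x) (J 1 ζ)) := by
    have := hB.inv (lieExp G x) (A 1 η) (J 1 ζ)
    rw [← this, hA]
    simp [Ad_Ad_inv]
  have e5 : J 0 ζ = 0 := by simp [hJdef, jacobiOp_zero]
  simp only [e5, e4, map_zero] at hF
  rw [map_add]
  simp at hF
  linarith

end Sigma

/-! ### The 1-form e_β^*θ_η and its potential. -/

section Theta

variable {E : Type*} [NormedAddCommGroup E] [NormedSpace ℝ E]
  {G : Type*} [TopologicalSpace G] [ChartedSpace E G] [Group G]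
  [LieGroup 𝓘(ℝ, E) ∞ G] [FiniteDimensional ℝ E] [T2Space G]
  {B : E →L[ℝ] E →L[ℝ] ℝ}

variable (G B) in
/-- The pullback `e_β^* θ_η`. -/
def expTheta (β : G) (η : E) : E → E [⋀^Fin 1]→L[ℝ] ℝ :=
  DForm.pullback 𝓘(ℝ, E) 𝓘(ℝ, E) (expBeta β : E → G) (thetaForm G B η)

theorem mdifferentiableAt_expBeta (β : G) (y : E) :
    MDifferentiableAt 𝓘(ℝ, E) 𝓘(ℝ, E) (expBeta β : E → G) y :=
  MDiffAt.const_gmul β (mdifferentiableAt_lieExp y).1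

theorem logD_expBeta (β : G) (y : E) :
    logD E 𝓘(ℝ, E) (expBeta β : E → G) y = jacobiOp 1 (lieBr G y) :=
  (logD_const_mul (J := 𝓘(ℝ, E)) β (lieExp G : E → G) y).trans (logD_lieExp y)

theorem expTheta_apply {β : G} (hβ : β ∈ Subgroup.center G) (η y : E) (v : Fin 1 → E) :
    expTheta G B β η y v = B η (jacobiOp 1 (lieBr G y) (v 0) +
      Ad (lieExp G y) (jacobiOp 1 (lieBr G y) (v 0))) := by
  have hd := mdifferentiableAt_expBeta (G := G) β y
  have h1 : expTheta G B β η y v =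
      B η (mcL (expBeta β y) (mD 𝓘(ℝ, E) 𝓘(ℝ, E) (expBeta β : E → G) y (v 0)) +
        mcR (expBeta β y) (mD 𝓘(ℝ, E) 𝓘(ℝ, E) (expBeta β : E → G) y (v 0))) := rfl
  rw [h1, ← logD_apply_eq hd, mcR_mfderiv hd, logD_expBeta, expBeta, Ad_mul, Ad_of_mem_center hβ]

theorem contDiff_expTheta {β : G} (hβ : β ∈ Subgroup.center G) (η : E) :
    ContDiff ℝ ∞ (expTheta G B β η) := by
  refine contDiff_alternating fun v => ?_
  simp only [expTheta_apply hβ]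
  -- Rewriting the right-invariant part as J_1(-ad y) exhibits smoothness in y without any
  -- smoothness of exp itself.
  have h (y w : E) : Ad (lieExp G y) (jacobiOp 1 (lieBr G y) w) =
      jacobiOp 1 ((-lieBr G) y) w := by
    have := DFunLike.congr_fun (Ad_lieExp_comp_jacobiOp (G := G) y 1) w
    rw [one_smul] at this
    exact this
  simp only [h]
  exact (B η).contDiff.comp ((contDiff_jacobiOp_apply _ _).add (contDiff_jacobiOp_apply _ _))

/-- Along the ray ty both Maurer–Cartan forms send the radial vector y to y, so the integrand is
constant. -/
theorem homotopyOp_expTheta {β : G} (hβ : β ∈ Subgroup.center G) (η y : E) (w : Fin 0 → E) :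
    homotopyOp (expTheta G B β η) y w = 2 * B η y := by
  rw [homotopyOp_apply (contDiff_expTheta hβ η)]
  have h (t : ℝ) : t ^ 0 * expTheta G B β η (t • y) (Matrix.vecCons y w) = 2 * B η y := by
    have h1 : jacobiOp 1 (lieBr G (t • y)) y = y := by
      haveI : CompleteSpace E := FiniteDimensional.complete ℝ E
      rcases eq_or_ne t 0 with rfl | ht
      · have := jacobiOp_unique (0 : E →L[ℝ] E) (J := fun t => t • ContinuousLinearMap.id ℝ E)
          (fun t => by simpa using (hasDerivAt_id t).smul_const (ContinuousLinearMap.id ℝ E))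
          (by simp) 1
        simp [← this]
      · have := jacobiOp_lieBr_self (G := G) (t • y) 1
        rw [map_smul, one_smul] at this
        exact smul_right_injective E ht this
    rw [expTheta_apply hβ]
    simp only [Matrix.cons_val_zero, h1, Ad_lieExp_smul_self, pow_zero, map_add]
    ring
  simp only [h]
  simp

theorem extDeriv_homotopyOp_expTheta {β : G} (hβ : β ∈ Subgroup.center G) (η y : E)
    (v : Fin 1 → E) :
    extDeriv (homotopyOp (expTheta G B β η)) y v = 2 * B η (v 0) := by
  rw [extDeriv_apply (differentiable_homotopyOp (contDiff_expTheta hβ η) y)]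
  simp only [homotopyOp_expTheta hβ]
  have : fderiv ℝ (fun y => 2 * B η y) y = (2 : ℝ) • B η :=
    ((B η).hasFDerivAt.const_mul 2).fderiv
  simp [this]

end Theta

/-! ### Differentiability of maps to and from G^{2g} × E. -/

section Pi

variable {E : Type*} [NormedAddCommGroup E] [NormedSpace ℝ E]
  {G : Type*} [TopologicalSpace G] [ChartedSpace E G]
  {F : Type*} [NormedAddCommGroup F] [NormedSpace ℝ F] {K : Type*} [TopologicalSpace K]
  {J : ModelWithCorners ℝ F K} {M : Type*} [TopologicalSpace M] [ChartedSpace K M]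
  {g : ℕ}

theorem hasMFDerivAt_pi {f : M → Fin (2 * g) → G} {x : M} {f' : F →L[ℝ] (Fin (2 * g) → E)} :
    HasMFDerivAt J (modelY E g) f x f' ↔
      ∀ i, HasMFDerivAt J 𝓘(ℝ, E) (fun y => f y i) x ((ContinuousLinearMap.proj i).comp f') := by
  unfold HasMFDerivAt
  rw [forall_and, ← continuousAt_pi]
  exact and_congr Iff.rfl hasFDerivWithinAt_pi'

theorem mdifferentiableAt_pi {f : M → Fin (2 * g) → G} {x : M}
    (h : ∀ i, MDifferentiableAt J 𝓘(ℝ, E) (fun y => f y i) x) :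
    MDifferentiableAt J (modelY E g) f x := by
  let f' : F →L[ℝ] (Fin (2 * g) → E) :=
    ContinuousLinearMap.pi fun i => mD J 𝓘(ℝ, E) (fun y => f y i) x
  have : HasMFDerivAt J (modelY E g) f x f' := hasMFDerivAt_pi.2 fun i => (h i).hasMFDerivAt
  exact this.mdifferentiableAt

theorem hasMFDerivAt_proj (h : Fin (2 * g) → G) (i : Fin (2 * g)) :
    HasMFDerivAt (modelY E g) 𝓘(ℝ, E) (fun h : Fin (2 * g) → G => h i) h
      (ContinuousLinearMap.proj (R := ℝ) (φ := fun _ => E) i) :=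
  hasMFDerivAt_pi.1 (hasMFDerivAt_id h) i

theorem mdifferentiableAt_proj (h : Fin (2 * g) → G) (i : Fin (2 * g)) :
    MDifferentiableAt (modelY E g) 𝓘(ℝ, E) (fun h : Fin (2 * g) → G => h i) h :=
  (hasMFDerivAt_proj h i).mdifferentiableAt

variable (E) in
theorem mdifferentiableAt_fst_proj (p : (Fin (2 * g) → G) × E) (i : Fin (2 * g)) :
    MDifferentiableAt (modelYg E g) 𝓘(ℝ, E) (fun p : (Fin (2 * g) → G) × E => p.1 i) p :=
  (mdifferentiableAt_proj p.1 i).comp p mdifferentiableAt_fst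

theorem mD_snd (p : (Fin (2 * g) → G) × E) (v : (Fin (2 * g) → E) × E) :
    mD (modelYg E g) 𝓘(ℝ, E) (fun p : (Fin (2 * g) → G) × E => p.2) p v = v.2 := by
  have : mfderiv (modelYg E g) 𝓘(ℝ, E) (fun p : (Fin (2 * g) → G) × E => p.2) p =
    ContinuousLinearMap.snd ℝ (TangentSpace (modelY E g) p.1) (TangentSpace 𝓘(ℝ, E) p.2) :=
    mfderiv_snd
  unfold mD
  rw [this]; rfl

end Pi

/-! ### The exterior derivative in the preferred chart. -/

section Chart

variable {F : Type*} [NormedAddCommGroup F] [NormedSpace ℝ F] {K : Type*} [TopologicalSpace K]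
  (J : ModelWithCorners ℝ F K) [J.Boundaryless] {M : Type*} [TopologicalSpace M] [ChartedSpace K M]

/-- Written in itself, the preferred chart is the identity near its base point, so `DForm.d` there
is simply the exterior derivative of the transported form. -/
theorem hasMFDerivAt_extChartAt_self (p : M) :
    HasMFDerivAt J 𝓘(ℝ, F) (extChartAt J p) p (ContinuousLinearMap.id ℝ F) := by
  refine ⟨continuousAt_extChartAt p, ?_⟩
  have : HasFDerivAt (writtenInExtChartAt J 𝓘(ℝ, F) p (extChartAt J p))
      (ContinuousLinearMap.id ℝ F) (extChartAt J p p) := by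
    refine (hasFDerivAt_id _).congr_of_eventuallyEq ?_
    filter_upwards [extChartAt_target_mem_nhds (I := J) p] with e he
    exact (extChartAt J p).right_inv he
  exact this.hasFDerivWithinAt

theorem DForm_d_apply {n : ℕ} (ψ : DForm J M n) (p : M) (v : Fin (n + 1) → F) :
    DForm.d J ψ p v = extDeriv (E := F) (DForm.pullback 𝓘(ℝ, F) J (extChartAt J p).symm ψ)
      (extChartAt J p p) v := by
  unfold DForm.d
  rw [(hasMFDerivAt_extChartAt_self J p).mfderiv]
  rfl

end Chart

/-! ### Evaluation on words of the free group. -/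

section Words

variable {E : Type*} [NormedAddCommGroup E] [NormedSpace ℝ E]
  {G : Type*} [TopologicalSpace G] [ChartedSpace E G] [Group G]
  [LieGroup 𝓘(ℝ, E) ∞ G]
  {F : Type*} [NormedAddCommGroup F] [NormedSpace ℝ F] {K : Type*} [TopologicalSpace K]
  {J : ModelWithCorners ℝ F K} {M : Type*} [TopologicalSpace M] [ChartedSpace K M]
  {g : ℕ}

theorem evalWord_one (h : Fin (2 * g) → G) : evalWord 1 h = 1 := map_one _

theorem evalWord_mul (u w : FreeGroup (Fin (2 * g))) (h : Fin (2 * g) → G) :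
    evalWord (u * w) h = evalWord u h * evalWord w h := map_mul _ _ _

theorem evalWord_inv (w : FreeGroup (Fin (2 * g))) (h : Fin (2 * g) → G) :
    evalWord w⁻¹ h = (evalWord w h)⁻¹ := map_inv _ _

theorem evalWord_of (i : Fin (2 * g)) (h : Fin (2 * g) → G) :
    evalWord (FreeGroup.of i) h = h i := FreeGroup.lift_apply_of

theorem evalWord_conj (w : FreeGroup (Fin (2 * g))) (a : G) (h : Fin (2 * g) → G) :
    evalWord w (fun i => a * h i * a⁻¹) = a * evalWord w h * a⁻¹ := by
  induction w using FreeGroup.induction_on with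
  | C1 => simp [evalWord_one]
  | of i => simp [evalWord_of]
  | inv_of i _ => simp [evalWord_inv, evalWord_of, mul_assoc]
  | mul u w hu hw => rw [evalWord_mul, hu, hw, evalWord_mul]; group

theorem mdifferentiableAt_evalWord {f : M → Fin (2 * g) → G} {x : M}
    (hf : ∀ i, MDifferentiableAt J 𝓘(ℝ, E) (fun y => f y i) x) (w : FreeGroup (Fin (2 * g))) :
    MDifferentiableAt J 𝓘(ℝ, E) (fun y => evalWord w (f y)) x := by
  induction w using FreeGroup.induction_on with
  | C1 => simpa only [evalWord_one] using mdifferentiableAt_const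
  | of i => simpa only [evalWord_of] using hf i
  | inv_of i _ => simpa only [evalWord_inv, evalWord_of] using MDiffAt.ginv (hf i)
  | mul u w hu hw => simpa only [evalWord_mul] using MDiffAt.gmul hu hw

theorem contMDiffAt_evalWord {f : M → Fin (2 * g) → G} {x : M}
    (hf : ∀ i, ContMDiffAt J 𝓘(ℝ, E) ∞ (fun y => f y i) x) (w : FreeGroup (Fin (2 * g))) :
    ContMDiffAt J 𝓘(ℝ, E) ∞ (fun y => evalWord w (f y)) x := by
  induction w using FreeGroup.induction_on with
  | C1 => simpa only [evalWord_one] using contMDiffAt_const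
  | of i => simpa only [evalWord_of] using hf i
  | inv_of i _ => simpa only [evalWord_inv, evalWord_of] using (hf i).inv
  | mul u w hu hw => simp only [evalWord_mul]; exact hu.mul hw

theorem contMDiffAt_chart_symm_fst (p : (Fin (2 * g) → G) × E) (i : Fin (2 * g)) :
    ContMDiffAt 𝓘(ℝ, (Fin (2 * g) → E) × E) 𝓘(ℝ, E) ∞
      (fun e : (Fin (2 * g) → E) × E => ((extChartAt (modelYg E g) p).symm e).1 i)
      (extChartAt (modelYg E g) p p) := by
  have h1 : ContMDiffAt 𝓘(ℝ, E) 𝓘(ℝ, E) ∞ (extChartAt 𝓘(ℝ, E) (p.1 i)).symm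
      (extChartAt 𝓘(ℝ, E) (p.1 i) (p.1 i)) :=
    (contMDiffOn_extChartAt_symm (p.1 i)).contMDiffAt (extChartAt_target_mem_nhds (p.1 i))
  have h2 : ContMDiffAt 𝓘(ℝ, (Fin (2 * g) → E) × E) 𝓘(ℝ, E) ∞
      (fun e : (Fin (2 * g) → E) × E => e.1 i) (extChartAt (modelYg E g) p p) := by
    rw [contMDiffAt_iff_contDiffAt]
    fun_prop
  exact ContMDiffAt.comp (g := (extChartAt 𝓘(ℝ, E) (p.1 i)).symm)
    (f := fun e : (Fin (2 * g) → E) × E => e.1 i) (extChartAt (modelYg E g) p p) h1 h2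

theorem eventually_mdifferentiableAt_chart_symm (p : (Fin (2 * g) → G) × E) :
    ∀ᶠ e in 𝓝 (extChartAt (modelYg E g) p p),
      MDifferentiableAt 𝓘(ℝ, (Fin (2 * g) → E) × E) (modelYg E g)
        (extChartAt (modelYg E g) p).symm e := by
  haveI : IsManifold 𝓘(ℝ, E) 1 G := IsManifold.of_le (n := ∞) (by simp)
  have h1 (i : Fin (2 * g)) := (contMDiffAt_iff_contMDiffAt_nhds (by simp)).1
    ((contMDiffAt_chart_symm_fst p i).of_le (m := 1) (by simp))
  filter_upwards [eventually_all.2 h1] with e he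
  refine MDifferentiableAt.prodMk (f := fun e => ((extChartAt (modelYg E g) p).symm e).1)
    (g := fun e => ((extChartAt (modelYg E g) p).symm e).2)
    (mdifferentiableAt_pi fun i => (he i).mdifferentiableAt (by simp)) ?_
  have : DifferentiableAt ℝ (fun e : (Fin (2 * g) → E) × E => e.2) e := differentiableAt_snd
  exact this.mdifferentiableAt

end Words

/-! ### The differential of Ω: the Polyakov–Wiegmann identity. -/

section PolyakovWiegmann

variable {E : Type*} [NormedAddCommGroup E] [NormedSpace ℝ E]
  {G : Type*} [TopologicalSpace G] [ChartedSpace E G] [Group G]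
  [LieGroup 𝓘(ℝ, E) ∞ G] [FiniteDimensional ℝ E]
  {V : Type*} [NormedAddCommGroup V] [NormedSpace ℝ V]
  {B : E →L[ℝ] E →L[ℝ] ℝ}

theorem IsInvariantInner.lieBr_swap_right (hB : IsInvariantInner G B) (x y z : E) :
    B (lieBr G x y) z = B x (lieBr G y z) := by
  rw [lieBr_swap, map_neg, neg_apply, hB.lieBr_left, neg_neg]

/-- The algebra of the next identity. The aᵢ are values of f^*θ and the bᵢ values of k^*θ̄; the d
and c are derivatives, with Maurer–Cartan corrections in the opposite order. The derivatives cancel,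
and λ is compared at a, b and a + b. -/
theorem IsInvariantInner.wedge_identity (hB : IsInvariantInner G B) (a₀ a₁ a₂ b₀ b₁ b₂ : E)
    (d₀₁ d₀₂ d₁₂ c₀₁ c₀₂ c₁₂ : E) :
    (B d₀₁ b₂ + B a₁ (lieBr G b₀ b₂ + c₀₂) - (B d₀₂ b₁ + B a₂ (lieBr G b₀ b₁ + c₀₁))) -
    (B (d₀₁ + lieBr G a₀ a₁) b₂ + B a₀ (lieBr G b₁ b₂ + c₁₂) -
      (B d₁₂ b₀ + B a₂ (lieBr G b₁ b₀ + (c₀₁ + lieBr G b₀ b₁)))) +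
    (B (d₀₂ + lieBr G a₀ a₂) b₁ + B a₀ (lieBr G b₂ b₁ + (c₁₂ + lieBr G b₁ b₂)) -
      (B (d₁₂ + lieBr G a₁ a₂) b₀ + B a₁ (lieBr G b₂ b₀ + (c₀₂ + lieBr G b₀ b₂)))) =
    B a₀ (lieBr G a₁ a₂) + B b₀ (lieBr G b₁ b₂) - B (a₀ + b₀) (lieBr G (a₁ + b₁) (a₂ + b₂)) := by
  simp only [map_add, add_apply, hB.lieBr_swap_right]
  have s (x y z : E) : B x (lieBr G y z) = -B x (lieBr G z y) := by rw [lieBr_swap, map_neg]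
  linarith [hB.swap_left a₁ b₀ b₂, hB.swap_left a₂ b₀ b₁, s b₀ a₂ b₁, hB.cyclic a₁ a₂ b₀,
    s a₀ a₂ b₁, s a₂ b₁ b₀, s a₀ b₂ b₁, s a₁ b₂ b₀]

/-- The pullback of `Ω` by a pair of maps into `G`. -/
def pairForm (B : E →L[ℝ] E →L[ℝ] ℝ) (f k : V → G) (y : V) : V [⋀^Fin 2]→L[ℝ] ℝ :=
  dotWedge B (logD E 𝓘(ℝ, V) f y) ((Ad (k y) : E →L[ℝ] E).comp (logD E 𝓘(ℝ, V) k y))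

theorem pairForm_apply (f k : V → G) (y : V) (v : Fin 2 → V) :
    pairForm B f k y v = B (logD E 𝓘(ℝ, V) f y (v 0)) (Ad (k y) (logD E 𝓘(ℝ, V) k y (v 1))) -
      B (logD E 𝓘(ℝ, V) f y (v 1)) (Ad (k y) (logD E 𝓘(ℝ, V) k y (v 0))) := rfl

theorem hasFDerivAt_pairing {f k : V → G} {x : V} (hf : ContMDiffAt 𝓘(ℝ, V) 𝓘(ℝ, E) ∞ f x)
    (hk : ContMDiffAt 𝓘(ℝ, V) 𝓘(ℝ, E) ∞ k x) (p q : V) :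
    ∃ D : V →L[ℝ] ℝ, HasFDerivAt (fun y => B (logD E 𝓘(ℝ, V) f y p)
        (Ad (k y) (logD E 𝓘(ℝ, V) k y q))) D x ∧
      ∀ z, D z = B (fderiv ℝ (logD E 𝓘(ℝ, V) f) x z p) (Ad (k x) (logD E 𝓘(ℝ, V) k x q)) +
        B (logD E 𝓘(ℝ, V) f x p) (lieBr G (Ad (k x) (logD E 𝓘(ℝ, V) k x z))
          (Ad (k x) (logD E 𝓘(ℝ, V) k x q)) + Ad (k x) (fderiv ℝ (logD E 𝓘(ℝ, V) k) x z q)) := by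
  have h1 := ((contDiffAt_logD hf).differentiableAt (by simp)).hasFDerivAt.clm_apply
    (hasFDerivAt_const p x)
  have h2 := ((contDiffAt_logD hk).differentiableAt (by simp)).hasFDerivAt.clm_apply
    (hasFDerivAt_const q x)
  have h3 := (hasFDerivAt_Ad (hk.mdifferentiableAt (by simp))).clm_apply h2
  refine ⟨_, (B.hasFDerivAt.comp x h1).clm_apply h3, fun z => ?_⟩
  simp [Ad_lieBr]
  ring

variable [FiniteDimensional ℝ V]

theorem differentiableAt_pairForm {f k : V → G} {x : V}
    (hf : ContMDiffAt 𝓘(ℝ, V) 𝓘(ℝ, E) ∞ f x) (hk : ContMDiffAt 𝓘(ℝ, V) 𝓘(ℝ, E) ∞ k x) :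
    DifferentiableAt ℝ (pairForm B f k) x := by
  refine differentiableAt_alternating fun v => ?_
  simp only [pairForm_apply]
  obtain ⟨D, hD, -⟩ := hasFDerivAt_pairing (B := B) hf hk (v 0) (v 1)
  obtain ⟨D', hD', -⟩ := hasFDerivAt_pairing (B := B) hf hk (v 1) (v 0)
  exact hD.differentiableAt.sub hD'.differentiableAt

/-- The value of the pullback of `λ` by a map into `G`. -/
def lambdaVal (B : E →L[ℝ] E →L[ℝ] ℝ) (f : V → G) (x : V) (v : Fin 3 → V) : ℝ :=
  B (logD E 𝓘(ℝ, V) f x (v 0)) (lieBr G (logD E 𝓘(ℝ, V) f x (v 1)) (logD E 𝓘(ℝ, V) f x (v 2)))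

/-- The failure of λ to be additive under multiplication of maps is the exact form d(f, k)^*Ω. Thus
Ω is a coboundary in the group direction. -/
theorem extDeriv_pairForm (hB : IsInvariantInner G B) {f k : V → G} {x : V}
    (hf : ContMDiffAt 𝓘(ℝ, V) 𝓘(ℝ, E) ∞ f x) (hk : ContMDiffAt 𝓘(ℝ, V) 𝓘(ℝ, E) ∞ k x)
    (v : Fin 3 → V) :
    extDeriv (pairForm B f k) x v =
      lambdaVal B f x v + lambdaVal B k x v - lambdaVal B (fun y => f y * k y) x v := by
  have hd (p q z : V) : fderiv ℝ (fun y => B (logD E 𝓘(ℝ, V) f y p)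
        (Ad (k y) (logD E 𝓘(ℝ, V) k y q)) - B (logD E 𝓘(ℝ, V) f y q)
        (Ad (k y) (logD E 𝓘(ℝ, V) k y p))) x z =
      B (fderiv ℝ (logD E 𝓘(ℝ, V) f) x z p) (Ad (k x) (logD E 𝓘(ℝ, V) k x q)) +
        B (logD E 𝓘(ℝ, V) f x p) (lieBr G (Ad (k x) (logD E 𝓘(ℝ, V) k x z))
          (Ad (k x) (logD E 𝓘(ℝ, V) k x q)) + Ad (k x) (fderiv ℝ (logD E 𝓘(ℝ, V) k) x z q)) -
      (B (fderiv ℝ (logD E 𝓘(ℝ, V) f) x z q) (Ad (k x) (logD E 𝓘(ℝ, V) k x p)) +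
        B (logD E 𝓘(ℝ, V) f x q) (lieBr G (Ad (k x) (logD E 𝓘(ℝ, V) k x z))
          (Ad (k x) (logD E 𝓘(ℝ, V) k x p)) + Ad (k x) (fderiv ℝ (logD E 𝓘(ℝ, V) k) x z p))) := by
    obtain ⟨D, hD, hDz⟩ := hasFDerivAt_pairing (B := B) hf hk p q
    obtain ⟨D', hD', hDz'⟩ := hasFDerivAt_pairing (B := B) hf hk q p
    rw [(hD.fun_sub hD').fderiv, sub_apply, hDz, hDz']
  have e {f : V → G} (hf : ContMDiffAt 𝓘(ℝ, V) 𝓘(ℝ, E) ∞ f x) (u w : V) :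
      fderiv ℝ (logD E 𝓘(ℝ, V) f) x u w = fderiv ℝ (logD E 𝓘(ℝ, V) f) x w u +
        lieBr G (logD E 𝓘(ℝ, V) f x w) (logD E 𝓘(ℝ, V) f x u) := by
    rw [← sub_eq_iff_eq_add', fderiv_logD_sub hf, lieBr_swap]; simp
  have hm (u : V) := logD_mul (J := 𝓘(ℝ, V)) (hf.mdifferentiableAt (by simp))
    (hk.mdifferentiableAt (by simp)) u
  rw [extDeriv_apply (differentiableAt_pairForm hf hk)]
  simp only [pairForm_apply, hd]
  rw [Fin.sum_univ_three]
  simp only [lambdaVal, hm]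
  have hA (u : V) : Ad (k x) (Ad (k x)⁻¹ (logD E 𝓘(ℝ, V) f x u) + logD E 𝓘(ℝ, V) k x u) =
      logD E 𝓘(ℝ, V) f x u + Ad (k x) (logD E 𝓘(ℝ, V) k x u) := by
    rw [map_add, Ad_Ad_inv]
  -- λ is invariant under `Ad` (k x). After this rotation the logarithmic derivative of the product
  -- is the plain sum a + b.
  rw [← hB.inv (k x) (Ad _ _ + _), ← hB.inv (k x) (logD E 𝓘(ℝ, V) k x _), Ad_lieBr, Ad_lieBr,
    hA, hA, hA]
  simp [Fin.removeNth, Fin.succAbove]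
  rw [e hf (v 1) (v 0), e hf (v 2) (v 0), e hf (v 2) (v 1), e hk (v 1) (v 0), e hk (v 2) (v 0),
    e hk (v 2) (v 1)]
  have := hB.wedge_identity (logD E 𝓘(ℝ, V) f x (v 0)) (logD E 𝓘(ℝ, V) f x (v 1))
    (logD E 𝓘(ℝ, V) f x (v 2)) (Ad (k x) (logD E 𝓘(ℝ, V) k x (v 0)))
    (Ad (k x) (logD E 𝓘(ℝ, V) k x (v 1))) (Ad (k x) (logD E 𝓘(ℝ, V) k x (v 2)))
    (fderiv ℝ (logD E 𝓘(ℝ, V) f) x (v 0) (v 1)) (fderiv ℝ (logD E 𝓘(ℝ, V) f) x (v 0) (v 2))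
    (fderiv ℝ (logD E 𝓘(ℝ, V) f) x (v 1) (v 2))
    (Ad (k x) (fderiv ℝ (logD E 𝓘(ℝ, V) k) x (v 0) (v 1)))
    (Ad (k x) (fderiv ℝ (logD E 𝓘(ℝ, V) k) x (v 0) (v 2)))
    (Ad (k x) (fderiv ℝ (logD E 𝓘(ℝ, V) k) x (v 1) (v 2)))
  simp only [map_add, Ad_lieBr, add_apply] at this ⊢
  linarith

end PolyakovWiegmann

/-! ### Fox calculus and the boundary of the chain c. -/

section FoxChain

variable {α : Type*} [DecidableEq α]

theorem foxDeriv_one (i : α) : foxDeriv i (1 : FreeGroup α) = 0 := by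
  simp [foxDeriv]

theorem foxDeriv_inv (i : α) (w : FreeGroup α) :
    foxDeriv i w⁻¹ = -(MonoidAlgebra.of ℤ (FreeGroup α) w⁻¹ * foxDeriv i w) := by
  have := foxDeriv_mul i w⁻¹ w
  rw [inv_mul_cancel, foxDeriv_one] at this
  exact eq_neg_of_add_eq_zero_left this.symm

/-- The fundamental formula of the Fox calculus, by induction on the word through the product rule.
-/
theorem sum_foxDeriv [Fintype α] (w : FreeGroup α) :
    ∑ i, foxDeriv i w * (MonoidAlgebra.of ℤ (FreeGroup α) (FreeGroup.of i) - 1) =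
      MonoidAlgebra.of ℤ (FreeGroup α) w - 1 := by
  induction w using FreeGroup.induction_on with
  | C1 => simp only [foxDeriv_one, zero_mul, Finset.sum_const_zero, map_one, sub_self]
  | of j => simp [foxDeriv_of, ite_mul]
  | inv_of j hj =>
    simp only [foxDeriv_inv, neg_mul, mul_assoc, Finset.sum_neg_distrib, ← Finset.mul_sum, hj]
    rw [mul_sub, ← map_mul, inv_mul_cancel, map_one, mul_one, neg_sub]
  | mul u w hu hw =>
    simp only [foxDeriv_mul, add_mul, mul_assoc, Finset.sum_add_distrib, ← Finset.mul_sum, hu, hw]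
    rw [mul_sub, ← map_mul, mul_one]
    abel

/-- The augmentation of the integral group ring. -/
def augmentation (α : Type*) : MonoidAlgebra ℤ (FreeGroup α) →ₐ[ℤ] ℤ :=
  MonoidAlgebra.lift ℤ ℤ (FreeGroup α) 1

theorem augmentation_of (w : FreeGroup α) :
    augmentation α (MonoidAlgebra.of ℤ (FreeGroup α) w) = 1 := by
  simp [augmentation]

/-- The exponent sum of a generator in a word. -/
def exponentSum (i : α) : FreeGroup α →* Multiplicative ℤ where
  toFun w := Multiplicative.ofAdd (augmentation α (foxDeriv i w))
  map_one' := by simp [foxDeriv_one]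
  map_mul' u w := by rw [foxDeriv_mul, map_add, map_mul, augmentation_of, one_mul]; rfl

/-- The augmented Fox derivative is the exponent sum, a homomorphism to an abelian group. It kills
every commutator, hence R. -/
theorem augmentation_foxDeriv_relator (g : ℕ) (i : Fin (2 * g)) :
    augmentation _ (foxDeriv i (relator g)) = 0 := by
  have h : exponentSum i (relator g) = 1 := by
    unfold relator
    rw [map_list_prod, List.map_ofFn]
    refine List.prod_eq_one fun x hx => ?_
    obtain ⟨j, rfl⟩ := List.mem_ofFn.1 hx
    simp only [Function.comp_apply, map_mul, map_inv]
    rw [mul_inv_cancel_comm, mul_inv_cancel]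
  exact h

/-- The additive extension of a function on the free group to the integral group ring. -/
def groupRingExt (F : FreeGroup α → ℝ) : MonoidAlgebra ℤ (FreeGroup α) →+ ℝ :=
  (Finsupp.liftAddHom fun w => (smulAddHom ℤ ℝ).flip (F w)).comp
    MonoidAlgebra.coeffAddEquiv.toAddMonoidHom

theorem groupRingExt_single (F : FreeGroup α → ℝ) (w : FreeGroup α) (n : ℤ) :
    groupRingExt F (MonoidAlgebra.single w n) = n • F w := by
  refine (Finsupp.liftAddHom_apply_single _ w n).trans ?_
  simp

theorem groupRingExt_boundary (F : FreeGroup α → ℝ) (i : α) (x : MonoidAlgebra ℤ (FreeGroup α)) :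
    groupRingExt (fun w => F w + F (FreeGroup.of i) - F (w * FreeGroup.of i)) x =
      augmentation α x • F (FreeGroup.of i) -
        groupRingExt F (x * (MonoidAlgebra.of ℤ (FreeGroup α) (FreeGroup.of i) - 1)) := by
  induction x using MonoidAlgebra.induction_linear with
  | zero => simp
  | add x y hx hy => rw [map_add, hx, hy, map_add, add_mul, map_add, add_smul]; ring
  | single w n =>
    have h : augmentation α (MonoidAlgebra.single w n) = n := by simp [augmentation]
    rw [mul_sub, mul_one, MonoidAlgebra.of_apply, MonoidAlgebra.single_mul_single, mul_one, map_sub,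
      groupRingExt_single, groupRingExt_single, groupRingExt_single, h]
    simp only [zsmul_eq_mul]
    ring

/-- In the group ring, the terms F(w) - F(w xᵢ) sum to -F((∂R/∂xᵢ)(xᵢ - 1)), and by the fundamental
formula these add up to -F(R - 1). The terms F(xᵢ) carry the augmentation of ∂R/∂xᵢ, which is zero.
-/
theorem sum_fundChain (g : ℕ) (F : FreeGroup (Fin (2 * g)) → ℝ) :
    ((fundChain g).sum fun ab n => n • (F ab.1 + F ab.2 - F (ab.1 * ab.2))) =
      F 1 - F (relator g) := by
  set P : (FreeGroup (Fin (2 * g)) × FreeGroup (Fin (2 * g)) →₀ ℤ) →+ ℝ :=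
    Finsupp.liftAddHom fun ab => (smulAddHom ℤ ℝ).flip (F ab.1 + F ab.2 - F (ab.1 * ab.2)) with hP
  have h1 : ((fundChain g).sum fun ab n => n • (F ab.1 + F ab.2 - F (ab.1 * ab.2))) =
      P (fundChain g) := rfl
  have h2 (i : Fin (2 * g)) (x : MonoidAlgebra ℤ (FreeGroup (Fin (2 * g)))) :
      P (Finsupp.mapDomain (fun w => (w, FreeGroup.of i)) x.coeff) =
        groupRingExt (fun w => F w + F (FreeGroup.of i) - F (w * FreeGroup.of i)) x := by
    induction x using MonoidAlgebra.induction_linear with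
    | zero => simp
    | add x y hx hy =>
      rw [MonoidAlgebra.coeff_add, Finsupp.mapDomain_add, map_add, hx, hy, map_add]
    | single w n =>
      rw [MonoidAlgebra.coeff_single, Finsupp.mapDomain_single, groupRingExt_single, hP,
        Finsupp.liftAddHom_apply_single]
      rfl
  rw [h1, fundChain, map_sum]
  simp only [h2, groupRingExt_boundary, augmentation_foxDeriv_relator, zero_smul, zero_sub,
    Finset.sum_neg_distrib, ← map_sum, sum_foxDeriv]
  rw [map_sub, MonoidAlgebra.of_apply, MonoidAlgebra.one_def, groupRingExt_single,
    groupRingExt_single]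
  simp

end FoxChain

/-! ### The conjugation action and its generating fields. -/

section ConjugationAction

variable {E : Type*} [NormedAddCommGroup E] [NormedSpace ℝ E]
  {G : Type*} [TopologicalSpace G] [ChartedSpace E G] [Group G]
  {F : Type*} [NormedAddCommGroup F] [NormedSpace ℝ F] {K : Type*} [TopologicalSpace K]
  {J : ModelWithCorners ℝ F K} {M : Type*} [TopologicalSpace M] [ChartedSpace K M]
  {F' : Type*} [NormedAddCommGroup F'] [NormedSpace ℝ F'] {K' : Type*} [TopologicalSpace K']
  {J' : ModelWithCorners ℝ F' K'} {N : Type*} [TopologicalSpace N] [ChartedSpace K' N]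
  {g : ℕ}

theorem mD_comp_of_eq {F'' : Type*} [NormedAddCommGroup F''] [NormedSpace ℝ F''] {K'' : Type*}
    [TopologicalSpace K''] {J'' : ModelWithCorners ℝ F'' K''} {P : Type*} [TopologicalSpace P]
    [ChartedSpace K'' P] {f : N → P} {k : M → N} {x : M} {y : N}
    (hf : MDifferentiableAt J' J'' f y) (hk : MDifferentiableAt J J' k x) (h : k x = y) (v : F) :
    mD J J'' (fun y => f (k y)) x v = mD J' J'' f y (mD J J' k x v) := by
  subst h
  exact mD_comp hf hk v

theorem mdifferentiableAt_to_prod {f : M → (Fin (2 * g) → G) × E} {x : M}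
    (h1 : ∀ i, MDifferentiableAt J 𝓘(ℝ, E) (fun y => (f y).1 i) x)
    (h2 : MDifferentiableAt J 𝓘(ℝ, E) (fun y => (f y).2) x) :
    MDifferentiableAt J (modelYg E g) f x :=
  MDifferentiableAt.prodMk (f := fun y => (f y).1) (g := fun y => (f y).2)
    (mdifferentiableAt_pi h1) h2

theorem mdifferentiableAt_prod_snd (p : (Fin (2 * g) → G) × E) :
    MDifferentiableAt (modelYg E g) 𝓘(ℝ, E) (fun p : (Fin (2 * g) → G) × E => p.2) p :=
  mdifferentiableAt_snd

variable [LieGroup 𝓘(ℝ, E) ∞ G]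

theorem logD_comp_of_eq {f : N → G} {k : M → N} {x : M} {y : N}
    (hf : MDifferentiableAt J' 𝓘(ℝ, E) f y) (hk : MDifferentiableAt J J' k x) (h : k x = y)
    (v : F) : logD E J (fun y => f (k y)) x v = logD E J' f y (mD J J' k x v) := by
  subst h
  exact logD_comp hf hk v

variable (E G) in
theorem mdifferentiableAt_word (w : FreeGroup (Fin (2 * g))) (p : (Fin (2 * g) → G) × E) :
    MDifferentiableAt (modelYg E g) 𝓘(ℝ, E)
      (fun p : (Fin (2 * g) → G) × E => evalWord w p.1) p :=
  mdifferentiableAt_evalWord (fun i => mdifferentiableAt_fst_proj E p i) w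

variable [FiniteDimensional ℝ E]

theorem mdifferentiableAt_Ad_one (v : E) :
    MDifferentiableAt 𝓘(ℝ, E) 𝓘(ℝ, E) (fun a : G => Ad a v) 1 ∧
      ∀ η, mD 𝓘(ℝ, E) 𝓘(ℝ, E) (fun a : G => Ad a v) 1 η = lieBr G η v := by
  haveI : IsManifold 𝓘(ℝ, E) 1 G := IsManifold.of_le (n := ∞) (by simp)
  set φ := extChartAt 𝓘(ℝ, E) (1 : G) with hφ
  have h1 := (contDiffAt_Ad (contMDiffAt_chartInv (E := E) (G := G))).differentiableAt (by simp)
  have h2 : HasFDerivAt (fun e => Ad (chartInv E G e) v) _ (chartOne E G) :=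
    h1.hasFDerivAt.clm_apply (hasFDerivAt_const v _)
  have h3 : MDifferentiableAt 𝓘(ℝ, E) 𝓘(ℝ, E) (fun e => Ad (chartInv E G e) v) (chartOne E G) :=
    h2.differentiableAt.mdifferentiableAt
  have h4 : MDifferentiableAt 𝓘(ℝ, E) 𝓘(ℝ, E) φ 1 := contMDiffAt_chart.mdifferentiableAt (by simp)
  have hev : (fun a : G => Ad a v) =ᶠ[𝓝 1] fun a => Ad (chartInv E G (φ a)) v := by
    filter_upwards [extChartAt_source_mem_nhds (I := 𝓘(ℝ, E)) (1 : G)] with a ha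
    have : chartInv E G (φ a) = a := φ.left_inv ha
    rw [this]
  refine ⟨(MDifferentiableAt.comp (1 : G) h3 h4).congr_of_eventuallyEq hev, fun η => ?_⟩
  rw [mD_congr hev, mD_comp_of_eq (f := fun e => Ad (chartInv E G e) v) h3 h4 rfl, mD_chart,
    mD_eq_fderiv, h2.fderiv, ← fderiv_Ad_chartInv]
  simp

theorem mdifferentiableAt_conj_one (x : G) :
    MDifferentiableAt 𝓘(ℝ, E) 𝓘(ℝ, E) (fun a : G => a * x * a⁻¹) 1 ∧
      ∀ η : E, logD E 𝓘(ℝ, E) (fun a : G => a * x * a⁻¹) 1 η = Ad x⁻¹ η - η := by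
  have hid : MDifferentiableAt 𝓘(ℝ, E) 𝓘(ℝ, E) (fun a : G => a) 1 := mdifferentiableAt_id
  refine ⟨MDiffAt.gmul (MDiffAt.gmul_const x hid) (MDiffAt.ginv hid), fun η => ?_⟩
  rw [logD_mul (MDiffAt.gmul_const x hid) (MDiffAt.ginv hid), logD_mul_const hid, logD_inv hid,
    logD_id_one]
  simp [Ad_one, sub_eq_add_neg]

theorem conjAct_one (p : (Fin (2 * g) → G) × E) : conjAct 1 p = p := by
  unfold conjAct
  refine Prod.ext (funext fun i => by simp) (Ad_one p.2)

theorem conjAct_mul (a b : G) (p : (Fin (2 * g) → G) × E) :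
    conjAct (a * b) p = conjAct a (conjAct b p) := by
  unfold conjAct
  exact Prod.ext (funext fun i => by simp [mul_assoc]) (Ad_mul a b p.2)

theorem evalWord_conjAct (w : FreeGroup (Fin (2 * g))) (a : G) (p : (Fin (2 * g) → G) × E) :
    evalWord w (conjAct a p).1 = a * evalWord w p.1 * a⁻¹ := evalWord_conj w a p.1

theorem mdifferentiableAt_conjAct (a : G) (p : (Fin (2 * g) → G) × E) :
    MDifferentiableAt (modelYg E g) (modelYg E g) (conjAct a) p := by
  refine mdifferentiableAt_to_prod (fun i => ?_) ?_
  · exact MDiffAt.gmul_const a⁻¹ (MDiffAt.const_gmul a (mdifferentiableAt_fst_proj E p i))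
  · have h : MDifferentiableAt 𝓘(ℝ, E) 𝓘(ℝ, E) (Ad a : E →L[ℝ] E) p.2 :=
      (Ad a : E →L[ℝ] E).differentiableAt.mdifferentiableAt
    exact h.comp p (mdifferentiableAt_prod_snd p)

theorem mdifferentiableAt_orbit (p : (Fin (2 * g) → G) × E) :
    MDifferentiableAt 𝓘(ℝ, E) (modelYg E g) (fun a : G => conjAct a p) 1 :=
  mdifferentiableAt_to_prod (fun i => (mdifferentiableAt_conj_one (p.1 i)).1)
    (mdifferentiableAt_Ad_one p.2).1

/-- The fundamental vector field of the conjugation action, with values in the model space. -/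
def conjField (η : E) (p : (Fin (2 * g) → G) × E) : (Fin (2 * g) → E) × E :=
  mD 𝓘(ℝ, E) (modelYg E g) (fun a : G => conjAct a p) 1 η

theorem conjField_snd (η : E) (p : (Fin (2 * g) → G) × E) :
    (conjField η p).2 = lieBr G η p.2 := by
  rw [← (mdifferentiableAt_Ad_one (G := G) p.2).2 η, ← mD_snd p]
  exact (mD_comp_of_eq (mdifferentiableAt_prod_snd p) (mdifferentiableAt_orbit p)
    (conjAct_one p) η).symm

/-- Evaluation on a word intertwines the action with conjugation on G, so only the orbit map a ↦ a x
a⁻¹ has to be differentiated. -/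
theorem logD_word_conjField (w : FreeGroup (Fin (2 * g))) (η : E)
    (p : (Fin (2 * g) → G) × E) :
    logD E (modelYg E g) (fun p : (Fin (2 * g) → G) × E => evalWord w p.1) p (conjField η p) =
      Ad (evalWord w p.1)⁻¹ η - η := by
  rw [← (mdifferentiableAt_conj_one _).2 η]
  refine (logD_comp_of_eq (mdifferentiableAt_word E G w p) (mdifferentiableAt_orbit p)
    (conjAct_one p) η).symm.trans ?_
  simp only [evalWord_conjAct]

theorem mD_conjAct_snd (a : G) (p : (Fin (2 * g) → G) × E) (v : (Fin (2 * g) → E) × E) :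
    (mD (modelYg E g) (modelYg E g) (conjAct a) p v).2 = Ad a v.2 := by
  rw [← mD_snd (conjAct a p)]
  refine (mD_comp (mdifferentiableAt_prod_snd (conjAct a p))
    (mdifferentiableAt_conjAct a p) v).symm.trans ?_
  have h : MDifferentiableAt 𝓘(ℝ, E) 𝓘(ℝ, E) (Ad a : E →L[ℝ] E) p.2 :=
    (Ad a : E →L[ℝ] E).differentiableAt.mdifferentiableAt
  refine (mD_comp (f := (Ad a : E →L[ℝ] E)) h (mdifferentiableAt_prod_snd p) v).trans ?_
  rw [mD_snd, mD_eq_fderiv]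
  simp

theorem logD_word_mD_conjAct (w : FreeGroup (Fin (2 * g))) (a : G)
    (p : (Fin (2 * g) → G) × E) (v : (Fin (2 * g) → E) × E) :
    logD E (modelYg E g) (fun p : (Fin (2 * g) → G) × E => evalWord w p.1) (conjAct a p)
        (mD (modelYg E g) (modelYg E g) (conjAct a) p v) =
      Ad a (logD E (modelYg E g) (fun p : (Fin (2 * g) → G) × E => evalWord w p.1) p v) := by
  refine (logD_comp (mdifferentiableAt_word E G w (conjAct a p))
    (mdifferentiableAt_conjAct a p) v).symm.trans ?_
  simp only [evalWord_conjAct]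
  exact logD_conj (mdifferentiableAt_word E G w p) a v

end ConjugationAction

/-! ### An explicit formula for the 2-form. -/

section OmegaTilde

variable {E : Type*} [NormedAddCommGroup E] [NormedSpace ℝ E]
  {G : Type*} [TopologicalSpace G] [ChartedSpace E G] [Group G]
  [LieGroup 𝓘(ℝ, E) ∞ G] [FiniteDimensional ℝ E]
  {B : E →L[ℝ] E →L[ℝ] ℝ} {g : ℕ}

/-- The logarithmic derivative of the evaluation on a word. -/
def wordD (w : FreeGroup (Fin (2 * g))) (p : (Fin (2 * g) → G) × E) :
    ((Fin (2 * g) → E) × E) →L[ℝ] E :=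
  logD E (modelYg E g) (fun p : (Fin (2 * g) → G) × E => evalWord w p.1) p

theorem mD_pair {a b : FreeGroup (Fin (2 * g))} (h : Fin (2 * g) → G) (v : Fin (2 * g) → E) :
    mD (modelY E g) (𝓘(ℝ, E).prod 𝓘(ℝ, E)) (fun h => (evalWord a h, evalWord b h)) h v =
      (mD (modelY E g) 𝓘(ℝ, E) (evalWord a) h v, mD (modelY E g) 𝓘(ℝ, E) (evalWord b) h v) :=
  mD_prodMk (mdifferentiableAt_evalWord (fun i => mdifferentiableAt_proj h i) a)
    (mdifferentiableAt_evalWord (fun i => mdifferentiableAt_proj h i) b) v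

theorem pullback_OmegaForm_apply (a b : FreeGroup (Fin (2 * g))) (h : Fin (2 * g) → G)
    (v : Fin 2 → (Fin (2 * g) → E)) :
    DForm.pullback (modelY E g) (𝓘(ℝ, E).prod 𝓘(ℝ, E))
      (fun h => (evalWord a h, evalWord b h)) (OmegaForm G B) h v =
    B (logD E (modelY E g) (evalWord a) h (v 0))
      (Ad (evalWord b h) (logD E (modelY E g) (evalWord b) h (v 1))) -
    B (logD E (modelY E g) (evalWord a) h (v 1))
      (Ad (evalWord b h) (logD E (modelY E g) (evalWord b) h (v 0))) := by
  have hd (w : FreeGroup (Fin (2 * g))) : MDifferentiableAt (modelY E g) 𝓘(ℝ, E)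
      (evalWord w : (Fin (2 * g) → G) → G) h :=
    mdifferentiableAt_evalWord (fun i => mdifferentiableAt_proj h i) w
  have hfst (q : G × G) (w : E × E) :
      mD (𝓘(ℝ, E).prod 𝓘(ℝ, E)) 𝓘(ℝ, E) (Prod.fst : G × G → G) q w = w.1 := by
    have : mfderiv (𝓘(ℝ, E).prod 𝓘(ℝ, E)) 𝓘(ℝ, E) (Prod.fst : G × G → G) q =
      ContinuousLinearMap.fst ℝ (TangentSpace 𝓘(ℝ, E) q.1) (TangentSpace 𝓘(ℝ, E) q.2) :=
      mfderiv_fst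
    unfold mD
    rw [this]; rfl
  have hsnd (q : G × G) (w : E × E) :
      mD (𝓘(ℝ, E).prod 𝓘(ℝ, E)) 𝓘(ℝ, E) (Prod.snd : G × G → G) q w = w.2 := by
    have : mfderiv (𝓘(ℝ, E).prod 𝓘(ℝ, E)) 𝓘(ℝ, E) (Prod.snd : G × G → G) q =
      ContinuousLinearMap.snd ℝ (TangentSpace 𝓘(ℝ, E) q.1) (TangentSpace 𝓘(ℝ, E) q.2) :=
      mfderiv_snd
    unfold mD
    rw [this]; rfl
  have hL (u : Fin (2 * g) → E) : mcL (evalWord a h) (mD (𝓘(ℝ, E).prod 𝓘(ℝ, E)) 𝓘(ℝ, E)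
      (Prod.fst : G × G → G) (evalWord a h, evalWord b h)
      (mD (modelY E g) (𝓘(ℝ, E).prod 𝓘(ℝ, E)) (fun h => (evalWord a h, evalWord b h)) h u)) =
      logD E (modelY E g) (evalWord a) h u := by
    rw [hfst, mD_pair, ← logD_apply_eq (hd a)]
  have hR (u : Fin (2 * g) → E) : mcR (evalWord b h) (mD (𝓘(ℝ, E).prod 𝓘(ℝ, E)) 𝓘(ℝ, E)
      (Prod.snd : G × G → G) (evalWord a h, evalWord b h)
      (mD (modelY E g) (𝓘(ℝ, E).prod 𝓘(ℝ, E)) (fun h => (evalWord a h, evalWord b h)) h u)) =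
      Ad (evalWord b h) (logD E (modelY E g) (evalWord b) h u) := by
    rw [hsnd, mD_pair, mcR_mfderiv (hd b)]
  have h3 (a a' b b' c c' d d' : E) (ha : a = a') (hb : b = b') (hc : c = c') (hd : d = d') :
      B a b - B c d = B a' b' - B c' d' := by rw [ha, hb, hc, hd]
  exact h3 _ _ _ _ _ _ _ _ (hL _) (hR _) (hL _) (hR _)

theorem omegaTilde_apply (p : (Fin (2 * g) → G) × E) (v : Fin 2 → (Fin (2 * g) → E) × E) :
    omegaTilde G B g p v =
      ((fundChain g).sum fun ab n => n •
        (B (wordD ab.1 p (v 0)) (Ad (evalWord ab.2 p.1) (wordD ab.2 p (v 1))) -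
          B (wordD ab.1 p (v 1)) (Ad (evalWord ab.2 p.1) (wordD ab.2 p (v 0))))) +
      sigmaE G B p.2 (fun i => (v i).2) := by
  let ev (h : Fin (2 * g) → G) (u : Fin 2 → Fin (2 * g) → E) :
      DForm (modelY E g) (Fin (2 * g) → G) 2 →+ ℝ :=
    { toFun := fun ψ => ψ h u
      map_zero' := rfl
      map_add' := fun _ _ => rfl }
  have h1 (h : Fin (2 * g) → G) (u : Fin 2 → Fin (2 * g) → E) : omegaForm G B g h u =
      (fundChain g).sum fun ab n => n • DForm.pullback (modelY E g) (𝓘(ℝ, E).prod 𝓘(ℝ, E))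
      (fun h => (evalWord ab.1 h, evalWord ab.2 h)) (OmegaForm G B) h u := by
    refine (map_sum (ev h u) _ _).trans ?_
    refine Finset.sum_congr rfl fun ab _ => ?_
    exact map_zsmul (ev h u) _ _
  have h2 : omegaTilde G B g p v =
      omegaForm G B g p.1 (fun i => mD (modelYg E g) (modelY E g) Prod.fst p (v i)) +
      sigmaE G B p.2 (fun i => mD (modelYg E g) 𝓘(ℝ, E)
        (fun p : (Fin (2 * g) → G) × E => p.2) p (v i)) := rfl
  have h3 (w : FreeGroup (Fin (2 * g))) (u : (Fin (2 * g) → E) × E) :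
      logD E (modelY E g) (evalWord w) p.1 (mD (modelYg E g) (modelY E g) Prod.fst p u) =
        wordD w p u :=
    (logD_comp (k := fun p : (Fin (2 * g) → G) × E => p.1)
      (mdifferentiableAt_evalWord (fun i => mdifferentiableAt_proj p.1 i) w)
      mdifferentiableAt_fst u).symm
  rw [h2, h1]
  simp only [pullback_OmegaForm_apply, h3, mD_snd]

end OmegaTilde

/-! ### Tangent spaces of X_β. -/

section TangentSpaces

variable {E : Type*} [NormedAddCommGroup E] [NormedSpace ℝ E]
  {G : Type*} [TopologicalSpace G] [ChartedSpace E G] [Group G]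
  [LieGroup 𝓘(ℝ, E) ∞ G] [FiniteDimensional ℝ E] [T2Space G]
  {B : E →L[ℝ] E →L[ℝ] ℝ} {g : ℕ} {β : G} {p : (Fin (2 * g) → G) × E}

theorem mem_extModuliTangent {v : (Fin (2 * g) → E) × E} :
    v ∈ extModuliTangent (E := E) β p ↔
      mD (modelYg E g) 𝓘(ℝ, E) (fun q : (Fin (2 * g) → G) × E => epsR q.1) p v =
        mD (modelYg E g) 𝓘(ℝ, E) (fun q : (Fin (2 * g) → G) × E => expBeta β q.2) p v := Iff.rfl

theorem expBeta_Ad (hβ : β ∈ Subgroup.center G) (a : G) (y : E) :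
    expBeta β (Ad a y) = a * expBeta β y * a⁻¹ := by
  unfold expBeta
  rw [lieExp_Ad, ← mul_assoc, ← mul_assoc, ← mul_assoc, Subgroup.mem_center_iff.1 hβ a]

theorem conjAct_mem_extModuli (hβ : β ∈ Subgroup.center G) (a : G)
    (hp : p ∈ extModuli E g β) : conjAct a p ∈ extModuli E g β :=
  (evalWord_conjAct (relator g) a p).trans
    ((congrArg (fun x => a * x * a⁻¹) hp).trans (expBeta_Ad hβ a p.2).symm)

variable (β) in
theorem mdifferentiableAt_expBeta_snd (p : (Fin (2 * g) → G) × E) :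
    MDifferentiableAt (modelYg E g) 𝓘(ℝ, E)
      (fun q : (Fin (2 * g) → G) × E => expBeta β q.2) p :=
  (mdifferentiableAt_expBeta β p.2).comp p (mdifferentiableAt_prod_snd p)

/-- This is where the constraint enters: on tangent vectors of X_β the logarithmic derivatives of
ε_R and e_β coincide, and left translation by β does not affect the latter. -/
theorem wordD_relator_of_tangent (hp : p ∈ extModuli E g β) {v : (Fin (2 * g) → E) × E}
    (hv : v ∈ extModuliTangent β p) :
    wordD (relator g) p v = jacobiOp 1 (lieBr G p.2) v.2 := by
  have h1 : wordD (relator g) p v =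
      logD E (modelYg E g) (fun q : (Fin (2 * g) → G) × E => expBeta β q.2) p v := by
    have h2 : ∀ (x y : G) (u w : E), x = y → u = w →
        (mcL x : E →L[ℝ] E) u = (mcL y : E →L[ℝ] E) w := by
      rintro x _ u _ rfl rfl; rfl
    rw [logD_apply_eq (mdifferentiableAt_expBeta_snd β p)]
    exact (logD_apply_eq (mdifferentiableAt_word E G (relator g) p) v).trans
      (h2 _ _ _ _ hp (mem_extModuliTangent.1 hv))
  rw [h1, logD_comp (mdifferentiableAt_expBeta β p.2) (mdifferentiableAt_prod_snd p), mD_snd,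
    logD_expBeta]

theorem mD_conjAct_mem (hβ : β ∈ Subgroup.center G) (a : G) (hp : p ∈ extModuli E g β)
    {v : (Fin (2 * g) → E) × E} (hv : v ∈ extModuliTangent β p) :
    mD (modelYg E g) (modelYg E g) (conjAct a) p v ∈
      extModuliTangent (E := E) β (conjAct a p) := by
  rw [mem_extModuliTangent]
  have hc (x : G) : MDifferentiableAt 𝓘(ℝ, E) 𝓘(ℝ, E) (fun x : G => a * x * a⁻¹) x :=
    MDiffAt.gmul_const a⁻¹ (mdifferentiableAt_mul_left a x)
  have h1 := mD_comp (k := fun q : (Fin (2 * g) → G) × E => evalWord (relator g) q.1)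
    (hc (evalWord (relator g) p.1)) (mdifferentiableAt_word E G (relator g) p) v
  have h2 := mD_comp_of_eq (hc (evalWord (relator g) p.1)) (mdifferentiableAt_expBeta_snd β p)
    hp.symm v
  have h3 := mD_comp (mdifferentiableAt_word E G (relator g) (conjAct a p))
    (mdifferentiableAt_conjAct a p) v
  have h4 := mD_comp (mdifferentiableAt_expBeta_snd β (conjAct a p))
    (mdifferentiableAt_conjAct a p) v
  simp only [evalWord_conjAct] at h3
  have h5 (q : (Fin (2 * g) → G) × E) : expBeta β (conjAct a q).2 = a * expBeta β q.2 * a⁻¹ :=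
    expBeta_Ad hβ a q.2
  simp only [h5] at h4
  refine h3.symm.trans (h1.trans (Eq.trans ?_ (h2.symm.trans h4)))
  exact congrArg _ (mem_extModuliTangent.1 hv)

/-- The orbit of p stays in X_β, so ε_R and e_β agree along the orbit map and so do their
derivatives. -/
theorem conjField_mem (hβ : β ∈ Subgroup.center G) (η : E) (hp : p ∈ extModuli E g β) :
    conjField η p ∈ extModuliTangent (E := E) β p := by
  rw [mem_extModuliTangent]
  have h1 := mD_comp_of_eq (mdifferentiableAt_word E G (relator g) p) (mdifferentiableAt_orbit p)
    (conjAct_one p) η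
  have h2 := mD_comp_of_eq (mdifferentiableAt_expBeta_snd β p) (mdifferentiableAt_orbit p)
    (conjAct_one p) η
  have h3 : (fun a : G => evalWord (relator g) (conjAct a p).1) =
      fun a => expBeta β (conjAct a p).2 := funext fun a => conjAct_mem_extModuli hβ a hp
  rw [h3] at h1
  exact h1.symm.trans h2

end TangentSpaces

/-! ### Invariance and the moment map equation. -/

section TwoForm

variable {E : Type*} [NormedAddCommGroup E] [NormedSpace ℝ E]
  {G : Type*} [TopologicalSpace G] [ChartedSpace E G] [Group G]
  [LieGroup 𝓘(ℝ, E) ∞ G] [FiniteDimensional ℝ E] [T2Space G]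
  {B : E →L[ℝ] E →L[ℝ] ℝ} {g : ℕ} {β : G}

theorem omegaTilde_pair (p : (Fin (2 * g) → G) × E) (u v : (Fin (2 * g) → E) × E) :
    omegaTilde G B g p ![u, v] =
      ((fundChain g).sum fun ab n => n •
        (B (wordD ab.1 p u) (Ad (evalWord ab.2 p.1) (wordD ab.2 p v)) -
          B (wordD ab.1 p v) (Ad (evalWord ab.2 p.1) (wordD ab.2 p u)))) +
      sigmaE G B p.2 ![u.2, v.2] := by
  have h : (fun i => ((![u, v] : Fin 2 → (Fin (2 * g) → E) × E) i).2) = ![u.2, v.2] := by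
    ext i; fin_cases i <;> rfl
  exact (omegaTilde_apply p _).trans (congrArg₂ (· + ·) rfl (congrArg (sigmaE G B p.2) h))

theorem omegaTilde_conjAct (hB : IsInvariantInner G B) (a : G) (p : (Fin (2 * g) → G) × E)
    (u v : (Fin (2 * g) → E) × E) :
    omegaTilde G B g (conjAct a p) ![mD (modelYg E g) (modelYg E g) (conjAct a) p u,
      mD (modelYg E g) (modelYg E g) (conjAct a) p v] = omegaTilde G B g p ![u, v] := by
  have h1 (w : FreeGroup (Fin (2 * g))) (v : (Fin (2 * g) → E) × E) :
      wordD w (conjAct a p) (mD (modelYg E g) (modelYg E g) (conjAct a) p v) =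
        Ad a (wordD w p v) := logD_word_mD_conjAct w a p v
  have h2 : (conjAct a p).2 = Ad a p.2 := rfl
  refine (omegaTilde_pair _ _ _).trans (Eq.trans ?_ (omegaTilde_pair _ _ _).symm)
  simp only [h1, mD_conjAct_snd, evalWord_conjAct, Ad_mul, Ad_inv_Ad, hB.inv, h2, sigmaE_Ad hB]

theorem wordD_mul (a b : FreeGroup (Fin (2 * g))) (p : (Fin (2 * g) → G) × E)
    (v : (Fin (2 * g) → E) × E) :
    wordD (a * b) p v = Ad (evalWord b p.1)⁻¹ (wordD a p v) + wordD b p v := by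
  unfold wordD
  simp only [evalWord_mul]
  exact logD_mul (mdifferentiableAt_word E G a p) (mdifferentiableAt_word E G b p) v

theorem wordD_one (p : (Fin (2 * g) → G) × E) (v : (Fin (2 * g) → E) × E) :
    wordD 1 p v = 0 := by
  unfold wordD
  simp only [evalWord_one]
  exact logD_const 1 p v

theorem IsInvariantInner.Ad_right (hB : IsInvariantInner G B) (a : G) (x y : E) :
    B x (Ad a y) = B (Ad a⁻¹ x) y := by
  rw [← hB.inv a (Ad a⁻¹ x), Ad_Ad_inv]

/-- The contraction of ω telescopes over the chain c to θ_η at the relator, since θ_η vanishes at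
the trivial word. On tangent vectors this equals e_β^*θ_η, which `sigmaE_moment` supplies with the
opposite sign. -/
theorem omegaTilde_conjField (hB : IsInvariantInner G B) (hβ : β ∈ Subgroup.center G) (η : E)
    {p : (Fin (2 * g) → G) × E} (hp : p ∈ extModuli E g β) {v : (Fin (2 * g) → E) × E}
    (hv : v ∈ extModuliTangent β p) :
    omegaTilde G B g p ![conjField η p, v] = 2 * B η v.2 := by
  set θ : FreeGroup (Fin (2 * g)) → ℝ := fun w =>
    B η (wordD w p v + Ad (evalWord w p.1) (wordD w p v)) with hθ
  have hw (w : FreeGroup (Fin (2 * g))) :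
      wordD w p (conjField η p) = Ad (evalWord w p.1)⁻¹ η - η := logD_word_conjField w η p
  -- Up to sign, contracting with the field of η turns the pullback of Ω into the deviation of θ_η
  -- from additivity, the form that `sum_fundChain` evaluates.
  have hab (a b : FreeGroup (Fin (2 * g))) :
      B (Ad (evalWord a p.1)⁻¹ η - η) (Ad (evalWord b p.1) (wordD b p v)) -
        B (wordD a p v) (Ad (evalWord b p.1) (Ad (evalWord b p.1)⁻¹ η - η)) =
      -(θ a + θ b - θ (a * b)) := by
    simp only [hθ, wordD_mul, evalWord_mul, Ad_mul, map_add, map_sub, Ad_Ad_inv, sub_apply]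
    have h1 := hB.Ad_right (evalWord a p.1) η (Ad (evalWord b p.1) (wordD b p v))
    have h2 := hB.Ad_right (evalWord b p.1)⁻¹ η (wordD a p v)
    rw [inv_inv] at h2
    linarith [hB.symm (wordD a p v) η, hB.symm (wordD a p v) (Ad (evalWord b p.1) η)]
  have hR : Ad (evalWord (relator g) p.1) (wordD (relator g) p v) =
      Ad (lieExp G p.2) (jacobiOp 1 (lieBr G p.2) v.2) := by
    have : evalWord (relator g) p.1 = β * lieExp G p.2 := hp
    rw [this, Ad_mul, Ad_of_mem_center hβ, wordD_relator_of_tangent hp hv]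
  refine (omegaTilde_pair p _ v).trans ?_
  rw [conjField_snd, sigmaE_moment hB]
  simp only [hw, hab, smul_neg]
  have hs := sum_fundChain g θ
  unfold Finsupp.sum at hs ⊢
  rw [Finset.sum_neg_distrib, hs, hθ]
  simp only [hR]
  simp only [wordD_one, wordD_relator_of_tangent hp hv]
  simp

theorem pullback_pair {F : Type*} [NormedAddCommGroup F] [NormedSpace ℝ F] {K : Type*}
    [TopologicalSpace K] {J : ModelWithCorners ℝ F K} {M : Type*} [TopologicalSpace M]
    [ChartedSpace K M] (f : M → M) (ψ : DForm J M 2) (x : M) (u v : F) :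
    DForm.pullback J J f ψ x ![u, v] = ψ (f x) ![mD J J f x u, mD J J f x v] := by
  have h : (fun i => mD J J f x ((![u, v] : Fin 2 → F) i)) = ![mD J J f x u, mD J J f x v] := by
    ext i; fin_cases i <;> rfl
  exact congrArg (ψ (f x)) h

theorem inner_mD_two_smul_snd (η : E) (p : (Fin (2 * g) → G) × E) (v : (Fin (2 * g) → E) × E) :
    B η (mD (modelYg E g) 𝓘(ℝ, E) (fun p : (Fin (2 * g) → G) × E => (2 : ℝ) • p.2) p v) =
      2 * B η v.2 := by
  have h : HasFDerivAt (fun y : E => (2 : ℝ) • y) ((2 : ℝ) • ContinuousLinearMap.id ℝ E) p.2 :=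
    (hasFDerivAt_id p.2).const_smul (2 : ℝ)
  rw [mD_comp (f := fun y : E => (2 : ℝ) • y) h.differentiableAt.mdifferentiableAt
    (mdifferentiableAt_prod_snd p), mD_snd, mD_eq_fderiv, h.fderiv]
  simp

theorem pullback_snd_extDeriv (hβ : β ∈ Subgroup.center G) (η : E) (p : (Fin (2 * g) → G) × E)
    (v : (Fin (2 * g) → E) × E) :
    DForm.pullback (modelYg E g) 𝓘(ℝ, E) (Prod.snd : (Fin (2 * g) → G) × E → E)
      (extDeriv (homotopyOp (expTheta G B β η))) p ![v] = 2 * B η v.2 :=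
  (extDeriv_homotopyOp_expTheta hβ η p.2 fun i =>
    mD (modelYg E g) 𝓘(ℝ, E) (fun p : (Fin (2 * g) → G) × E => p.2) p
      ((![v] : Fin 1 → (Fin (2 * g) → E) × E) i)).trans
    (congrArg (fun w => 2 * B η w) (mD_snd p v))

end TwoForm

/-! ### Exterior derivatives of finite linear combinations. -/

section ExtDerivSum

variable {V : Type*} [NormedAddCommGroup V] [NormedSpace ℝ V]

theorem extDeriv_sum_smul {ι : Type*} {n : ℕ} (s : Finset ι) (c : ι → ℝ)
    {φ : ι → V → V [⋀^Fin n]→L[ℝ] ℝ} {x : V} (h : ∀ i ∈ s, DifferentiableAt ℝ (φ i) x) :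
    DifferentiableAt ℝ (∑ i ∈ s, c i • φ i) x ∧
      extDeriv (∑ i ∈ s, c i • φ i) x = ∑ i ∈ s, c i • extDeriv (φ i) x := by
  classical
  induction s using Finset.induction_on with
  | empty =>
    refine ⟨by simp, ?_⟩
    have h0 := extDeriv_smul (𝕜 := ℝ) (x := x) 0 (0 : V → V [⋀^Fin n]→L[ℝ] ℝ)
    rw [zero_smul, zero_smul] at h0
    simpa using h0
  | insert a s ha ih =>
    obtain ⟨h1, h2⟩ := ih fun i hi => h i (Finset.mem_insert_of_mem hi)
    have h3 : DifferentiableAt ℝ (c a • φ a) x := (h a (Finset.mem_insert_self a s)).const_smul (c a)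
    rw [Finset.sum_insert ha, Finset.sum_insert ha]
    exact ⟨h3.add h1, by rw [extDeriv_add h3 h1, extDeriv_smul, h2]⟩

end ExtDerivSum

/-! ### Closedness of the 2-form on X_β. -/

section Closed

variable {E : Type*} [NormedAddCommGroup E] [NormedSpace ℝ E]
  {G : Type*} [TopologicalSpace G] [ChartedSpace E G] [Group G]
  [LieGroup 𝓘(ℝ, E) ∞ G] [FiniteDimensional ℝ E] [T2Space G]
  {B : E →L[ℝ] E →L[ℝ] ℝ} {g : ℕ} {β : G}

/-- Evaluation on a word, in the preferred chart at a point. -/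
def chartWord (p : (Fin (2 * g) → G) × E) (w : FreeGroup (Fin (2 * g)))
    (e : (Fin (2 * g) → E) × E) : G :=
  evalWord w ((extChartAt (modelYg E g) p).symm e).1

theorem contMDiffAt_chartWord (p : (Fin (2 * g) → G) × E) (w : FreeGroup (Fin (2 * g))) :
    ContMDiffAt 𝓘(ℝ, (Fin (2 * g) → E) × E) 𝓘(ℝ, E) ∞ (chartWord p w)
      (extChartAt (modelYg E g) p p) :=
  contMDiffAt_evalWord (contMDiffAt_chart_symm_fst p) w

theorem wordD_mD_chart_symm {p : (Fin (2 * g) → G) × E} {e : (Fin (2 * g) → E) × E}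
    (he : MDifferentiableAt 𝓘(ℝ, (Fin (2 * g) → E) × E) (modelYg E g)
      (extChartAt (modelYg E g) p).symm e) (w : FreeGroup (Fin (2 * g)))
    (v : (Fin (2 * g) → E) × E) :
    wordD w ((extChartAt (modelYg E g) p).symm e)
        (mD 𝓘(ℝ, (Fin (2 * g) → E) × E) (modelYg E g) (extChartAt (modelYg E g) p).symm e v) =
      logD E 𝓘(ℝ, (Fin (2 * g) → E) × E) (chartWord p w) e v :=
  (logD_comp (mdifferentiableAt_word E G w _) he v).symm

theorem mD_chart_symm_snd {p : (Fin (2 * g) → G) × E} {e : (Fin (2 * g) → E) × E}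
    (he : MDifferentiableAt 𝓘(ℝ, (Fin (2 * g) → E) × E) (modelYg E g)
      (extChartAt (modelYg E g) p).symm e) (v : (Fin (2 * g) → E) × E) :
    (mD 𝓘(ℝ, (Fin (2 * g) → E) × E) (modelYg E g) (extChartAt (modelYg E g) p).symm e v).2 =
      v.2 := by
  rw [← mD_snd ((extChartAt (modelYg E g) p).symm e)]
  refine (mD_comp (mdifferentiableAt_prod_snd _) he v).symm.trans ?_
  have h : mD 𝓘(ℝ, (Fin (2 * g) → E) × E) 𝓘(ℝ, E) (fun e : (Fin (2 * g) → E) × E => e.2) e v =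
      v.2 := by
    rw [mD_eq_fderiv, fderiv_snd]; rfl
  exact h

theorem mD_chart_symm_self (p : (Fin (2 * g) → G) × E) (v : (Fin (2 * g) → E) × E) :
    mD 𝓘(ℝ, (Fin (2 * g) → E) × E) (modelYg E g) (extChartAt (modelYg E g) p).symm
      (extChartAt (modelYg E g) p p) v = v := by
  have h1 := (eventually_mdifferentiableAt_chart_symm p).self_of_nhds
  have h2 := hasMFDerivAt_extChartAt_self (modelYg E g) p
  have h3 := mD_comp h1 h2.mdifferentiableAt v
  have h4 : mD (modelYg E g) 𝓘(ℝ, (Fin (2 * g) → E) × E) (extChartAt (modelYg E g) p) p v = v := by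
    unfold mD
    rw [h2.mfderiv]; rfl
  rw [h4] at h3
  rw [← h3, mD_congr (k := fun q => q), mD_id]
  filter_upwards [extChartAt_source_mem_nhds (I := modelYg E g) p] with q hq
  exact (extChartAt (modelYg E g) p).left_inv hq

theorem logD_chartWord (p : (Fin (2 * g) → G) × E) (w : FreeGroup (Fin (2 * g)))
    (v : (Fin (2 * g) → E) × E) :
    logD E 𝓘(ℝ, (Fin (2 * g) → E) × E) (chartWord p w) (extChartAt (modelYg E g) p p) v =
      wordD w p v := by
  have h := logD_comp_of_eq (mdifferentiableAt_word E G w p)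
    (eventually_mdifferentiableAt_chart_symm p).self_of_nhds (extChartAt_to_inv p) v
  rw [mD_chart_symm_self] at h
  exact h

theorem pullback_chart_omegaTilde_apply {p : (Fin (2 * g) → G) × E} {e : (Fin (2 * g) → E) × E}
    (he : MDifferentiableAt 𝓘(ℝ, (Fin (2 * g) → E) × E) (modelYg E g)
      (extChartAt (modelYg E g) p).symm e) (v : Fin 2 → (Fin (2 * g) → E) × E) :
    DForm.pullback 𝓘(ℝ, (Fin (2 * g) → E) × E) (modelYg E g) (extChartAt (modelYg E g) p).symm
      (omegaTilde G B g) e v =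
    ((fundChain g).sum fun ab n => n • pairForm B (chartWord p ab.1) (chartWord p ab.2) e v) +
      sigmaE G B e.2 (fun i => (v i).2) := by
  have h1 := omegaTilde_apply (B := B) ((extChartAt (modelYg E g) p).symm e) fun i =>
    mD 𝓘(ℝ, (Fin (2 * g) → E) × E) (modelYg E g) (extChartAt (modelYg E g) p).symm e (v i)
  refine h1.trans ?_
  simp only [wordD_mD_chart_symm he, mD_chart_symm_snd he]
  rfl

/-- The chart leaves the Lie algebra factor untouched, so σ is only composed with the linear
projection. Equality on a neighbourhood is what allows the exterior derivative to be taken. -/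
theorem pullback_chart_omegaTilde (p : (Fin (2 * g) → G) × E) :
    DForm.pullback 𝓘(ℝ, (Fin (2 * g) → E) × E) (modelYg E g) (extChartAt (modelYg E g) p).symm
      (omegaTilde G B g) =ᶠ[𝓝 (extChartAt (modelYg E g) p p)]
    (∑ ab ∈ (fundChain g).support,
        (fundChain g ab : ℝ) • pairForm B (chartWord p ab.1) (chartWord p ab.2)) +
      fun e => (sigmaE G B e.2).compContinuousLinearMap
        (fderiv ℝ (fun e : (Fin (2 * g) → E) × E => e.2) e) := by
  filter_upwards [eventually_mdifferentiableAt_chart_symm p] with e he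
  have h (v : Fin 2 → (Fin (2 * g) → E) × E) :
      ((fundChain g).sum fun ab n => n • pairForm B (chartWord p ab.1) (chartWord p ab.2) e v) +
        sigmaE G B e.2 (fun i => (v i).2) =
      ((∑ ab ∈ (fundChain g).support,
        (fundChain g ab : ℝ) • pairForm B (chartWord p ab.1) (chartWord p ab.2)) +
      fun e => (sigmaE G B e.2).compContinuousLinearMap
        (fderiv ℝ (fun e : (Fin (2 * g) → E) × E => e.2) e)) e v := by
    rw [Pi.add_apply, Finset.sum_apply, fderiv_snd, ContinuousAlternatingMap.add_apply,
      ContinuousAlternatingMap.sum_apply]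
    exact congrArg₂ (· + ·) (Finset.sum_congr rfl fun ab _ => zsmul_eq_mul _ _) rfl
  exact ContinuousAlternatingMap.ext fun v => (pullback_chart_omegaTilde_apply he v).trans (h v)

theorem extDeriv_sigmaE_snd (hB : IsInvariantInner G B) (x : (Fin (2 * g) → E) × E)
    (v : Fin 3 → (Fin (2 * g) → E) × E) :
    DifferentiableAt ℝ (fun e : (Fin (2 * g) → E) × E => (sigmaE G B e.2).compContinuousLinearMap
        (fderiv ℝ (fun e : (Fin (2 * g) → E) × E => e.2) e)) x ∧
    extDeriv (fun e : (Fin (2 * g) → E) × E => (sigmaE G B e.2).compContinuousLinearMap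
        (fderiv ℝ (fun e : (Fin (2 * g) → E) × E => e.2) e)) x v =
      expLambda G B x.2 (fun i => (v i).2) := by
  refine ⟨differentiableAt_alternating fun v => ?_, ?_⟩
  · simp only [fderiv_snd]
    have h : DifferentiableAt ℝ (fun e : (Fin (2 * g) → E) × E => sigmaE G B e.2) x :=
      ((differentiable_sigmaE hB) x.2).comp x differentiableAt_snd
    exact (ContinuousAlternatingMap.apply ℝ E ℝ fun i => (v i).2).differentiableAt.comp x h
  · rw [extDeriv_pullback (r := ⊤)
      (f := fun e : (Fin (2 * g) → E) × E => e.2) ((differentiable_sigmaE hB) x.2)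
      contDiffAt_snd (by simp), extDeriv_sigmaE hB, fderiv_snd]
    rfl

/-- By Polyakov–Wiegmann the chain sum telescopes to minus ε_R^*λ, the trivial word contributing
nothing. The differential of σ is exp^*λ, and the two agree on tangent vectors. -/
theorem d_omegaTilde_eq_zero (hB : IsInvariantInner G B) {p : (Fin (2 * g) → G) × E}
    (hp : p ∈ extModuli E g β) (v : Fin 3 → (Fin (2 * g) → E) × E)
    (hv : ∀ i, v i ∈ extModuliTangent (E := E) β p) :
    DForm.d (modelYg E g) (omegaTilde G B g) p v = 0 := by
  set x := extChartAt (modelYg E g) p p with hx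
  have hs := extDeriv_sum_smul (fundChain g).support (fun ab => (fundChain g ab : ℝ))
    (φ := fun ab => pairForm B (chartWord p ab.1) (chartWord p ab.2)) (x := x)
    fun ab _ => differentiableAt_pairForm (contMDiffAt_chartWord p ab.1)
      (contMDiffAt_chartWord p ab.2)
  have hσ := extDeriv_sigmaE_snd hB x v
  have h1 := (pullback_chart_omegaTilde (B := B) p).extDeriv_eq
  have h2 : extDeriv (E := (Fin (2 * g) → E) × E)
      (DForm.pullback 𝓘(ℝ, (Fin (2 * g) → E) × E) (modelYg E g)
        (extChartAt (modelYg E g) p).symm (omegaTilde G B g)) x v =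
      ((fundChain g).sum fun ab n => n •
        (lambdaVal B (chartWord p ab.1) x v + lambdaVal B (chartWord p ab.2) x v -
          lambdaVal B (chartWord p (ab.1 * ab.2)) x v)) +
      expLambda G B p.2 (fun i => (v i).2) := by
    rw [h1, extDeriv_add hs.1 hσ.1, hs.2]
    rw [ContinuousAlternatingMap.add_apply, hσ.2, ContinuousAlternatingMap.sum_apply]
    refine congrArg₂ (· + ·) (Finset.sum_congr rfl fun ab _ => ?_) rfl
    rw [ContinuousAlternatingMap.smul_apply, extDeriv_pairForm hB (contMDiffAt_chartWord p ab.1)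
      (contMDiffAt_chartWord p ab.2)]
    have h3 : (fun y => chartWord p ab.1 y * chartWord p ab.2 y) = chartWord p (ab.1 * ab.2) :=
      funext fun y => (evalWord_mul _ _ _).symm
    rw [h3]
    exact (zsmul_eq_mul _ _).symm
  rw [DForm_d_apply]
  refine h2.trans ?_
  rw [sum_fundChain g fun w => lambdaVal B (chartWord p w) x v, expLambda_apply hB]
  simp only [lambdaVal, hx, logD_chartWord, wordD_one, wordD_relator_of_tangent hp (hv _)]
  simp

end Closed

end ExtendedModuli

end

/-! ### Assembly of the proposition. -/

theorem propositionp5p3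
    {E : Type*} [NormedAddCommGroup E] [NormedSpace ℝ E] [FiniteDimensional ℝ E]
    {G : Type*} [TopologicalSpace G] [T2Space G] [CompactSpace G] [ConnectedSpace G]
    [ChartedSpace E G] [Group G] [LieGroup 𝓘(ℝ, E) ∞ G]
    (B : E →L[ℝ] E →L[ℝ] ℝ) (hB : ExtendedModuli.IsInvariantInner G B)
    (g : ℕ) (β : G) (hβ : β ∈ Subgroup.center G) :
    ExtendedModuli.IsHamiltonianOn (G := G) (ExtendedModuli.modelYg E g) B
        ExtendedModuli.conjAct (ExtendedModuli.extModuli E g β)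
        (ExtendedModuli.extModuliTangent β) (ExtendedModuli.omegaTilde G B g)
        (fun p => (2 : ℝ) • p.2) ∧
      (∀ η : E, ∀ p ∈ ExtendedModuli.extModuli E g β,
        ∀ v ∈ ExtendedModuli.extModuliTangent β p,
          ExtendedModuli.omegaTilde G B g p
              ![ExtendedModuli.fundField (G := G) (ExtendedModuli.modelYg E g)
                  ExtendedModuli.conjAct η p, v] =
            ExtendedModuli.DForm.pullback (ExtendedModuli.modelYg E g) 𝓘(ℝ, E) Prod.snd
              (extDeriv (ExtendedModuli.homotopyOp (V := E)
                (ExtendedModuli.DForm.pullback 𝓘(ℝ, E) 𝓘(ℝ, E) (ExtendedModuli.expBeta β)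
                  (ExtendedModuli.thetaForm G B η)))) p ![v]) ∧
      (∀ η Λ : E,
        ExtendedModuli.homotopyOp (V := E)
            (ExtendedModuli.DForm.pullback 𝓘(ℝ, E) 𝓘(ℝ, E) (ExtendedModuli.expBeta β)
              (ExtendedModuli.thetaForm G B η)) Λ ![] = B η ((2 : ℝ) • Λ)) := by
  refine ⟨⟨fun p _ => ExtendedModuli.conjAct_one p,
    fun a b p _ => ExtendedModuli.conjAct_mul a b p,
    fun a p hp => ExtendedModuli.conjAct_mem_extModuli hβ a hp,
    fun a p hp v hv => ExtendedModuli.mD_conjAct_mem hβ a hp hv,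
    fun η p hp => ExtendedModuli.conjField_mem hβ η hp,
    fun p hp u hu v hv w hw => ExtendedModuli.d_omegaTilde_eq_zero hB hp ![u, v, w] fun i => ?_,
    fun a p _ u _ v _ => ?_, fun η p hp v hv => ?_, fun a p _ => ?_⟩,
    fun η p hp v hv => ?_, fun η y => ?_⟩
  · fin_cases i
    exacts [hu, hv, hw]
  · exact (ExtendedModuli.pullback_pair _ _ _ _ _).trans
      (ExtendedModuli.omegaTilde_conjAct hB a p u v)
  · exact (ExtendedModuli.omegaTilde_conjField hB hβ η hp hv).trans
      (ExtendedModuli.inner_mD_two_smul_snd η p v).symm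
  · exact (map_smul (ExtendedModuli.Ad a) (2 : ℝ) p.2).symm
  · exact (ExtendedModuli.omegaTilde_conjField hB hβ η hp hv).trans
      (ExtendedModuli.pullback_snd_extDeriv hβ η p v).symm
  · refine (ExtendedModuli.homotopyOp_expTheta hβ η y _).trans ?_
    rw [map_smul, smul_eq_mul]
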